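/- **Setting.** The programming language is call-by-value PCF with unit, booleans, naturals, products, sums, equi-recursive types and ML-style references: the types are $\alpha ::= \mathsf{Unit}\mid\mathsf{Bool}\mid\mathsf{Nat}\mid\alpha\Rightarrow\beta\mid\alpha\times\beta\mid\alpha+\beta\mid\mathsf{Ref}(\alpha)\mid X\mid\mu X.\alpha$, and the first-order operations include equality of references. A *model* of type $\Gamma$ is $\mathcal M=(\nu\vec l)(\xi,\sigma)$, where the environment $\xi$ maps the variables of $\Gamma$ to closed values (and its type variables to closed types), the store $\sigma$ maps exactly the free locations (those of $\Gamma$) and the hidden ones $\vec l$ to closed values, and all these are well typed; $\cong$ is contextual congruence of models. The assertions are built from equations $e=e'$ between logical terms (variables, constants, locations, first-order operations, pairs, injections, dereferences $!e$) and reachability predicates $e\hookrightarrow e'$ ($e'$ of a reference type) by $\neg,\wedge,\vee,\supset$, the quantifiers $\forall x^\alpha,\exists x^\alpha$, the hiding quantifiers $\nu x,\overline\nu x$, the type quantifiers $\forall X,\exists X$, the content quantifiers $[!e]C,\langle !e\rangle C$, the (possibly located) evaluation formulae $e\bullet e'=x\{C\}$, and $\square,\Diamond$; $e\,\#\,e'$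 abbreviates $\neg(e'\hookrightarrow e)$. By definition, $\mathcal M\models e_1=e_2$ iff $\mathcal M[u:e_1]\cong\mathcal M[u:e_2]$ (and this is false for terms of different types), and $\mathcal M\models e_1\hookrightarrow e_2$ iff, for every $(\nu\vec l)(\xi,\sigma)\cong\mathcal M$, the location denoted by $e_2$ belongs to the least set that contains the locations occurring in the value of $e_1$ and, with each $l$, the locations occurring in $\sigma(l)$. Quantified variables range over the results of those programs whose execution leaves every model of the given type unchanged up to $\cong$. Write $C\equiv C'$ if $C$ and $C'$ hold in the same models of every type under which they are well typed. A type is *finite* if it contains no function type and no type variable (hence no recursive type); $e\hookrightarrow e'$ is *finite* if $e$ has a finite type. For a finite type $\alpha$, a term $x$ of type $\alpha$ and a term $y$ of type $\mathsf{Ref}(\beta)$, define formulae $x\hookrightarrow^\circ y$ by recursion on $\alpha$, where $B$ is a base type: $$\begin{aligned} x^{B}\hookrightarrow^\circ y&:=\mathsf F,\\ x^{\alpha_1\times\alpha_2}\hookrightarrow^\circ y&:=\exists x_1^{\alpha_1},x_2^{\alpha_2}.\big(x=\langle x_1,x_2\rangle\wedge(x_1\hookrightarrow^\circ y\vee x_2\hookrightarrow^\circ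 y)\big),\\ x^{\alpha_1+\alpha_2}\hookrightarrow^\circ y&:=\textstyle\bigvee_{i=1,2}\exists x'^{\alpha_i}.\big(x=\mathsf{in}_i(x')\wedge x'\hookrightarrow^\circ y\big),\\ x^{\mathsf{Ref}(\alpha)}\hookrightarrow^\circ y&:=x=y\ \vee\ {!x}\hookrightarrow^\circ y,\end{aligned}$$ and formulae $x\hookrightarrow_i y$ ("$y$ is reachable from $x$ in at most $i$ steps") by recursion on $i\in\mathbb N$: $$\begin{aligned} x\hookrightarrow_0 y&:=(x=y),\qquad x^{B}\hookrightarrow_{n+1}y:=\mathsf F,\\ x^{\alpha_1\times\alpha_2}\hookrightarrow_{n+1}y&:=\exists x_1^{\alpha_1},x_2^{\alpha_2}.\big(x=\langle x_1,x_2\rangle\wedge(x_1\hookrightarrow_n y\vee x_2\hookrightarrow_n y)\big)\vee x\hookrightarrow_n y,\\ x^{\alpha_1+\alpha_2}\hookrightarrow_{n+1}y&:=\textstyle\bigvee_{i=1,2}\exists x'^{\alpha_i}.\big(x=\mathsf{in}_i(x')\wedge x'\hookrightarrow_n y\big)\vee x\hookrightarrow_n y,\\ x^{\mathsf{Ref}(\alpha)}\hookrightarrow_{n+1}y&:={!x}\hookrightarrow_n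 y\ \vee\ x\hookrightarrow_n y .\end{aligned}$$ Bound variables are chosen fresh. **Theorem.** 1. Let $C$ be an assertion that is well typed under $\Gamma$ and in which every reachability predicate is finite. Then there is an assertion $C'$, well typed under $\Gamma$, in which no reachability predicate occurs and for which $C\equiv C'$. 2. Let $\alpha$ be finite, $x$ a term of type $\alpha$ and $y$ a term of type $\mathsf{Ref}(\beta)$. Then for every model $\mathcal M$ (of a type under which $x$, $y$ are so typed): (a) $\mathcal M\models x\hookrightarrow y$ iff $\mathcal M\models x\hookrightarrow_i y$ for some $i\in\mathbb N$; (b) $\mathcal M\models x\hookrightarrow^\circ y$ iff $\mathcal M\models x\hookrightarrow_i y$ for some $i\in\mathbb N$; (c) $\mathcal M\models x\hookrightarrow y$ iff $\mathcal M\models x\hookrightarrow^\circ y$. -/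

import Mathlib

namespace LocalState

/-! ### Types -/

/-- Types. `tvar` is a free (or formula-quantified) type variable; the variables bound by `mu`
are the de Bruijn indices `bvar`. -/
inductive Ty : Type
  | unit : Ty
  | bool : Ty
  | nat : Ty
  | arrow : Ty → Ty → Ty
  | prod : Ty → Ty → Ty
  | sum : Ty → Ty → Ty
  | ref : Ty → Ty
  | tvar : ℕ → Ty
  | bvar : ℕ → Ty
  | mu : Ty → Ty

namespace Ty

/-- Every `bvar` of the type is bound by one of its `mu`s or by one of `k` surrounding ones. -/
def LCAt : ℕ → Ty → Prop
  | _, unit => True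
  | _, bool => True
  | _, nat => True
  | k, arrow a b => LCAt k a ∧ LCAt k b
  | k, prod a b => LCAt k a ∧ LCAt k b
  | k, sum a b => LCAt k a ∧ LCAt k b
  | k, ref a => LCAt k a
  | _, tvar _ => True
  | k, bvar n => n < k
  | k, mu a => LCAt (k + 1) a

/-- Proper types: no dangling de Bruijn index. -/
def LC (a : Ty) : Prop := LCAt 0 a

/-- The type variable `X` occurs in the type. -/
def HasTVar (X : ℕ) : Ty → Prop
  | unit => False
  | bool => False
  | nat => False
  | arrow a b => HasTVar X a ∨ HasTVar X b
  | prod a b => HasTVar X a ∨ HasTVar X b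
  | sum a b => HasTVar X a ∨ HasTVar X b
  | ref a => HasTVar X a
  | tvar Y => X = Y
  | bvar _ => False
  | mu a => HasTVar X a

/-- Closed types. -/
def Closed (a : Ty) : Prop := a.LC ∧ ∀ X, ¬ HasTVar X a

/-- Replace `bvar k` by the (locally closed) type `s`. -/
def instB (s : Ty) : ℕ → Ty → Ty
  | _, unit => unit
  | _, bool => bool
  | _, nat => nat
  | k, arrow a b => arrow (instB s k a) (instB s k b)
  | k, prod a b => prod (instB s k a) (instB s k b)
  | k, sum a b => sum (instB s k a) (instB s k b)
  | k, ref a => ref (instB s k a)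
  | _, tvar X => tvar X
  | k, bvar n => if n = k then s else bvar n
  | k, mu a => mu (instB s (k + 1) a)

/-- Replace the type variables by (closed) types. -/
def inst (δ : ℕ → Ty) : Ty → Ty
  | unit => unit
  | bool => bool
  | nat => nat
  | arrow a b => arrow (inst δ a) (inst δ b)
  | prod a b => prod (inst δ a) (inst δ b)
  | sum a b => sum (inst δ a) (inst δ b)
  | ref a => ref (inst δ a)
  | tvar X => δ X
  | bvar n => bvar n
  | mu a => mu (inst δ a)

/-- Zero or more unfoldings `μX.a ↦ a[μX.a/X]` at the root. -/
inductive Unfolds : Ty → Ty → Prop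
  | refl (a : Ty) : Unfolds a a
  | step {a b : Ty} : Unfolds (instB (mu a) 0 a) b → Unfolds (mu a) b

/-- The same root constructor (other than `mu`), with immediate subtypes related by `R`. -/
inductive Match (R : Ty → Ty → Prop) : Ty → Ty → Prop
  | unit : Match R unit unit
  | bool : Match R bool bool
  | nat : Match R nat nat
  | arrow {a b c d : Ty} : R a c → R b d → Match R (arrow a b) (arrow c d)
  | prod {a b c d : Ty} : R a c → R b d → Match R (prod a b) (prod c d)
  | sum {a b c d : Ty} : R a c → R b d → Match R (sum a b) (sum c d)
  | ref {a b : Ty} : R a b → Match R (ref a) (ref b)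
  | tvar (X : ℕ) : Match R (tvar X) (tvar X)

/-- The root of the type is a proper type constructor. -/
def IsHead : Ty → Prop
  | bvar _ => False
  | mu _ => False
  | _ => True

/-- `R` relates only types whose infinite unfoldings agree. -/
def IsBisim (R : Ty → Ty → Prop) : Prop :=
  ∀ a b, R a b →
    (∀ a', Unfolds a a' → a'.IsHead → ∃ b', Unfolds b b' ∧ Match R a' b') ∧
    (∀ b', Unfolds b b' → b'.IsHead → ∃ a', Unfolds a a' ∧ Match R a' b')

/-- Equality of equi-recursive types: the two infinite unfoldings are the same tree. -/
def Eqv (a b : Ty) : Prop := ∃ R, IsBisim R ∧ R a b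

/-- Finite types: no function type and no type variable (hence no recursive type). -/
def IsFinite : Ty → Prop
  | unit => True
  | bool => True
  | nat => True
  | arrow _ _ => False
  | prod a b => IsFinite a ∧ IsFinite b
  | sum a b => IsFinite a ∧ IsFinite b
  | ref a => IsFinite a
  | tvar _ => False
  | bvar _ => False
  | mu _ => False

end Ty

/-! ### Programs -/

inductive UnOp : Type
  | not

/-- Binary first-order operations; `eq` compares data of base type and references. -/
inductive BinOp : Type
  | add | sub | mul | le | and | or | eq

/-- Programs. Variables are de Bruijn indices; indices that exceed the number of enclosing binders
are the free variables. In `recfn a b M` (that is, `μf^{a⇒b}.λy^a.M`) index `0` of `M` is `y` and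
index `1` is `f`. -/
inductive Term : Type
  | var : ℕ → Term
  | unit : Term
  | bool : Bool → Term
  | nat : ℕ → Term
  | loc : ℕ → Term
  | lam : Ty → Term → Term
  | recfn : Ty → Ty → Term → Term
  | app : Term → Term → Term
  | assign : Term → Term → Term
  | ref : Term → Term
  | deref : Term → Term
  | un : UnOp → Term → Term
  | bin : BinOp → Term → Term → Term
  | fst : Term → Term
  | snd : Term → Term
  | pair : Term → Term → Term
  /-- first injection into the sum of the two types -/
  | inl : Ty → Ty → Term → Term
  /-- second injection into the sum of the two types -/
  | inr : Ty → Ty → Term → Term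
  | cond : Term → Term → Term → Term
  /-- `caseOf M a N b N'` branches to `N` (binding a datum of type `a`) or `N'` (of type `b`) -/
  | caseOf : Term → Ty → Term → Ty → Term → Term

namespace Term

def IsValue : Term → Prop
  | var _ => True
  | unit => True
  | bool _ => True
  | nat _ => True
  | loc _ => True
  | lam _ _ => True
  | recfn _ _ _ => True
  | pair M N => IsValue M ∧ IsValue N
  | inl _ _ M => IsValue M
  | inr _ _ M => IsValue M
  | _ => False

/-- Free locations. -/
def fl : Term → Set ℕ
  | var _ => ∅
  | unit => ∅
  | bool _ => ∅
  | nat _ => ∅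
  | loc l => {l}
  | lam _ M => fl M
  | recfn _ _ M => fl M
  | app M N => fl M ∪ fl N
  | assign M N => fl M ∪ fl N
  | ref M => fl M
  | deref M => fl M
  | un _ M => fl M
  | bin _ M N => fl M ∪ fl N
  | fst M => fl M
  | snd M => fl M
  | pair M N => fl M ∪ fl N
  | inl _ _ M => fl M
  | inr _ _ M => fl M
  | cond M N P => fl M ∪ fl N ∪ fl P
  | caseOf M _ N _ P => fl M ∪ fl N ∪ fl P

/-- A renaming of the variables, pushed under one binder. -/
def liftR (r : ℕ → ℕ) : ℕ → ℕ
  | 0 => 0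
  | n + 1 => r n + 1

def rename (r : ℕ → ℕ) : Term → Term
  | var n => var (r n)
  | unit => unit
  | bool b => bool b
  | nat n => nat n
  | loc l => loc l
  | lam a M => lam a (rename (liftR r) M)
  | recfn a b M => recfn a b (rename (liftR (liftR r)) M)
  | app M N => app (rename r M) (rename r N)
  | assign M N => assign (rename r M) (rename r N)
  | ref M => ref (rename r M)
  | deref M => deref (rename r M)
  | un o M => un o (rename r M)
  | bin o M N => bin o (rename r M) (rename r N)
  | fst M => fst (rename r M)
  | snd M => snd (rename r M)
  | pair M N => pair (rename r M) (rename r N)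
  | inl a b M => inl a b (rename r M)
  | inr a b M => inr a b (rename r M)
  | cond M N P => cond (rename r M) (rename r N) (rename r P)
  | caseOf M a N b P =>
      caseOf (rename r M) a (rename (liftR r) N) b (rename (liftR r) P)

/-- A substitution, pushed under one binder. -/
def liftS (s : ℕ → Term) : ℕ → Term
  | 0 => var 0
  | n + 1 => rename Nat.succ (s n)

/-- Capture-avoiding simultaneous substitution. -/
def subst (s : ℕ → Term) : Term → Term
  | var n => s n
  | unit => unit
  | bool b => bool b
  | nat n => nat n
  | loc l => loc l
  | lam a M => lam a (subst (liftS s) M)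
  | recfn a b M => recfn a b (subst (liftS (liftS s)) M)
  | app M N => app (subst s M) (subst s N)
  | assign M N => assign (subst s M) (subst s N)
  | ref M => ref (subst s M)
  | deref M => deref (subst s M)
  | un o M => un o (subst s M)
  | bin o M N => bin o (subst s M) (subst s N)
  | fst M => fst (subst s M)
  | snd M => snd (subst s M)
  | pair M N => pair (subst s M) (subst s N)
  | inl a b M => inl a b (subst s M)
  | inr a b M => inr a b (subst s M)
  | cond M N P => cond (subst s M) (subst s N) (subst s P)
  | caseOf M a N b P =>
      caseOf (subst s M) a (subst (liftS s) N) b (subst (liftS s) P)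

/-- The substitution `V` for index `0`, lowering all other indices by one. -/
def single (V : Term) : ℕ → Term
  | 0 => V
  | n + 1 => var n

/-- `M[V/x]`, where `x` is index `0` of `M`. -/
def subst1 (V M : Term) : Term := subst (single V) M

/-- `M[V/y][W/f]`, where `y` is index `0` and `f` is index `1` of `M`. -/
def subst2 (V W M : Term) : Term :=
  subst (fun n => match n with
    | 0 => V
    | 1 => W
    | m + 2 => var m) M

/-- The substitution given by an environment: variable `n` becomes the `n`-th entry. -/
def envSubst (ξ : List Term) (n : ℕ) : Term := ξ.getD n (var n)

/-- Weakening by `k` variables. -/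
def shift (k : ℕ) (M : Term) : Term := rename (fun n => n + k) M

/-- `let x^a = M in N`. -/
def letE (a : Ty) (M N : Term) : Term := app (lam a N) M

/-- `M ; N`. -/
def seq (M N : Term) : Term := app (lam Ty.unit (shift 1 N)) M

end Term

def UnOp.eval : UnOp → Term → Option Term
  | .not, .bool b => some (.bool (!b))
  | _, _ => none

def BinOp.eval : BinOp → Term → Term → Option Term
  | .add, .nat m, .nat n => some (.nat (m + n))
  | .sub, .nat m, .nat n => some (.nat (m - n))
  | .mul, .nat m, .nat n => some (.nat (m * n))
  | .le, .nat m, .nat n => some (.bool (decide (m ≤ n)))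
  | .and, .bool a, .bool b => some (.bool (a && b))
  | .or, .bool a, .bool b => some (.bool (a || b))
  | .eq, .unit, .unit => some (.bool true)
  | .eq, .bool a, .bool b => some (.bool (decide (a = b)))
  | .eq, .nat m, .nat n => some (.bool (decide (m = n)))
  | .eq, .loc l, .loc l' => some (.bool (decide (l = l')))
  | _, _, _ => none

/-- `UnOp.Sig o a b`: the operation takes a datum of type `a` to one of type `b`. -/
inductive UnOp.Sig : UnOp → Ty → Ty → Prop
  | not : UnOp.Sig .not .bool .bool

/-- `BinOp.Sig o a b c`: the operation takes data of types `a` and `b` to one of type `c`. -/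
inductive BinOp.Sig : BinOp → Ty → Ty → Ty → Prop
  | add : BinOp.Sig .add .nat .nat .nat
  | sub : BinOp.Sig .sub .nat .nat .nat
  | mul : BinOp.Sig .mul .nat .nat .nat
  | le : BinOp.Sig .le .nat .nat .bool
  | and : BinOp.Sig .and .bool .bool .bool
  | or : BinOp.Sig .or .bool .bool .bool
  | eqUnit : BinOp.Sig .eq .unit .unit .bool
  | eqBool : BinOp.Sig .eq .bool .bool .bool
  | eqNat : BinOp.Sig .eq .nat .nat .bool
  | eqRef (a : Ty) : BinOp.Sig .eq (.ref a) (.ref a) .bool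

/-- Typing of programs. `S l = some a` says that the location `l` has type `Ref a`;
`G` lists the types of the variables. -/
inductive HasType (S : ℕ → Option Ty) : List Ty → Term → Ty → Prop
  | var {G : List Ty} {n : ℕ} {a : Ty} : G[n]? = some a → HasType S G (.var n) a
  | unit {G : List Ty} : HasType S G .unit .unit
  | bool {G : List Ty} (b : Bool) : HasType S G (.bool b) .bool
  | nat {G : List Ty} (n : ℕ) : HasType S G (.nat n) .nat
  | loc {G : List Ty} {l : ℕ} {a : Ty} : S l = some a → HasType S G (.loc l) (.ref a)
  | lam {G : List Ty} {a b : Ty} {M : Term} :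
      a.LC → HasType S (a :: G) M b → HasType S G (.lam a M) (.arrow a b)
  | recfn {G : List Ty} {a b : Ty} {M : Term} :
      a.LC → b.LC → HasType S (a :: .arrow a b :: G) M b →
      HasType S G (.recfn a b M) (.arrow a b)
  | app {G : List Ty} {a b : Ty} {M N : Term} :
      HasType S G M (.arrow a b) → HasType S G N a → HasType S G (.app M N) b
  | assign {G : List Ty} {a : Ty} {M N : Term} :
      HasType S G M (.ref a) → HasType S G N a → HasType S G (.assign M N) .unit
  | ref {G : List Ty} {a : Ty} {M : Term} : HasType S G M a → HasType S G (.ref M) (.ref a)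
  | deref {G : List Ty} {a : Ty} {M : Term} : HasType S G M (.ref a) → HasType S G (.deref M) a
  | un {G : List Ty} {o : UnOp} {a b : Ty} {M : Term} :
      o.Sig a b → HasType S G M a → HasType S G (.un o M) b
  | bin {G : List Ty} {o : BinOp} {a b c : Ty} {M N : Term} :
      o.Sig a b c → HasType S G M a → HasType S G N b → HasType S G (.bin o M N) c
  | fst {G : List Ty} {a b : Ty} {M : Term} : HasType S G M (.prod a b) → HasType S G (.fst M) a
  | snd {G : List Ty} {a b : Ty} {M : Term} : HasType S G M (.prod a b) → HasType S G (.snd M) b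
  | pair {G : List Ty} {a b : Ty} {M N : Term} :
      HasType S G M a → HasType S G N b → HasType S G (.pair M N) (.prod a b)
  | inl {G : List Ty} {a b : Ty} {M : Term} :
      a.LC → b.LC → HasType S G M a → HasType S G (.inl a b M) (.sum a b)
  | inr {G : List Ty} {a b : Ty} {M : Term} :
      a.LC → b.LC → HasType S G M b → HasType S G (.inr a b M) (.sum a b)
  | cond {G : List Ty} {a : Ty} {M N P : Term} :
      HasType S G M .bool → HasType S G N a → HasType S G P a → HasType S G (.cond M N P) a
  | caseOf {G : List Ty} {a b c : Ty} {M N P : Term} :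
      a.LC → b.LC → HasType S G M (.sum a b) → HasType S (a :: G) N c → HasType S (b :: G) P c →
      HasType S G (.caseOf M a N b P) c
  /-- types with the same infinite unfolding are interchangeable -/
  | conv {G : List Ty} {a b : Ty} {M : Term} :
      HasType S G M a → Ty.Eqv a b → b.LC → HasType S G M b

/-! ### Reduction -/

/-- Stores: partial maps from locations to values (finite in every model below). -/
abbrev Store := ℕ → Option Term

/-- Configurations `(ν l₁ … lₙ)(M, σ)`. -/
structure Config where
  hid : Finset ℕ
  prog : Term
  store : Store

/-- One-step call-by-value reduction, closed under left-to-right evaluation contexts. A new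
reference is added to the hidden locations. -/
inductive Step : Config → Config → Prop
  | beta {h : Finset ℕ} {σ : Store} {a : Ty} {M V : Term} : V.IsValue →
      Step ⟨h, .app (.lam a M) V, σ⟩ ⟨h, Term.subst1 V M, σ⟩
  | unroll {h : Finset ℕ} {σ : Store} {a b : Ty} {M V : Term} : V.IsValue →
      Step ⟨h, .app (.recfn a b M) V, σ⟩ ⟨h, Term.subst2 V (.recfn a b M) M, σ⟩
  | fst {h : Finset ℕ} {σ : Store} {V W : Term} : V.IsValue → W.IsValue →
      Step ⟨h, .fst (.pair V W), σ⟩ ⟨h, V, σ⟩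
  | snd {h : Finset ℕ} {σ : Store} {V W : Term} : V.IsValue → W.IsValue →
      Step ⟨h, .snd (.pair V W), σ⟩ ⟨h, W, σ⟩
  | condT {h : Finset ℕ} {σ : Store} {M N : Term} :
      Step ⟨h, .cond (.bool true) M N, σ⟩ ⟨h, M, σ⟩
  | condF {h : Finset ℕ} {σ : Store} {M N : Term} :
      Step ⟨h, .cond (.bool false) M N, σ⟩ ⟨h, N, σ⟩
  | caseL {h : Finset ℕ} {σ : Store} {a b c d : Ty} {V N P : Term} : V.IsValue →
      Step ⟨h, .caseOf (.inl c d V) a N b P, σ⟩ ⟨h, Term.subst1 V N, σ⟩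
  | caseR {h : Finset ℕ} {σ : Store} {a b c d : Ty} {V N P : Term} : V.IsValue →
      Step ⟨h, .caseOf (.inr c d V) a N b P, σ⟩ ⟨h, Term.subst1 V P, σ⟩
  | un {h : Finset ℕ} {σ : Store} {o : UnOp} {V W : Term} : o.eval V = some W →
      Step ⟨h, .un o V, σ⟩ ⟨h, W, σ⟩
  | bin {h : Finset ℕ} {σ : Store} {o : BinOp} {V V' W : Term} : o.eval V V' = some W →
      Step ⟨h, .bin o V V', σ⟩ ⟨h, W, σ⟩
  | deref {h : Finset ℕ} {σ : Store} {l : ℕ} {V : Term} : σ l = some V →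
      Step ⟨h, .deref (.loc l), σ⟩ ⟨h, V, σ⟩
  | assign {h : Finset ℕ} {σ : Store} {l : ℕ} {V W : Term} : V.IsValue → σ l = some W →
      Step ⟨h, .assign (.loc l) V, σ⟩ ⟨h, .unit, Function.update σ l (some V)⟩
  | ref {h : Finset ℕ} {σ : Store} {l : ℕ} {V : Term} : V.IsValue → σ l = none → l ∉ h →
      Step ⟨h, .ref V, σ⟩ ⟨insert l h, .loc l, Function.update σ l (some V)⟩
  | appL {h h' : Finset ℕ} {σ σ' : Store} {M M' N : Term} :
      Step ⟨h, M, σ⟩ ⟨h', M', σ'⟩ → Step ⟨h, .app M N, σ⟩ ⟨h', .app M' N, σ'⟩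
  | appR {h h' : Finset ℕ} {σ σ' : Store} {V N N' : Term} : V.IsValue →
      Step ⟨h, N, σ⟩ ⟨h', N', σ'⟩ → Step ⟨h, .app V N, σ⟩ ⟨h', .app V N', σ'⟩
  | pairL {h h' : Finset ℕ} {σ σ' : Store} {M M' N : Term} :
      Step ⟨h, M, σ⟩ ⟨h', M', σ'⟩ → Step ⟨h, .pair M N, σ⟩ ⟨h', .pair M' N, σ'⟩
  | pairR {h h' : Finset ℕ} {σ σ' : Store} {V N N' : Term} : V.IsValue →
      Step ⟨h, N, σ⟩ ⟨h', N', σ'⟩ → Step ⟨h, .pair V N, σ⟩ ⟨h', .pair V N', σ'⟩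
  | fstC {h h' : Finset ℕ} {σ σ' : Store} {M M' : Term} :
      Step ⟨h, M, σ⟩ ⟨h', M', σ'⟩ → Step ⟨h, .fst M, σ⟩ ⟨h', .fst M', σ'⟩
  | sndC {h h' : Finset ℕ} {σ σ' : Store} {M M' : Term} :
      Step ⟨h, M, σ⟩ ⟨h', M', σ'⟩ → Step ⟨h, .snd M, σ⟩ ⟨h', .snd M', σ'⟩
  | inlC {h h' : Finset ℕ} {σ σ' : Store} {a b : Ty} {M M' : Term} :
      Step ⟨h, M, σ⟩ ⟨h', M', σ'⟩ → Step ⟨h, .inl a b M, σ⟩ ⟨h', .inl a b M', σ'⟩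
  | inrC {h h' : Finset ℕ} {σ σ' : Store} {a b : Ty} {M M' : Term} :
      Step ⟨h, M, σ⟩ ⟨h', M', σ'⟩ → Step ⟨h, .inr a b M, σ⟩ ⟨h', .inr a b M', σ'⟩
  | unC {h h' : Finset ℕ} {σ σ' : Store} {o : UnOp} {M M' : Term} :
      Step ⟨h, M, σ⟩ ⟨h', M', σ'⟩ → Step ⟨h, .un o M, σ⟩ ⟨h', .un o M', σ'⟩
  | binL {h h' : Finset ℕ} {σ σ' : Store} {o : BinOp} {M M' N : Term} :
      Step ⟨h, M, σ⟩ ⟨h', M', σ'⟩ → Step ⟨h, .bin o M N, σ⟩ ⟨h', .bin o M' N, σ'⟩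
  | binR {h h' : Finset ℕ} {σ σ' : Store} {o : BinOp} {V N N' : Term} : V.IsValue →
      Step ⟨h, N, σ⟩ ⟨h', N', σ'⟩ → Step ⟨h, .bin o V N, σ⟩ ⟨h', .bin o V N', σ'⟩
  | condC {h h' : Finset ℕ} {σ σ' : Store} {M M' N P : Term} :
      Step ⟨h, M, σ⟩ ⟨h', M', σ'⟩ → Step ⟨h, .cond M N P, σ⟩ ⟨h', .cond M' N P, σ'⟩
  | caseC {h h' : Finset ℕ} {σ σ' : Store} {a b : Ty} {M M' N P : Term} :
      Step ⟨h, M, σ⟩ ⟨h', M', σ'⟩ → Step ⟨h, .caseOf M a N b P, σ⟩ ⟨h', .caseOf M' a N b P, σ'⟩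
  | derefC {h h' : Finset ℕ} {σ σ' : Store} {M M' : Term} :
      Step ⟨h, M, σ⟩ ⟨h', M', σ'⟩ → Step ⟨h, .deref M, σ⟩ ⟨h', .deref M', σ'⟩
  | assignL {h h' : Finset ℕ} {σ σ' : Store} {M M' N : Term} :
      Step ⟨h, M, σ⟩ ⟨h', M', σ'⟩ → Step ⟨h, .assign M N, σ⟩ ⟨h', .assign M' N, σ'⟩
  | assignR {h h' : Finset ℕ} {σ σ' : Store} {V N N' : Term} : V.IsValue →
      Step ⟨h, N, σ⟩ ⟨h', N', σ'⟩ → Step ⟨h, .assign V N, σ⟩ ⟨h', .assign V N', σ'⟩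
  | refC {h h' : Finset ℕ} {σ σ' : Store} {M M' : Term} :
      Step ⟨h, M, σ⟩ ⟨h', M', σ'⟩ → Step ⟨h, .ref M, σ⟩ ⟨h', .ref M', σ'⟩

/-- `c ⇓ c'`: reduction to a value. -/
def EvalsTo (c c' : Config) : Prop := Relation.ReflTransGen Step c c' ∧ c'.prog.IsValue

/-- `c ⇓`. -/
def Converges (c : Config) : Prop := ∃ c', EvalsTo c c'

/-! ### Models -/

/-- A closed typing environment: the types of the variables `0, 1, 2, …` of a model, and the
content types of its free locations. -/
structure Env where
  vars : List Ty
  locs : ℕ → Option Ty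

/-- `Γ · x : a`, where `x` is the next unused variable. -/
def Env.snoc (Γ : Env) (a : Ty) : Env := ⟨Γ.vars ++ [a], Γ.locs⟩

/-- `(ν l₁ … lₙ)(ξ, σ)`: hidden locations, environment and store. The environment lists the
values of the variables `0, 1, 2, …`. -/
structure Model where
  hid : Finset ℕ
  env : List Term
  store : Store

namespace Model

/-- `M[x : V]`, where `x` is the next unused variable. -/
def push (M : Model) (V : Term) : Model := ⟨M.hid, M.env ++ [V], M.store⟩

/-- `M / x`, where `x` is the last variable. -/
def pop (M : Model) : Model := ⟨M.hid, M.env.dropLast, M.store⟩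

/-- `(ν l) M`. -/
def hide (l : ℕ) (M : Model) : Model := ⟨insert l M.hid, M.env, M.store⟩

/-- `M[l ↦ V]`. -/
def update (M : Model) (l : ℕ) (V : Term) : Model :=
  ⟨M.hid, M.env, Function.update M.store l (some V)⟩

end Model

/-- `M` is a model of type `Γ`. Here `S` types all its locations, free and hidden, and the store
is defined exactly on these. -/
def IsModel (Γ : Env) (M : Model) : Prop :=
  (∀ a ∈ Γ.vars, a.Closed) ∧
  {l | M.store l ≠ none}.Finite ∧
  ∃ S : ℕ → Option Ty,
    (∀ l a, Γ.locs l = some a → S l = some a) ∧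
    (∀ l, l ∈ M.hid ↔ S l ≠ none ∧ Γ.locs l = none) ∧
    (∀ l a, S l = some a → a.Closed) ∧
    (∀ l, M.store l = none ↔ S l = none) ∧
    (∀ l a V, S l = some a → M.store l = some V → V.IsValue ∧ HasType S [] V a) ∧
    List.Forall₂ (fun V a => V.IsValue ∧ HasType S [] V a) M.env Γ.vars

/-- The iterated pair `⟨V₁, ⟨V₂, …⟩⟩`. -/
def tuple : List Term → Term
  | [] => .unit
  | V :: Vs => .pair V (tuple Vs)

def tupleTy : List Ty → Ty
  | [] => .unit
  | a :: as => .prod a (tupleTy as)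

/-- Contextual congruence of models of type `Γ`. A context is a program `N` of type `Unit` whose
hole is the variable `0`; the data that fill it are closed, so that filling is substitution. The
locations that occur in `N` are free ones of `Γ`, hence not hidden in either model. -/
def ModelEquiv (Γ : Env) (M M' : Model) : Prop :=
  IsModel Γ M ∧ IsModel Γ M' ∧
  ∀ N, HasType Γ.locs [tupleTy Γ.vars] N .unit →
    (Converges ⟨M.hid, Term.subst1 (tuple M.env) N, M.store⟩ ↔
      Converges ⟨M'.hid, Term.subst1 (tuple M'.env) N, M'.store⟩)

/-- `M[x : N] ⇓ M'`, where `x` is the next unused variable and `N` is a program of type `a`. -/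
def Runs (Γ : Env) (M : Model) (N : Term) (a : Ty) (M' : Model) : Prop :=
  HasType Γ.locs Γ.vars N a ∧ IsModel (Γ.snoc a) M' ∧
  ∃ h V σ, EvalsTo ⟨∅, N.subst (Term.envSubst M.env), M.store⟩ ⟨h, V, σ⟩ ∧
    M' = ⟨M.hid ∪ h, M.env ++ [V], σ⟩

/-- `M ⇝ M'`: evolution by running zero or more programs. -/
inductive Evolves (Γ : Env) (M : Model) : Env → Model → Prop
  | refl : Evolves Γ M Γ M
  | run {Γ₀ : Env} {M₀ : Model} {N : Term} {a : Ty} {M' : Model} :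
      Evolves Γ M Γ₀ M₀ → Runs Γ₀ M₀ N a M' → Evolves Γ M (Γ₀.snoc a) M'

/-- Functional terms of type `a`: running them does not change any model of type `Γ`. -/
def Functional (Γ : Env) (L : Term) (a : Ty) : Prop :=
  HasType Γ.locs Γ.vars L a ∧
  ∀ M M', IsModel Γ M → Runs Γ M L a M' → ModelEquiv Γ M M'.pop

/-- The label closure of `A` in `σ`. -/
inductive Ncl (σ : Store) (A : Set ℕ) : ℕ → Prop
  | base {l : ℕ} : l ∈ A → Ncl σ A l
  | step {l l' : ℕ} {V : Term} : Ncl σ A l → σ l = some V → l' ∈ V.fl → Ncl σ A l'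

/-! ### The assertion language -/

/-- Logical terms; variables are names. -/
inductive LTerm : Type
  | var : ℕ → LTerm
  | unit : LTerm
  | bool : Bool → LTerm
  | nat : ℕ → LTerm
  | loc : ℕ → LTerm
  | un : UnOp → LTerm → LTerm
  | bin : BinOp → LTerm → LTerm → LTerm
  | pair : LTerm → LTerm → LTerm
  | inl : Ty → Ty → LTerm → LTerm
  | inr : Ty → Ty → LTerm → LTerm
  | deref : LTerm → LTerm

/-- Primitive formulae; the remaining connectives are defined from them by duality below. -/
inductive Formula : Type
  /-- `e = e'` -/
  | eq : LTerm → LTerm → Formula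
  | neg : Formula → Formula
  | and : Formula → Formula → Formula
  /-- `∀ x^a. C` -/
  | all : ℕ → Ty → Formula → Formula
  /-- the universal hiding quantifier over hidden references `x` of type `Ref a` -/
  | nuAll : ℕ → Ty → Formula → Formula
  /-- `∀ X. C` -/
  | allT : ℕ → Formula → Formula
  /-- universal content quantification `[!e] C` -/
  | allCon : LTerm → Formula → Formula
  /-- the evaluation formula `e • e' = x^b {C}` -/
  | eval : LTerm → LTerm → ℕ → Ty → Formula → Formula
  /-- the located evaluation formula `e • e' = x^b {C} @ ws`, each `w` in `ws` being listed with
  its content type -/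
  | located : LTerm → LTerm → ℕ → Ty → Formula → List (LTerm × Ty) → Formula
  | box : Formula → Formula
  /-- the reachability predicate `e ↪ e'` -/
  | reach : LTerm → LTerm → Formula

/-- Typing environments of formulae: the types of variable names and the content types of
locations. -/
structure FEnv where
  vars : ℕ → Option Ty
  locs : ℕ → Option Ty

/-- `Γ · x : a`. -/
def FEnv.bind (Γ : FEnv) (x : ℕ) (a : Ty) : FEnv := ⟨Function.update Γ.vars x (some a), Γ.locs⟩

/-- The type variable `X` does not occur in `Γ`. -/
def FEnv.FreshT (Γ : FEnv) (X : ℕ) : Prop :=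
  (∀ x a, Γ.vars x = some a → ¬ Ty.HasTVar X a) ∧ (∀ l a, Γ.locs l = some a → ¬ Ty.HasTVar X a)

namespace LTerm

/-- `Γ ⊢ e : a`. -/
inductive HasType (Γ : FEnv) : LTerm → Ty → Prop
  | var {x : ℕ} {a : Ty} : Γ.vars x = some a → HasType Γ (.var x) a
  | unit : HasType Γ .unit .unit
  | bool (b : Bool) : HasType Γ (.bool b) .bool
  | nat (n : ℕ) : HasType Γ (.nat n) .nat
  | loc {l : ℕ} {a : Ty} : Γ.locs l = some a → HasType Γ (.loc l) (.ref a)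
  | un {o : UnOp} {a b : Ty} {e : LTerm} : o.Sig a b → HasType Γ e a → HasType Γ (.un o e) b
  | bin {o : BinOp} {a b c : Ty} {e e' : LTerm} :
      o.Sig a b c → HasType Γ e a → HasType Γ e' b → HasType Γ (.bin o e e') c
  | pair {a b : Ty} {e e' : LTerm} :
      HasType Γ e a → HasType Γ e' b → HasType Γ (.pair e e') (.prod a b)
  | inl {a b : Ty} {e : LTerm} :
      a.LC → b.LC → HasType Γ e a → HasType Γ (.inl a b e) (.sum a b)
  | inr {a b : Ty} {e : LTerm} :
      a.LC → b.LC → HasType Γ e b → HasType Γ (.inr a b e) (.sum a b)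
  | deref {a : Ty} {e : LTerm} : HasType Γ e (.ref a) → HasType Γ (.deref e) a
  | conv {a b : Ty} {e : LTerm} : HasType Γ e a → Ty.Eqv a b → b.LC → HasType Γ e b

/-- All variable names in the term are smaller than `k`. -/
def VarsBelow (k : ℕ) : LTerm → Prop
  | var x => x < k
  | unit => True
  | bool _ => True
  | nat _ => True
  | loc _ => True
  | un _ e => VarsBelow k e
  | bin _ e e' => VarsBelow k e ∧ VarsBelow k e'
  | pair e e' => VarsBelow k e ∧ VarsBelow k e'
  | inl _ _ e => VarsBelow k e
  | inr _ _ e => VarsBelow k e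
  | deref e => VarsBelow k e

def DerefFree : LTerm → Prop
  | var _ => True
  | unit => True
  | bool _ => True
  | nat _ => True
  | loc _ => True
  | un _ e => DerefFree e
  | bin _ e e' => DerefFree e ∧ DerefFree e'
  | pair e e' => DerefFree e ∧ DerefFree e'
  | inl _ _ e => DerefFree e
  | inr _ _ e => DerefFree e
  | deref _ => False

end LTerm

/-- How the names in a formula are read in a model: `pos x` is the variable of the model that the
name `x` stands for, and `tys X` is the closed type assigned to the type variable `X`. (Keeping
names apart from the variables of a model makes the variables that a model acquires fresh for every
formula, as the bound name convention has it.) -/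
structure Reading where
  pos : ℕ → ℕ
  tys : ℕ → Ty

def Reading.bind (ρ : Reading) (x n : ℕ) : Reading := ⟨Function.update ρ.pos x n, ρ.tys⟩

def Reading.bindT (ρ : Reading) (X : ℕ) (a : Ty) : Reading := ⟨ρ.pos, Function.update ρ.tys X a⟩

namespace LTerm

/-- A logical term as a program. -/
def prog (ρ : Reading) : LTerm → Term
  | var x => .var (ρ.pos x)
  | unit => .unit
  | bool b => .bool b
  | nat n => .nat n
  | loc l => .loc l
  | un o e => .un o (prog ρ e)
  | bin o e e' => .bin o (prog ρ e) (prog ρ e')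
  | pair e e' => .pair (prog ρ e) (prog ρ e')
  | inl a b e => .inl (a.inst ρ.tys) (b.inst ρ.tys) (prog ρ e)
  | inr a b e => .inr (a.inst ρ.tys) (b.inst ρ.tys) (prog ρ e)
  | deref e => .deref (prog ρ e)

/-- The interpretation of a logical term in an environment and a store (always defined for
well-typed terms in models). -/
def den (ρ : Reading) (ξ : List Term) (σ : Store) : LTerm → Option Term
  | var x => ξ[ρ.pos x]?
  | unit => some .unit
  | bool b => some (.bool b)
  | nat n => some (.nat n)
  | loc l => some (.loc l)
  | un o e => (den ρ ξ σ e).bind o.eval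
  | bin o e e' => (den ρ ξ σ e).bind fun V => (den ρ ξ σ e').bind fun W => o.eval V W
  | pair e e' => (den ρ ξ σ e).bind fun V => (den ρ ξ σ e').map fun W => .pair V W
  | inl a b e => (den ρ ξ σ e).map fun V => .inl (a.inst ρ.tys) (b.inst ρ.tys) V
  | inr a b e => (den ρ ξ σ e).map fun V => .inr (a.inst ρ.tys) (b.inst ρ.tys) V
  | deref e => (den ρ ξ σ e).bind fun V => match V with
      | .loc l => σ l
      | _ => none

end LTerm

/-- The program `let xs = !ws in let y^b = N in ws := xs`, of type `Unit`, in the scope of `k`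
further variables. -/
def restoring (N : Term) (b : Ty) : ℕ → List (Term × Ty) → Term
  | k, [] => Term.letE b (N.shift k) .unit
  | k, (w, a) :: ws =>
      Term.letE a (.deref (w.shift k))
        (Term.seq (restoring N b (k + 1) ws) (.assign (w.shift (k + 1)) (.var 0)))

namespace Formula

/-- `Γ ⊢ C`. -/
def WF : FEnv → Formula → Prop
  | Γ, eq e e' => (∃ a, e.HasType Γ a) ∧ (∃ b, e'.HasType Γ b)
  | Γ, neg C => WF Γ C
  | Γ, and C D => WF Γ C ∧ WF Γ D
  | Γ, all x a C => a.LC ∧ WF (Γ.bind x a) C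
  | Γ, nuAll x a C => a.LC ∧ WF (Γ.bind x (.ref a)) C
  | Γ, allT X C => Γ.FreshT X ∧ WF Γ C
  | Γ, allCon e C => (∃ a, e.HasType Γ (.ref a)) ∧ WF Γ C
  | Γ, eval e e' x b C =>
      b.LC ∧ (∃ a, e.HasType Γ (.arrow a b) ∧ e'.HasType Γ a) ∧ WF (Γ.bind x b) C
  | Γ, located e e' x b C ws =>
      b.LC ∧ (∃ a, e.HasType Γ (.arrow a b) ∧ e'.HasType Γ a) ∧ WF (Γ.bind x b) C ∧
      ∀ w ∈ ws, w.2.LC ∧ w.1.HasType Γ (.ref w.2) ∧ w.1.DerefFree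
  | Γ, box C => WF Γ C
  | Γ, reach e e' => (∃ a, e.HasType Γ a) ∧ (∃ b, e'.HasType Γ (.ref b))

/-- The source of every reachability predicate in the formula has a finite type. -/
def FiniteReach : FEnv → Formula → Prop
  | _, eq _ _ => True
  | Γ, neg C => FiniteReach Γ C
  | Γ, and C D => FiniteReach Γ C ∧ FiniteReach Γ D
  | Γ, all x a C => FiniteReach (Γ.bind x a) C
  | Γ, nuAll x a C => FiniteReach (Γ.bind x (.ref a)) C
  | Γ, allT _ C => FiniteReach Γ C
  | Γ, allCon _ C => FiniteReach Γ C
  | Γ, eval _ _ x b C => FiniteReach (Γ.bind x b) C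
  | Γ, located _ _ x b C _ => FiniteReach (Γ.bind x b) C
  | Γ, box C => FiniteReach Γ C
  | Γ, reach e _ => ∃ a, a.IsFinite ∧ e.HasType Γ a

/-- No reachability predicate occurs in the formula. -/
def NoReach : Formula → Prop
  | eq _ _ => True
  | neg C => NoReach C
  | and C D => NoReach C ∧ NoReach D
  | all _ _ C => NoReach C
  | nuAll _ _ C => NoReach C
  | allT _ C => NoReach C
  | allCon _ C => NoReach C
  | eval _ _ _ _ C => NoReach C
  | located _ _ _ _ C _ => NoReach C
  | box C => NoReach C
  | reach _ _ => False

/-- Satisfaction `M ⊨ C` in a model `M` of type `Γ`. -/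
def Sat : Formula → Env → Model → Reading → Prop
  | eq e e', Γ, M, ρ =>
      ∃ a V V', e.den ρ M.env M.store = some V ∧ e'.den ρ M.env M.store = some V' ∧
        ModelEquiv (Γ.snoc a) (M.push V) (M.push V')
  | neg C, Γ, M, ρ => ¬ Sat C Γ M ρ
  | and C D, Γ, M, ρ => Sat C Γ M ρ ∧ Sat D Γ M ρ
  | all x a C, Γ, M, ρ =>
      ∀ L M', Functional Γ L (a.inst ρ.tys) → Runs Γ M L (a.inst ρ.tys) M' →
        Sat C (Γ.snoc (a.inst ρ.tys)) M' (ρ.bind x Γ.vars.length)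
  | nuAll x a C, Γ, M, ρ =>
      ∀ l M', Γ.locs l = none → l ∉ M'.hid →
        IsModel ⟨Γ.vars, Function.update Γ.locs l (some (a.inst ρ.tys))⟩ M' →
        ModelEquiv Γ (M'.hide l) M →
        Sat C (Env.snoc ⟨Γ.vars, Function.update Γ.locs l (some (a.inst ρ.tys))⟩
            (.ref (a.inst ρ.tys)))
          (M'.push (.loc l)) (ρ.bind x Γ.vars.length)
  | allT X C, Γ, M, ρ => ∀ a : Ty, a.Closed → Sat C Γ M (ρ.bindT X a)
  | allCon e C, Γ, M, ρ =>
      ∀ L a l V c, Functional Γ L a → e.den ρ M.env M.store = some (.loc l) →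
        EvalsTo ⟨M.hid, L.subst (Term.envSubst M.env), M.store⟩ c →
        ModelEquiv ⟨[a], Γ.locs⟩ ⟨c.hid, [c.prog], c.store⟩ ⟨M.hid, [V], M.store⟩ →
        IsModel Γ (M.update l V) →
        Sat C Γ (M.update l V) ρ
  | eval e e' x b C, Γ, M, ρ =>
      ∃ M', Runs Γ M (.app (e.prog ρ) (e'.prog ρ)) (b.inst ρ.tys) M' ∧
        Sat C (Γ.snoc (b.inst ρ.tys)) M' (ρ.bind x Γ.vars.length)
  | located e e' x b C ws, Γ, M, ρ =>
      ∃ M', Runs Γ M (.app (e.prog ρ) (e'.prog ρ)) (b.inst ρ.tys) M' ∧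
        Sat C (Γ.snoc (b.inst ρ.tys)) M' (ρ.bind x Γ.vars.length) ∧
        ∀ M'', Runs Γ M
            (restoring (.app (e.prog ρ) (e'.prog ρ)) (b.inst ρ.tys) 0
              (ws.map fun w => (w.1.prog ρ, w.2.inst ρ.tys))) .unit M'' →
          ModelEquiv (Γ.snoc .unit) M'' (M.push .unit)
  | box C, Γ, M, ρ => ∀ Γ' M', Evolves Γ M Γ' M' → Sat C Γ' M' ρ
  | reach e e', Γ, M, ρ =>
      ∀ M', ModelEquiv Γ M' M →
        ∃ V l, e.den ρ M'.env M'.store = some V ∧ e'.den ρ M'.env M'.store = some (.loc l) ∧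
          Ncl M'.store V.fl l

/-! Derived connectives. -/

def or (C D : Formula) : Formula := neg (and (neg C) (neg D))

def imp (C D : Formula) : Formula := neg (and C (neg D))

def ex (x : ℕ) (a : Ty) (C : Formula) : Formula := neg (all x a (neg C))

def nuEx (x : ℕ) (a : Ty) (C : Formula) : Formula := neg (nuAll x a (neg C))

def exT (X : ℕ) (C : Formula) : Formula := neg (allT X (neg C))

def someCon (e : LTerm) (C : Formula) : Formula := neg (allCon e (neg C))

def dia (C : Formula) : Formula := neg (box (neg C))

/-- `e # e'`. -/
def unreach (e e' : LTerm) : Formula := neg (reach e' e)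

/-- Falsity, that is `1 ≠ 1`. -/
def fls : Formula := neg (eq (.nat 1) (.nat 1))

/-- The formula `e^a ↪° e'` given by the inductive clauses for base types, products, sums and
references. Bound names are taken from `k, k + 1, …`. -/
def reachO : Ty → ℕ → LTerm → LTerm → Formula
  | .prod a b, k, e, e' =>
      ex k a (ex (k + 1) b (and (eq e (.pair (.var k) (.var (k + 1))))
        (or (reachO a (k + 2) (.var k) e') (reachO b (k + 2) (.var (k + 1)) e'))))
  | .sum a b, k, e, e' =>
      or (ex k a (and (eq e (.inl a b (.var k))) (reachO a (k + 1) (.var k) e')))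
        (ex k b (and (eq e (.inr a b (.var k))) (reachO b (k + 1) (.var k) e')))
  | .ref a, k, e, e' => or (eq e e') (reachO a k (.deref e) e')
  | _, _, _, _ => fls

/-- The formula `e^a ↪ᵢ e'`: `e'` is reachable from `e` in at most `i` steps. Projections are
expressed by naming the two components. Bound names are taken from `k, k + 1, …`. -/
def reachIn : ℕ → Ty → ℕ → LTerm → LTerm → Formula
  | 0, _, _, e, e' => eq e e'
  | n + 1, .prod a b, k, e, e' =>
      or (ex k a (ex (k + 1) b (and (eq e (.pair (.var k) (.var (k + 1))))
          (or (reachIn n a (k + 2) (.var k) e') (reachIn n b (k + 2) (.var (k + 1)) e')))))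
        (reachIn n (.prod a b) k e e')
  | n + 1, .sum a b, k, e, e' =>
      or (or (ex k a (and (eq e (.inl a b (.var k))) (reachIn n a (k + 1) (.var k) e')))
          (ex k b (and (eq e (.inr a b (.var k))) (reachIn n b (k + 1) (.var k) e'))))
        (reachIn n (.sum a b) k e e')
  | n + 1, .ref a, k, e, e' =>
      or (reachIn n a k (.deref e) e') (reachIn n (.ref a) k e e')
  | _ + 1, _, _, _, _ => fls

end Formula

/-- The reading `ρ` makes the models of type `Δ` models of the formula environment `Γ`: type
variables denote closed types, and each variable name and location of `Γ` has the type that `Γ`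
says. (`Δ` may have further variables and locations.) -/
def Reading.Interprets (ρ : Reading) (Γ : FEnv) (Δ : Env) : Prop :=
  (∀ X, (ρ.tys X).Closed) ∧
  (∀ x a, Γ.vars x = some a → Δ.vars[ρ.pos x]? = some (a.inst ρ.tys)) ∧
  (∀ l a, Γ.locs l = some a → Δ.locs l = some (a.inst ρ.tys))

/-- `C ≡ D` is valid for formulae over `Γ`: they hold in the same models. -/
def Formula.Equivalent (Γ : FEnv) (C D : Formula) : Prop :=
  ∀ (Δ : Env) (ρ : Reading) (M : Model), ρ.Interprets Γ Δ → IsModel Δ M →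
    (C.Sat Δ M ρ ↔ D.Sat Δ M ρ)

end LocalState

/-! Everything is compared with `Reaches`, reachability inside the store of one given model.
Starting from a datum of finite type, each projection, case distinction or dereference leads to data
of a strictly smaller type. A recursion on the type therefore visits all locations reachable from
the datum, however large the store is, and `ncl_union` and `ncl_singleton` are the closure laws
behind it.

This recursion can be written as a program of the language. `reachProg` walks through the datum and
compares the references it meets with the target. Once reachability is decided by a program, it can
be observed by a context. Congruent models thus agree on it (`Reaches.of_modelEquiv`), and the
clause for the reachability predicate, which ranges over all congruent models, collapses to the
given one (`sat_reach_iff`).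

The same recursion shows that `reachO` expresses `Reaches` (`sat_reachO_iff`), but quantifiers and
equations of the logic need care. Quantified variables range over results of functional programs. To
find the components of a datum, such programs are exhibited: projections, and case distinctions
whose other branch diverges. Conversely, a functional program preserves a model only up to
congruence, so the invariance of reachability is used again (`Reaches.of_sat_ex`). Equations are
congruences of models too. A context that compares references shows that equal references are the
same location (`exists_loc_of_sat_eq`), and invariance once more shows that an equation transports
reachability (`Reaches.of_sat_eq`). In the other direction, a value of a sum type may carry
annotations that differ from those in the formula; its equation with the annotated injection holds
because convergence depends only on the program without annotations (`Step.of_sameErasure`).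

For `reachIn`, soundness is an induction on the number of steps and completeness an induction on the
type. The second part follows, since all three formulae are equivalent to `Reaches`. For the first
part, every reachability predicate is replaced by `reachO`; the replacement is sound in any position
because satisfaction evaluates subformulae in well-typed models only. -/

namespace LocalState

/-! ### Equi-recursive types -/

namespace Ty

theorem Unfolds.trans {a b c : Ty} (h : Unfolds a b) (h' : Unfolds b c) : Unfolds a c := by
  induction h with
  | refl => exact h'
  | step _ ih => exact .step (ih h')

theorem Unfolds.eq_of_isHead {a b : Ty} (h : Unfolds a b) (ha : a.IsHead) : b = a := by
  cases h with
  | refl => rfl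
  | step _ => exact ha.elim

theorem Match.mono {R R' : Ty → Ty → Prop} (h : ∀ a b, R a b → R' a b) {a b : Ty}
    (m : Match R a b) : Match R' a b := by
  cases m <;> constructor <;> exact h _ _ ‹_›

theorem Match.of_isHead {R : Ty → Ty → Prop} (h : ∀ a, R a a) {a : Ty} (ha : a.IsHead) :
    Match R a a := by
  cases a <;> first | exact ha.elim | (constructor <;> exact h _)

theorem Match.swap {R : Ty → Ty → Prop} {a b : Ty} (m : Match R a b) :
    Match (fun x y => R y x) b a := by
  cases m <;> constructor <;> assumption

theorem Match.comp {R R' : Ty → Ty → Prop} {a b c : Ty} (m : Match R a b) (m' : Match R' b c) :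
    Match (fun x z => ∃ y, R x y ∧ R' y z) a c := by
  cases m <;> cases m' <;> constructor <;> exact ⟨_, ‹_›, ‹_›⟩

theorem Match.isHead_left {R : Ty → Ty → Prop} {a b : Ty} (m : Match R a b) : a.IsHead := by
  cases m <;> trivial

theorem Match.isHead_right {R : Ty → Ty → Prop} {a b : Ty} (m : Match R a b) : b.IsHead := by
  cases m <;> trivial

theorem isBisim_eq : IsBisim Eq := by
  rintro a _ rfl
  exact ⟨fun a' h h' => ⟨a', h, .of_isHead (fun _ => rfl) h'⟩,
    fun a' h h' => ⟨a', h, .of_isHead (fun _ => rfl) h'⟩⟩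

theorem Eqv.refl (a : Ty) : Eqv a a := ⟨Eq, isBisim_eq, rfl⟩

theorem Eqv.symm {a b : Ty} : Eqv a b → Eqv b a := by
  rintro ⟨R, hR, h⟩
  refine ⟨fun x y => R y x, fun x y hxy => ⟨fun a' h h' => ?_, fun a' h h' => ?_⟩, h⟩
  · obtain ⟨b', hb, m⟩ := (hR _ _ hxy).2 a' h h'
    exact ⟨b', hb, m.swap⟩
  · obtain ⟨b', hb, m⟩ := (hR _ _ hxy).1 a' h h'
    exact ⟨b', hb, m.swap⟩

theorem Eqv.trans {a b c : Ty} : Eqv a b → Eqv b c → Eqv a c := by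
  rintro ⟨R, hR, h⟩ ⟨R', hR', h'⟩
  refine ⟨fun x z => ∃ y, R x y ∧ R' y z, ?_, b, h, h'⟩
  rintro x z ⟨y, hxy, hyz⟩
  refine ⟨fun x' u hd => ?_, fun z' u hd => ?_⟩
  · obtain ⟨y', uy, m⟩ := (hR _ _ hxy).1 x' u hd
    obtain ⟨z', uz, m'⟩ := (hR' _ _ hyz).1 y' uy m.isHead_right
    exact ⟨z', uz, m.comp m'⟩
  · obtain ⟨y', uy, m⟩ := (hR' _ _ hyz).2 z' u hd
    obtain ⟨x', ux, m'⟩ := (hR _ _ hxy).2 y' uy m.isHead_left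
    exact ⟨x', ux, m'.comp m⟩

/-- A union of bisimulations is a bisimulation: each pair brings its own witness, whose successors
lie in the union again. -/
theorem isBisim_eqv : IsBisim Eqv := by
  rintro a b ⟨R, hR, h⟩
  refine ⟨fun a' u hd => ?_, fun a' u hd => ?_⟩
  · obtain ⟨b', ub, m⟩ := (hR _ _ h).1 a' u hd
    exact ⟨b', ub, m.mono fun _ _ h => ⟨R, hR, h⟩⟩
  · obtain ⟨b', ub, m⟩ := (hR _ _ h).2 a' u hd
    exact ⟨b', ub, m.mono fun _ _ h => ⟨R, hR, h⟩⟩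

/-- A head unfolds to nothing but itself, so the partner supplied by the bisimulation has to be `b`.
-/
theorem Eqv.match_of_isHead {a b : Ty} (h : Eqv a b) (ha : a.IsHead) (hb : b.IsHead) :
    Match Eqv a b := by
  obtain ⟨b', ub, m⟩ := (isBisim_eqv a b h).1 a (.refl a) ha
  rwa [ub.eq_of_isHead hb] at m

/-- Adding to `Eqv` the pairs whose immediate subtypes are already equal gives a bisimulation,
because heads do not unfold further. -/
theorem Eqv.of_match {a b : Ty} (m : Match Eqv a b) : Eqv a b := by
  refine ⟨fun x y => Eqv x y ∨ Match Eqv x y, ?_, .inr m⟩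
  rintro x y (h | m)
  · refine ⟨fun a' u hd => ?_, fun a' u hd => ?_⟩
    · obtain ⟨b', ub, m⟩ := (isBisim_eqv _ _ h).1 a' u hd
      exact ⟨b', ub, m.mono fun _ _ => .inl⟩
    · obtain ⟨b', ub, m⟩ := (isBisim_eqv _ _ h).2 a' u hd
      exact ⟨b', ub, m.mono fun _ _ => .inl⟩
  · refine ⟨fun a' u _ => ?_, fun a' u _ => ?_⟩
    · rw [u.eq_of_isHead m.isHead_left]
      exact ⟨y, .refl y, m.mono fun _ _ => .inl⟩
    · rw [u.eq_of_isHead m.isHead_right]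
      exact ⟨x, .refl x, m.mono fun _ _ => .inl⟩

/-! ### Locally closed types and instantiation of type variables -/

theorem LCAt.mono {a : Ty} : ∀ {j k : ℕ}, LCAt j a → j ≤ k → LCAt k a := by
  induction a with
  | unit | bool | nat | tvar => intros; trivial
  | arrow a b iha ihb | prod a b iha ihb | sum a b iha ihb =>
      exact fun h hjk => ⟨iha h.1 hjk, ihb h.2 hjk⟩
  | ref a ih => exact fun h hjk => ih (j := _) h hjk
  | bvar n => exact fun h hjk => lt_of_lt_of_le h hjk
  | mu a ih => exact fun h hjk => ih (j := _ + 1) h (Nat.succ_le_succ hjk)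

theorem instB_of_lcAt {a : Ty} (s : Ty) : ∀ {k : ℕ}, LCAt k a → instB s k a = a := by
  induction a with
  | unit | bool | nat | tvar => intros; rfl
  | arrow a b iha ihb | prod a b iha ihb | sum a b iha ihb =>
      intro k h; simp only [instB, iha h.1, ihb h.2]
  | ref a ih => intro k h; simp only [instB, ih (k := k) h]
  | bvar n => intro k h; exact if_neg (ne_of_lt h)
  | mu a ih => intro k h; simp only [instB, ih (k := k + 1) h]

theorem inst_instB {δ : ℕ → Ty} (hδ : ∀ X, (δ X).LC) (s a : Ty) :
    ∀ k, (instB s k a).inst δ = instB (s.inst δ) k (a.inst δ) := by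
  induction a with
  | unit | bool | nat => intros; rfl
  | arrow a b iha ihb | prod a b iha ihb | sum a b iha ihb =>
      intro k; simp only [instB, inst, iha, ihb]
  | ref a ih | mu a ih => intro k; simp only [instB, inst, ih]
  -- The type put in place of a variable has no dangling index, so opening a binder does not touch
  -- it.
  | tvar X => exact fun k => (instB_of_lcAt _ ((hδ X).mono (Nat.zero_le k))).symm
  | bvar n => intro k; simp only [instB, inst]; split <;> rfl

theorem LCAt.inst {δ : ℕ → Ty} (hδ : ∀ X, (δ X).LC) {a : Ty} :
    ∀ {k : ℕ}, LCAt k a → LCAt k (a.inst δ) := by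
  induction a with
  | unit | bool | nat => intros; trivial
  | arrow a b iha ihb | prod a b iha ihb | sum a b iha ihb => exact fun h => ⟨iha h.1, ihb h.2⟩
  | ref a ih => exact fun h => ih (k := _) h
  | tvar X => exact fun _ => (hδ X).mono (Nat.zero_le _)
  | bvar n => exact fun h => h
  | mu a ih => exact fun h => ih (k := _ + 1) h

theorem not_hasTVar_inst {δ : ℕ → Ty} (hδ : ∀ X, (δ X).Closed) (a : Ty) (X : ℕ) :
    ¬ HasTVar X (a.inst δ) := by
  induction a with
  | unit | bool | nat | bvar => exact id
  | arrow a b iha ihb | prod a b iha ihb | sum a b iha ihb => exact fun h => h.elim iha ihb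
  | ref a ih | mu a ih => exact ih
  | tvar Y => exact (hδ Y).2 X

theorem LC.closed_inst {δ : ℕ → Ty} (hδ : ∀ X, (δ X).Closed) {a : Ty} (h : a.LC) :
    (a.inst δ).Closed :=
  ⟨LCAt.inst (fun X => (hδ X).1) h, not_hasTVar_inst hδ a⟩

theorem inst_congr {δ δ' : ℕ → Ty} (a : Ty) (h : ∀ X, HasTVar X a → δ X = δ' X) :
    a.inst δ = a.inst δ' := by
  induction a with
  | unit | bool | nat | bvar => rfl
  | arrow a b iha ihb | prod a b iha ihb | sum a b iha ihb =>
      simp only [inst, iha fun X hX => h X (.inl hX), ihb fun X hX => h X (.inr hX)]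
  | ref a ih | mu a ih => simp only [inst, ih fun X hX => h X hX]
  | tvar Y => exact h Y rfl

theorem inst_tvar (a : Ty) : a.inst tvar = a := by
  induction a <;> simp_all [inst]

theorem inst_of_no_tvar {δ : ℕ → Ty} {a : Ty} (h : ∀ X, ¬ HasTVar X a) : a.inst δ = a :=
  (inst_congr a fun X hX => (h X hX).elim).trans (inst_tvar a)

theorem IsFinite.closed {a : Ty} (h : a.IsFinite) : a.Closed := by
  induction a with
  | unit | bool | nat => exact ⟨trivial, fun _ => id⟩
  | arrow | tvar | bvar | mu => exact h.elim
  | prod a b iha ihb | sum a b iha ihb =>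
      exact ⟨⟨(iha h.1).1, (ihb h.2).1⟩, fun X hX => hX.elim ((iha h.1).2 X) ((ihb h.2).2 X)⟩
  | ref a ih => exact ⟨(ih h).1, (ih h).2⟩

theorem IsFinite.inst_eq {a : Ty} (h : a.IsFinite) (δ : ℕ → Ty) : a.inst δ = a :=
  inst_of_no_tvar h.closed.2

theorem Unfolds.inst {δ : ℕ → Ty} (hδ : ∀ X, (δ X).LC) {a b : Ty} (h : Unfolds a b) :
    Unfolds (a.inst δ) (b.inst δ) := by
  induction h with
  | refl => exact .refl _
  | step _ ih => exact .step (by rwa [inst_instB hδ] at ih)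

/-- Unfolding an instance first follows the unfolding of the type itself. Either a proper
constructor appears there, or a type variable does and the rest takes place inside the type
substituted for it. -/
theorem Unfolds.of_inst {δ : ℕ → Ty} (hδ : ∀ X, (δ X).LC) {c h : Ty} (u : Unfolds c h) :
    ∀ a : Ty, c = a.inst δ → h.IsHead →
      (∃ a', Unfolds a a' ∧ a'.IsHead ∧ (∀ X, a' ≠ tvar X) ∧ h = a'.inst δ) ∨
        ∃ X, Unfolds a (tvar X) ∧ Unfolds (δ X) h := by
  induction u with
  | refl c =>
      rintro a rfl hd
      cases a with
      | tvar X => exact .inr ⟨X, .refl _, .refl _⟩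
      | bvar | mu => exact hd.elim
      | _ => exact .inl ⟨_, .refl _, trivial, fun _ => nofun, rfl⟩
  | @step m h u ih =>
      intro a hc hd
      cases a with
      | tvar X =>
          have hX : δ X = mu m := hc.symm
          exact .inr ⟨X, .refl _, by rw [hX]; exact .step u⟩
      | mu a =>
          obtain rfl : m = a.inst δ := by injection hc
          obtain ⟨a', ua, h1, h2, h3⟩ | ⟨X, ua, uX⟩ :=
            ih (instB (mu a) 0 a) (inst_instB hδ (mu a) a 0).symm hd
          · exact .inl ⟨a', .step ua, h1, h2, h3⟩
          · exact .inr ⟨X, .step ua, uX⟩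
      | _ => cases hc

theorem Match.inst {R R' : Ty → Ty → Prop} {δ : ℕ → Ty}
    (h : ∀ a b, R a b → R' (a.inst δ) (b.inst δ)) {a b : Ty} (m : Match R a b)
    (ha : ∀ X, a ≠ .tvar X) : Match R' (a.inst δ) (b.inst δ) := by
  cases m with
  | tvar X => exact (ha X rfl).elim
  | _ => constructor <;> exact h _ _ ‹_›

/-- This makes the conversion rule stable under readings. The bisimulation consists of the instances
of equal types and of all identical pairs; the latter are needed once both sides have entered the
same type variable. -/
theorem Eqv.inst {δ : ℕ → Ty} (hδ : ∀ X, (δ X).LC) {a b : Ty} (h : Eqv a b) :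
    Eqv (a.inst δ) (b.inst δ) := by
  let R : Ty → Ty → Prop := fun x y => x = y ∨ ∃ a b, Eqv a b ∧ x = a.inst δ ∧ y = b.inst δ
  have hR : ∀ a b, Eqv a b → ∀ h, Unfolds (a.inst δ) h → h.IsHead →
      ∃ h', Unfolds (b.inst δ) h' ∧ Match R h h' := by
    intro a b hab h u hd
    obtain ⟨a', ua, ha', hX, rfl⟩ | ⟨X, ua, uX⟩ := u.of_inst hδ a rfl hd
    · obtain ⟨b', ub, m⟩ := (isBisim_eqv a b hab).1 a' ua ha'
      exact ⟨b'.inst δ, ub.inst hδ, m.inst (fun x y hxy => .inr ⟨x, y, hxy, rfl, rfl⟩) hX⟩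
    · obtain ⟨b', ub, m⟩ := (isBisim_eqv a b hab).1 _ ua trivial
      cases m
      exact ⟨h, (ub.inst hδ).trans uX, .of_isHead (fun _ => .inl rfl) hd⟩
  refine ⟨R, ?_, .inr ⟨a, b, h, rfl, rfl⟩⟩
  rintro x y (rfl | ⟨a, b, hab, rfl, rfl⟩)
  · exact ⟨fun a' h h' => ⟨a', h, .of_isHead (fun _ => .inl rfl) h'⟩,
      fun a' h h' => ⟨a', h, .of_isHead (fun _ => .inl rfl) h'⟩⟩
  · refine ⟨hR a b hab, fun h u hd => ?_⟩
    obtain ⟨h', u', m⟩ := hR b a hab.symm h u hd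
    refine ⟨h', u', m.swap.mono ?_⟩
    rintro x y (rfl | ⟨a, b, hab, rfl, rfl⟩)
    · exact .inl rfl
    · exact .inr ⟨b, a, hab.symm, rfl, rfl⟩

end Ty

/-! ### Reduction -/

theorem Term.IsValue.not_step {V : Term} (hV : V.IsValue) {h : Finset ℕ} {σ : Store} {c : Config} :
    ¬ Step ⟨h, V, σ⟩ c := by
  induction V generalizing c with
  | pair M N ihM ihN =>
      intro st
      cases st with
      | pairL st => exact ihM hV.1 st
      | pairR _ st => exact ihN hV.2 st
  | inl a b M ih =>
      intro st
      cases st with | inlC st => exact ih hV st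
  | inr a b M ih =>
      intro st
      cases st with | inrC st => exact ih hV st
  | var | unit | bool | nat | loc | lam | recfn => intro st; cases st
  | _ => exact hV.elim

theorem UnOp.isValue_of_eval {o : UnOp} {V W : Term} (h : o.eval V = some W) :
    V.IsValue ∧ W.IsValue := by
  unfold UnOp.eval at h
  split at h <;> simp_all only [Option.some.injEq, reduceCtorEq]
  subst h
  exact ⟨trivial, trivial⟩

theorem BinOp.isValue_of_eval {o : BinOp} {V V' W : Term} (h : o.eval V V' = some W) :
    V.IsValue ∧ V'.IsValue ∧ W.IsValue := by
  unfold BinOp.eval at h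
  split at h <;> simp_all only [Option.some.injEq, reduceCtorEq] <;> subst h <;>
    exact ⟨trivial, trivial, trivial⟩

/-- Reduction is deterministic except for the choice of the name of a new reference. -/
theorem Step.deterministic {c c₁ : Config} (st : Step c c₁) (hh : c₁.hid = c.hid) {c₂ : Config}
    (st' : Step c c₂) : c₂ = c₁ := by
  induction st generalizing c₂ with
  -- Allocation properly enlarges the hidden set, which `hh` rules out.
  | ref _ _ hl => exact (hl (Finset.insert_eq_self.1 hh)).elim
  | beta hV =>
      cases st' with
      | beta => rfl
      | appL s => cases s
      | appR _ s => exact (hV.not_step s).elim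
  | unroll hV =>
      cases st' with
      | unroll => rfl
      | appL s => cases s
      | appR _ s => exact (hV.not_step s).elim
  | fst hV hW =>
      cases st' with
      | fst => rfl
      | fstC s => exact (Term.IsValue.not_step (V := .pair _ _) ⟨hV, hW⟩ s).elim
  | snd hV hW =>
      cases st' with
      | snd => rfl
      | sndC s => exact (Term.IsValue.not_step (V := .pair _ _) ⟨hV, hW⟩ s).elim
  | condT =>
      cases st' with
      | condT => rfl
      | condC s => cases s
  | condF =>
      cases st' with
      | condF => rfl
      | condC s => cases s
  | caseL hV =>
      cases st' with
      | caseL => rfl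
      | caseC s => exact (Term.IsValue.not_step (V := .inl _ _ _) hV s).elim
  | caseR hV =>
      cases st' with
      | caseR => rfl
      | caseC s => exact (Term.IsValue.not_step (V := .inr _ _ _) hV s).elim
  | un ho =>
      cases st' with
      | un ho' => cases ho.symm.trans ho'; rfl
      | unC s => exact ((UnOp.isValue_of_eval ho).1.not_step s).elim
  | bin ho =>
      cases st' with
      | bin ho' => cases ho.symm.trans ho'; rfl
      | binL s => exact ((BinOp.isValue_of_eval ho).1.not_step s).elim
      | binR _ s => exact ((BinOp.isValue_of_eval ho).2.1.not_step s).elim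
  | deref ho =>
      cases st' with
      | deref ho' => cases ho.symm.trans ho'; rfl
      | derefC s => cases s
  | assign hV =>
      cases st' with
      | assign => rfl
      | assignL s => cases s
      | assignR _ s => exact (hV.not_step s).elim
  | appL s ih =>
      cases st' with
      | beta | unroll => cases s
      | appL s' => cases ih hh s'; rfl
      | appR hV _ => exact (hV.not_step s).elim
  | appR hV s ih =>
      cases st' with
      | beta hW | unroll hW => exact (hW.not_step s).elim
      | appL s' => exact (hV.not_step s').elim
      | appR _ s' => cases ih hh s'; rfl
  | pairL s ih =>
      cases st' with
      | pairL s' => cases ih hh s'; rfl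
      | pairR hV _ => exact (hV.not_step s).elim
  | pairR hV s ih =>
      cases st' with
      | pairL s' => exact (hV.not_step s').elim
      | pairR _ s' => cases ih hh s'; rfl
  | fstC s ih =>
      cases st' with
      | fst hV hW => exact (Term.IsValue.not_step (V := .pair _ _) ⟨hV, hW⟩ s).elim
      | fstC s' => cases ih hh s'; rfl
  | sndC s ih =>
      cases st' with
      | snd hV hW => exact (Term.IsValue.not_step (V := .pair _ _) ⟨hV, hW⟩ s).elim
      | sndC s' => cases ih hh s'; rfl
  | inlC s ih => cases st' with | inlC s' => cases ih hh s'; rfl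
  | inrC s ih => cases st' with | inrC s' => cases ih hh s'; rfl
  | unC s ih =>
      cases st' with
      | un ho => exact ((UnOp.isValue_of_eval ho).1.not_step s).elim
      | unC s' => cases ih hh s'; rfl
  | binL s ih =>
      cases st' with
      | bin ho => exact ((BinOp.isValue_of_eval ho).1.not_step s).elim
      | binL s' => cases ih hh s'; rfl
      | binR hV _ => exact (hV.not_step s).elim
  | binR hV s ih =>
      cases st' with
      | bin ho => exact ((BinOp.isValue_of_eval ho).2.1.not_step s).elim
      | binL s' => exact (hV.not_step s').elim
      | binR _ s' => cases ih hh s'; rfl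
  | condC s ih =>
      cases st' with
      | condT | condF => cases s
      | condC s' => cases ih hh s'; rfl
  | caseC s ih =>
      cases st' with
      | caseL hV => exact (Term.IsValue.not_step (V := .inl _ _ _) hV s).elim
      | caseR hV => exact (Term.IsValue.not_step (V := .inr _ _ _) hV s).elim
      | caseC s' => cases ih hh s'; rfl
  | derefC s ih =>
      cases st' with
      | deref => cases s
      | derefC s' => cases ih hh s'; rfl
  | assignL s ih =>
      cases st' with
      | assign => cases s
      | assignL s' => cases ih hh s'; rfl
      | assignR hV _ => exact (hV.not_step s).elim
  | assignR hV s ih =>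
      cases st' with
      | assign hW => exact (hW.not_step s).elim
      | assignL s' => exact (hV.not_step s').elim
      | assignR _ s' => cases ih hh s'; rfl
  | refC s ih =>
      cases st' with
      | ref hV => exact (hV.not_step s).elim
      | refC s' => cases ih hh s'; rfl

/-- Reduction that changes neither the store nor the hidden locations. -/
def PureSteps (h : Finset ℕ) (σ : Store) : Term → Term → Prop :=
  Relation.ReflTransGen fun M N => Step ⟨h, M, σ⟩ ⟨h, N, σ⟩

namespace PureSteps

variable {h : Finset ℕ} {σ : Store} {M N P : Term}

theorem refl (M : Term) : PureSteps h σ M M := Relation.ReflTransGen.refl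

theorem trans (s : PureSteps h σ M N) (s' : PureSteps h σ N P) : PureSteps h σ M P :=
  Relation.ReflTransGen.trans s s'

theorem tail (s : PureSteps h σ M N) (s' : Step ⟨h, N, σ⟩ ⟨h, P, σ⟩) : PureSteps h σ M P :=
  Relation.ReflTransGen.tail s s'

theorem map (f : Term → Term)
    (hf : ∀ M N, Step ⟨h, M, σ⟩ ⟨h, N, σ⟩ → Step ⟨h, f M, σ⟩ ⟨h, f N, σ⟩)
    (s : PureSteps h σ M N) : PureSteps h σ (f M) (f N) :=
  Relation.ReflTransGen.lift f hf _ _ s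

theorem steps (s : PureSteps h σ M N) : Relation.ReflTransGen Step ⟨h, M, σ⟩ ⟨h, N, σ⟩ :=
  Relation.ReflTransGen.lift (fun M => (⟨h, M, σ⟩ : Config)) (fun _ _ h => h) _ _ s

/-- By `Step.deterministic` a pure step has no competitor, so every evaluation of `M` runs through
`N`. -/
theorem evalsTo_iff (s : PureSteps h σ M N) {c : Config} :
    EvalsTo ⟨h, M, σ⟩ c ↔ EvalsTo ⟨h, N, σ⟩ c := by
  refine ⟨fun e => ?_, fun e => ⟨s.steps.trans e.1, e.2⟩⟩
  induction s using Relation.ReflTransGen.head_induction_on with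
  | refl => exact e
  | head st _ ih =>
      refine ih ⟨?_, e.2⟩
      obtain h | ⟨d, st', r⟩ := e.1.cases_head
      · subst h
        exact (e.2.not_step st).elim
      · rwa [st.deterministic rfl st'] at r

theorem converges_iff (s : PureSteps h σ M N) :
    Converges ⟨h, M, σ⟩ ↔ Converges ⟨h, N, σ⟩ :=
  exists_congr fun _ => s.evalsTo_iff

theorem pair {M' N' : Term} (s : PureSteps h σ M M') (hV : M'.IsValue) (s' : PureSteps h σ N N') :
    PureSteps h σ (.pair M N) (.pair M' N') :=
  (s.map (.pair · N) fun _ _ => .pairL).trans (s'.map (.pair M') fun _ _ => .pairR hV)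

theorem bin {o : BinOp} {M' N' : Term} (s : PureSteps h σ M M') (hV : M'.IsValue)
    (s' : PureSteps h σ N N') : PureSteps h σ (.bin o M N) (.bin o M' N') :=
  (s.map (.bin o · N) fun _ _ => .binL).trans (s'.map (.bin o M') fun _ _ => .binR hV)

theorem fst {V W : Term} (s : PureSteps h σ M (.pair V W)) (hV : V.IsValue) (hW : W.IsValue) :
    PureSteps h σ (.fst M) V :=
  (s.map .fst fun _ _ => .fstC).tail (.fst hV hW)

theorem snd {V W : Term} (s : PureSteps h σ M (.pair V W)) (hV : V.IsValue) (hW : W.IsValue) :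
    PureSteps h σ (.snd M) W :=
  (s.map .snd fun _ _ => .sndC).tail (.snd hV hW)

theorem deref {l : ℕ} {V : Term} (s : PureSteps h σ M (.loc l)) (hl : σ l = some V) :
    PureSteps h σ (.deref M) V :=
  (s.map .deref fun _ _ => .derefC).tail (.deref hl)

theorem caseL {a b c d : Ty} {V : Term} (s : PureSteps h σ M (.inl c d V)) (hV : V.IsValue) :
    PureSteps h σ (.caseOf M a N b P) (.subst1 V N) :=
  (s.map (.caseOf · a N b P) fun _ _ => .caseC).tail (.caseL hV)

theorem caseR {a b c d : Ty} {V : Term} (s : PureSteps h σ M (.inr c d V)) (hV : V.IsValue) :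
    PureSteps h σ (.caseOf M a N b P) (.subst1 V P) :=
  (s.map (.caseOf · a N b P) fun _ _ => .caseC).tail (.caseR hV)

theorem cond {b : Bool} (s : PureSteps h σ M (.bool b)) :
    PureSteps h σ (.cond M N P) (if b then N else P) := by
  refine (s.map (.cond · N P) fun _ _ => .condC).tail ?_
  cases b
  · exact .condF
  · exact .condT

theorem beta {a : Ty} {V : Term} (s : PureSteps h σ M V) (hV : V.IsValue) :
    PureSteps h σ (.app (.lam a N) M) (.subst1 V N) :=
  (s.map (.app (.lam a N)) fun _ _ => .appR trivial).tail (.beta hV)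

end PureSteps

/-- A diverging program of type `a`. -/
def omega (a : Ty) : Term := .app (.recfn .unit a (.app (.var 1) (.var 0))) .unit

theorem subst_omega (s : ℕ → Term) (a : Ty) : (omega a).subst s = omega a := rfl

/-- One unrolling reproduces the configuration exactly, and determinism leaves no other step. -/
theorem omega_not_evalsTo {a : Ty} {h : Finset ℕ} {σ : Store} {c : Config} :
    ¬ EvalsTo ⟨h, omega a, σ⟩ c := by
  rintro ⟨r, hv⟩
  suffices h : c = ⟨h, omega a, σ⟩ by
    subst h
    exact hv
  clear hv
  induction r with
  | refl => rfl
  | tail _ st ih =>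
      subst ih
      exact Step.deterministic (Step.unroll (a := .unit) (b := a) (V := .unit)
        (M := .app (.var 1) (.var 0)) trivial) rfl st

/-! ### Type annotations have no effect on reduction -/

namespace Term

/-- The program with its type annotations erased. -/
def erase : Term → Term
  | var n => var n
  | unit => unit
  | bool b => bool b
  | nat n => nat n
  | loc l => loc l
  | lam _ M => lam .unit (erase M)
  | recfn _ _ M => recfn .unit .unit (erase M)
  | app M N => app (erase M) (erase N)
  | assign M N => assign (erase M) (erase N)
  | ref M => ref (erase M)
  | deref M => deref (erase M)
  | un o M => un o (erase M)
  | bin o M N => bin o (erase M) (erase N)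
  | fst M => fst (erase M)
  | snd M => snd (erase M)
  | pair M N => pair (erase M) (erase N)
  | inl _ _ M => inl .unit .unit (erase M)
  | inr _ _ M => inr .unit .unit (erase M)
  | cond M N P => cond (erase M) (erase N) (erase P)
  | caseOf M _ N _ P => caseOf (erase M) .unit (erase N) .unit (erase P)

theorem erase_rename (M : Term) : ∀ r, (M.rename r).erase = M.erase.rename r := by
  induction M <;> intro r <;> simp_all [rename, erase]

theorem erase_subst (M : Term) :
    ∀ s, (M.subst s).erase = M.erase.subst fun n => (s n).erase := by
  have hl : ∀ s, (fun n => (liftS s n).erase) = liftS fun n => (s n).erase := by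
    intro s
    funext n
    cases n
    · rfl
    · exact erase_rename _ _
  induction M <;> intro s <;> simp_all [subst, erase]

theorem isValue_erase (M : Term) : M.erase.IsValue ↔ M.IsValue := by
  induction M <;> simp_all [IsValue, erase]

theorem erase_subst1 (V M : Term) : (subst1 V M).erase = subst1 V.erase M.erase := by
  rw [subst1, erase_subst, subst1]
  congr 1
  funext n
  cases n <;> rfl

theorem erase_subst2 (V W M : Term) : (subst2 V W M).erase = subst2 V.erase W.erase M.erase := by
  rw [subst2, erase_subst, subst2]
  congr 1
  funext n
  rcases n with _ | _ | n <;> rfl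

theorem IsValue.of_erase_eq {V W : Term} (hV : V.IsValue) (h : W.erase = V.erase) : W.IsValue := by
  rwa [← isValue_erase, h, isValue_erase]

theorem erase_eq_app {P M N : Term} (h : P.erase = app M N) :
    ∃ M' N', P = app M' N' ∧ M'.erase = M ∧ N'.erase = N := by
  cases P <;> simp_all [erase]

theorem erase_eq_assign {P M N : Term} (h : P.erase = assign M N) :
    ∃ M' N', P = assign M' N' ∧ M'.erase = M ∧ N'.erase = N := by
  cases P <;> simp_all [erase]

theorem erase_eq_pair {P M N : Term} (h : P.erase = pair M N) :
    ∃ M' N', P = pair M' N' ∧ M'.erase = M ∧ N'.erase = N := by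
  cases P <;> simp_all [erase]

theorem erase_eq_ref {P M : Term} (h : P.erase = ref M) :
    ∃ M', P = ref M' ∧ M'.erase = M := by
  cases P <;> simp_all [erase]

theorem erase_eq_deref {P M : Term} (h : P.erase = deref M) :
    ∃ M', P = deref M' ∧ M'.erase = M := by
  cases P <;> simp_all [erase]

theorem erase_eq_fst {P M : Term} (h : P.erase = fst M) :
    ∃ M', P = fst M' ∧ M'.erase = M := by
  cases P <;> simp_all [erase]

theorem erase_eq_snd {P M : Term} (h : P.erase = snd M) :
    ∃ M', P = snd M' ∧ M'.erase = M := by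
  cases P <;> simp_all [erase]

theorem erase_eq_un {o : UnOp} {P M : Term} (h : P.erase = un o M) :
    ∃ M', P = un o M' ∧ M'.erase = M := by
  cases P <;> simp_all [erase]

theorem erase_eq_bin {o : BinOp} {P M N : Term} (h : P.erase = bin o M N) :
    ∃ M' N', P = bin o M' N' ∧ M'.erase = M ∧ N'.erase = N := by
  cases P <;> simp_all [erase]

theorem erase_eq_inl {c d : Ty} {P M : Term} (h : P.erase = inl c d M) :
    ∃ a b M', P = inl a b M' ∧ M'.erase = M := by
  cases P <;> simp_all [erase]

theorem erase_eq_inr {c d : Ty} {P M : Term} (h : P.erase = inr c d M) :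
    ∃ a b M', P = inr a b M' ∧ M'.erase = M := by
  cases P <;> simp_all [erase]

theorem erase_eq_lam {c : Ty} {P M : Term} (h : P.erase = lam c M) :
    ∃ a M', P = lam a M' ∧ M'.erase = M := by
  cases P <;> simp_all [erase]

theorem erase_eq_recfn {c d : Ty} {P M : Term} (h : P.erase = recfn c d M) :
    ∃ a b M', P = recfn a b M' ∧ M'.erase = M := by
  cases P <;> simp_all [erase]

theorem erase_eq_cond {P M N Q : Term} (h : P.erase = cond M N Q) :
    ∃ M' N' Q', P = cond M' N' Q' ∧ M'.erase = M ∧ N'.erase = N ∧ Q'.erase = Q := by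
  cases P <;> simp_all [erase]

theorem erase_eq_caseOf {c d : Ty} {P M N Q : Term} (h : P.erase = caseOf M c N d Q) :
    ∃ M' a N' b Q', P = caseOf M' a N' b Q' ∧ M'.erase = M ∧ N'.erase = N ∧ Q'.erase = Q := by
  cases P <;> simp_all [erase]

theorem erase_eq_bool {P : Term} {b : Bool} (h : P.erase = bool b) : P = bool b := by
  cases P <;> simp_all [erase]

theorem erase_eq_loc {P : Term} {l : ℕ} (h : P.erase = loc l) : P = loc l := by
  cases P <;> simp_all [erase]

end Term

/-- Operations compute on base data and locations, which carry no annotations; the result is the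
same and not merely the same up to erasure. -/
theorem UnOp.eval_erase {o : UnOp} {V W V' : Term} (h : o.eval V = some W)
    (hV : V'.erase = V.erase) : o.eval V' = some W := by
  unfold UnOp.eval at h
  split at h <;> simp_all only [Option.some.injEq, reduceCtorEq]
  cases V' <;> simp_all [Term.erase, UnOp.eval]

theorem BinOp.eval_erase {o : BinOp} {V₁ V₂ W V₁' V₂' : Term} (h : o.eval V₁ V₂ = some W)
    (h₁ : V₁'.erase = V₁.erase) (h₂ : V₂'.erase = V₂.erase) : o.eval V₁' V₂' = some W := by
  unfold BinOp.eval at h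
  split at h <;> simp_all only [Option.some.injEq, reduceCtorEq] <;>
    cases V₁' <;> simp_all only [Term.erase, reduceCtorEq] <;>
    cases V₂' <;> simp_all [Term.erase, BinOp.eval]

/-- Configurations that agree up to type annotations. -/
inductive Config.SameErasure : Config → Config → Prop
  | mk {h : Finset ℕ} {M M' : Term} {σ σ' : Store} : M'.erase = M.erase →
      (∀ l, (σ' l).map Term.erase = (σ l).map Term.erase) → SameErasure ⟨h, M, σ⟩ ⟨h, M', σ'⟩

theorem map_erase_update {σ σ' : Store} {V V' : Term} (l : ℕ) (hV : V'.erase = V.erase)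
    (hs : ∀ l, (σ' l).map Term.erase = (σ l).map Term.erase) (l' : ℕ) :
    (Function.update σ' l (some V') l').map Term.erase =
      (Function.update σ l (some V) l').map Term.erase := by
  by_cases hl : l' = l
  · subst hl
    simp [hV]
  · simp [hl, hs]

/-- No rule inspects an annotation, so a configuration with the same erasure has a redex of the same
kind, and an allocation can choose the same location. This matters because the conversion rule
allows values of one type to be annotated in different ways. -/
theorem Step.of_sameErasure {c c' : Config} (st : Step c c') :
    ∀ {d : Config}, c.SameErasure d → ∃ d', Step d d' ∧ c'.SameErasure d' := by
  induction st with
  | beta hV =>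
      rintro _ ⟨hp, hs⟩
      obtain ⟨_, V', rfl, hf, hV'⟩ := Term.erase_eq_app hp
      obtain ⟨_, M', rfl, hM⟩ := Term.erase_eq_lam hf
      exact ⟨_, .beta (hV.of_erase_eq hV'), .mk (by simp only [Term.erase_subst1, hV', hM]) hs⟩
  | unroll hV =>
      rintro _ ⟨hp, hs⟩
      obtain ⟨_, V', rfl, hf, hV'⟩ := Term.erase_eq_app hp
      obtain ⟨_, _, M', rfl, hM⟩ := Term.erase_eq_recfn hf
      exact ⟨_, .unroll (hV.of_erase_eq hV'),
        .mk (by simp only [Term.erase_subst2, Term.erase, hV', hM]) hs⟩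
  | fst hV hW =>
      rintro _ ⟨hp, hs⟩
      obtain ⟨P, rfl, hq⟩ := Term.erase_eq_fst hp
      obtain ⟨V', W', rfl, hV', hW'⟩ := Term.erase_eq_pair hq
      exact ⟨_, .fst (hV.of_erase_eq hV') (hW.of_erase_eq hW'), .mk hV' hs⟩
  | snd hV hW =>
      rintro _ ⟨hp, hs⟩
      obtain ⟨P, rfl, hq⟩ := Term.erase_eq_snd hp
      obtain ⟨V', W', rfl, hV', hW'⟩ := Term.erase_eq_pair hq
      exact ⟨_, .snd (hV.of_erase_eq hV') (hW.of_erase_eq hW'), .mk hW' hs⟩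
  | condT =>
      rintro _ ⟨hp, hs⟩
      obtain ⟨_, M', N', rfl, hp, hM, hN⟩ := Term.erase_eq_cond hp
      obtain rfl := Term.erase_eq_bool hp
      exact ⟨_, .condT, .mk hM hs⟩
  | condF =>
      rintro _ ⟨hp, hs⟩
      obtain ⟨_, M', N', rfl, hp, hM, hN⟩ := Term.erase_eq_cond hp
      obtain rfl := Term.erase_eq_bool hp
      exact ⟨_, .condF, .mk hN hs⟩
  | caseL hV =>
      rintro _ ⟨hp, hs⟩
      obtain ⟨_, _, N', _, P', rfl, hp, hN, hP⟩ := Term.erase_eq_caseOf hp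
      obtain ⟨_, _, V', rfl, hV'⟩ := Term.erase_eq_inl hp
      exact ⟨_, .caseL (hV.of_erase_eq hV'), .mk (by simp only [Term.erase_subst1, hV', hN]) hs⟩
  | caseR hV =>
      rintro _ ⟨hp, hs⟩
      obtain ⟨_, _, N', _, P', rfl, hp, hN, hP⟩ := Term.erase_eq_caseOf hp
      obtain ⟨_, _, V', rfl, hV'⟩ := Term.erase_eq_inr hp
      exact ⟨_, .caseR (hV.of_erase_eq hV'), .mk (by simp only [Term.erase_subst1, hV', hP]) hs⟩
  | un ho =>
      rintro _ ⟨hp, hs⟩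
      obtain ⟨_, rfl, hV⟩ := Term.erase_eq_un hp
      exact ⟨_, .un (UnOp.eval_erase ho hV), .mk rfl hs⟩
  | bin ho =>
      rintro _ ⟨hp, hs⟩
      obtain ⟨_, _, rfl, hV, hV'⟩ := Term.erase_eq_bin hp
      exact ⟨_, .bin (BinOp.eval_erase ho hV hV'), .mk rfl hs⟩
  | @deref _ σ l V hl =>
      rintro _ ⟨hp, hs⟩
      obtain ⟨P, rfl, hq⟩ := Term.erase_eq_deref hp
      obtain rfl := Term.erase_eq_loc hq
      have hl' := hs l
      rw [hl, Option.map_some, Option.map_eq_some_iff] at hl'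
      obtain ⟨V', hV', hV⟩ := hl'
      exact ⟨_, .deref hV', .mk hV hs⟩
  | @assign _ σ l V W hV hl =>
      rintro _ ⟨hp, hs⟩
      obtain ⟨_, V', rfl, hp, hV'⟩ := Term.erase_eq_assign hp
      obtain rfl := Term.erase_eq_loc hp
      have hl' := hs l
      rw [hl, Option.map_some, Option.map_eq_some_iff] at hl'
      obtain ⟨W', hW', -⟩ := hl'
      exact ⟨_, .assign (hV.of_erase_eq hV') hW', .mk rfl (map_erase_update l hV' hs)⟩
  | @ref _ σ l V hV hl hh =>
      rintro _ ⟨hp, hs⟩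
      obtain ⟨V', rfl, hV'⟩ := Term.erase_eq_ref hp
      have hl' := hs l
      rw [hl, Option.map_none, Option.map_eq_none_iff] at hl'
      exact ⟨_, .ref (hV.of_erase_eq hV') hl' hh, .mk rfl (map_erase_update l hV' hs)⟩
  | appL _ ih =>
      rintro _ ⟨hp, hs⟩
      obtain ⟨M', N', rfl, hM, hN⟩ := Term.erase_eq_app hp
      obtain ⟨_, st, hM', hs'⟩ := ih (.mk hM hs)
      exact ⟨_, .appL st, .mk (by simp_all only [Term.erase]) hs'⟩
  | appR hv _ ih =>
      rintro _ ⟨hp, hs⟩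
      obtain ⟨V', M', rfl, hV, hM⟩ := Term.erase_eq_app hp
      obtain ⟨_, st, hM', hs'⟩ := ih (.mk hM hs)
      exact ⟨_, .appR (hv.of_erase_eq hV) st, .mk (by simp_all only [Term.erase]) hs'⟩
  | pairL _ ih =>
      rintro _ ⟨hp, hs⟩
      obtain ⟨M', N', rfl, hM, hN⟩ := Term.erase_eq_pair hp
      obtain ⟨_, st, hM', hs'⟩ := ih (.mk hM hs)
      exact ⟨_, .pairL st, .mk (by simp_all only [Term.erase]) hs'⟩
  | pairR hv _ ih =>
      rintro _ ⟨hp, hs⟩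
      obtain ⟨V', M', rfl, hV, hM⟩ := Term.erase_eq_pair hp
      obtain ⟨_, st, hM', hs'⟩ := ih (.mk hM hs)
      exact ⟨_, .pairR (hv.of_erase_eq hV) st, .mk (by simp_all only [Term.erase]) hs'⟩
  | fstC _ ih =>
      rintro _ ⟨hp, hs⟩
      obtain ⟨M', rfl, hM⟩ := Term.erase_eq_fst hp
      obtain ⟨_, st, hM', hs'⟩ := ih (.mk hM hs)
      exact ⟨_, .fstC st, .mk (by simp_all only [Term.erase]) hs'⟩
  | sndC _ ih =>
      rintro _ ⟨hp, hs⟩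
      obtain ⟨M', rfl, hM⟩ := Term.erase_eq_snd hp
      obtain ⟨_, st, hM', hs'⟩ := ih (.mk hM hs)
      exact ⟨_, .sndC st, .mk (by simp_all only [Term.erase]) hs'⟩
  | inlC _ ih =>
      rintro _ ⟨hp, hs⟩
      obtain ⟨_, _, M', rfl, hM⟩ := Term.erase_eq_inl hp
      obtain ⟨_, st, hM', hs'⟩ := ih (.mk hM hs)
      exact ⟨_, .inlC st, .mk (by simp_all only [Term.erase]) hs'⟩
  | inrC _ ih =>
      rintro _ ⟨hp, hs⟩
      obtain ⟨_, _, M', rfl, hM⟩ := Term.erase_eq_inr hp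
      obtain ⟨_, st, hM', hs'⟩ := ih (.mk hM hs)
      exact ⟨_, .inrC st, .mk (by simp_all only [Term.erase]) hs'⟩
  | unC _ ih =>
      rintro _ ⟨hp, hs⟩
      obtain ⟨M', rfl, hM⟩ := Term.erase_eq_un hp
      obtain ⟨_, st, hM', hs'⟩ := ih (.mk hM hs)
      exact ⟨_, .unC st, .mk (by simp_all only [Term.erase]) hs'⟩
  | binL _ ih =>
      rintro _ ⟨hp, hs⟩
      obtain ⟨M', N', rfl, hM, hN⟩ := Term.erase_eq_bin hp
      obtain ⟨_, st, hM', hs'⟩ := ih (.mk hM hs)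
      exact ⟨_, .binL st, .mk (by simp_all only [Term.erase]) hs'⟩
  | binR hv _ ih =>
      rintro _ ⟨hp, hs⟩
      obtain ⟨V', M', rfl, hV, hM⟩ := Term.erase_eq_bin hp
      obtain ⟨_, st, hM', hs'⟩ := ih (.mk hM hs)
      exact ⟨_, .binR (hv.of_erase_eq hV) st, .mk (by simp_all only [Term.erase]) hs'⟩
  | condC _ ih =>
      rintro _ ⟨hp, hs⟩
      obtain ⟨M', N', P', rfl, hM, hN, hP⟩ := Term.erase_eq_cond hp
      obtain ⟨_, st, hM', hs'⟩ := ih (.mk hM hs)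
      exact ⟨_, .condC st, .mk (by simp_all only [Term.erase]) hs'⟩
  | caseC _ ih =>
      rintro _ ⟨hp, hs⟩
      obtain ⟨M', _, N', _, P', rfl, hM, hN, hP⟩ := Term.erase_eq_caseOf hp
      obtain ⟨_, st, hM', hs'⟩ := ih (.mk hM hs)
      exact ⟨_, .caseC st, .mk (by simp_all only [Term.erase]) hs'⟩
  | derefC _ ih =>
      rintro _ ⟨hp, hs⟩
      obtain ⟨M', rfl, hM⟩ := Term.erase_eq_deref hp
      obtain ⟨_, st, hM', hs'⟩ := ih (.mk hM hs)
      exact ⟨_, .derefC st, .mk (by simp_all only [Term.erase]) hs'⟩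
  | assignL _ ih =>
      rintro _ ⟨hp, hs⟩
      obtain ⟨M', N', rfl, hM, hN⟩ := Term.erase_eq_assign hp
      obtain ⟨_, st, hM', hs'⟩ := ih (.mk hM hs)
      exact ⟨_, .assignL st, .mk (by simp_all only [Term.erase]) hs'⟩
  | assignR hv _ ih =>
      rintro _ ⟨hp, hs⟩
      obtain ⟨V', M', rfl, hV, hM⟩ := Term.erase_eq_assign hp
      obtain ⟨_, st, hM', hs'⟩ := ih (.mk hM hs)
      exact ⟨_, .assignR (hv.of_erase_eq hV) st, .mk (by simp_all only [Term.erase]) hs'⟩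
  | refC _ ih =>
      rintro _ ⟨hp, hs⟩
      obtain ⟨M', rfl, hM⟩ := Term.erase_eq_ref hp
      obtain ⟨_, st, hM', hs'⟩ := ih (.mk hM hs)
      exact ⟨_, .refC st, .mk (by simp_all only [Term.erase]) hs'⟩

theorem Config.SameErasure.converges {c d : Config} (h : c.SameErasure d) (hc : Converges c) :
    Converges d := by
  obtain ⟨c', r, hv⟩ := hc
  induction r using Relation.ReflTransGen.head_induction_on generalizing d with
  | refl =>
      obtain ⟨hp, hs⟩ := h
      exact ⟨_, .refl, hv.of_erase_eq hp⟩
  | head st _ ih =>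
      obtain ⟨d', st', h'⟩ := st.of_sameErasure h
      obtain ⟨c'', r, hv⟩ := ih h'
      exact ⟨c'', .head st' r, hv⟩

/-! ### Typed values -/

/-- Closed values together with the type that their syntax determines. -/
inductive ValueShape (S : ℕ → Option Ty) : Term → Ty → Prop
  | unit : ValueShape S .unit .unit
  | bool (b : Bool) : ValueShape S (.bool b) .bool
  | nat (n : ℕ) : ValueShape S (.nat n) .nat
  | loc {l : ℕ} {a : Ty} : S l = some a → ValueShape S (.loc l) (.ref a)
  | lam (a b : Ty) (M : Term) : ValueShape S (.lam a M) (.arrow a b)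
  | recfn (a b : Ty) (M : Term) : ValueShape S (.recfn a b M) (.arrow a b)
  | pair {a b : Ty} {V W : Term} :
      HasType S [] V a → HasType S [] W b → ValueShape S (.pair V W) (.prod a b)
  | inl {a b : Ty} {V : Term} : HasType S [] V a → ValueShape S (.inl a b V) (.sum a b)
  | inr {a b : Ty} {V : Term} : HasType S [] V b → ValueShape S (.inr a b V) (.sum a b)

namespace HasType

variable {S : ℕ → Option Ty} {V : Term} {a b t : Ty}

/-- Inversion of typing for closed values: the uses of `conv` at the root are merged into a single
equality of types, while the components keep their own typings. -/
theorem valueShape (h : HasType S [] V t) (hV : V.IsValue) :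
    ∃ t', ValueShape S V t' ∧ Ty.Eqv t' t := by
  generalize hG : ([] : List Ty) = G at h
  induction h with
  | var hn => subst hG; simp at hn
  | unit => exact ⟨_, .unit, .refl _⟩
  | bool b => exact ⟨_, .bool b, .refl _⟩
  | nat n => exact ⟨_, .nat n, .refl _⟩
  | loc hl => exact ⟨_, .loc hl, .refl _⟩
  | lam => exact ⟨_, .lam _ _ _, .refl _⟩
  | recfn => exact ⟨_, .recfn _ _ _, .refl _⟩
  | pair h h' => subst hG; exact ⟨_, .pair h h', .refl _⟩
  | inl _ _ h => subst hG; exact ⟨_, .inl h, .refl _⟩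
  | inr _ _ h => subst hG; exact ⟨_, .inr h, .refl _⟩
  | conv _ he _ ih =>
      obtain ⟨t', ht, e⟩ := ih hV hG
      exact ⟨t', ht, e.trans he⟩
  | _ => exact hV.elim

theorem valueShape_match (h : HasType S [] V t) (hV : V.IsValue) (ht : t.IsHead) :
    ∃ t', ValueShape S V t' ∧ Ty.Match Ty.Eqv t' t := by
  obtain ⟨t', hs, e⟩ := h.valueShape hV
  exact ⟨t', hs, e.match_of_isHead (by cases hs <;> trivial) ht⟩

theorem eq_unit (h : HasType S [] V .unit) (hV : V.IsValue) : V = .unit := by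
  obtain ⟨t', hs, m⟩ := h.valueShape_match hV trivial
  cases m
  cases hs
  rfl

theorem exists_bool (h : HasType S [] V .bool) (hV : V.IsValue) : ∃ b, V = .bool b := by
  obtain ⟨t', hs, m⟩ := h.valueShape_match hV trivial
  cases m
  cases hs
  exact ⟨_, rfl⟩

theorem exists_nat (h : HasType S [] V .nat) (hV : V.IsValue) : ∃ n, V = .nat n := by
  obtain ⟨t', hs, m⟩ := h.valueShape_match hV trivial
  cases m
  cases hs
  exact ⟨_, rfl⟩

theorem exists_loc (h : HasType S [] V (.ref a)) (hV : V.IsValue) :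
    ∃ l a', V = .loc l ∧ S l = some a' ∧ Ty.Eqv a' a := by
  obtain ⟨t', hs, m⟩ := h.valueShape_match hV trivial
  cases m with
  | ref e =>
      cases hs with
      | loc hl => exact ⟨_, _, rfl, hl, e⟩

theorem exists_pair (h : HasType S [] V (.prod a b)) (hV : V.IsValue) (ha : a.LC) (hb : b.LC) :
    ∃ V₁ V₂, V = .pair V₁ V₂ ∧ HasType S [] V₁ a ∧ HasType S [] V₂ b := by
  obtain ⟨t', hs, m⟩ := h.valueShape_match hV trivial
  cases m with
  | prod e e' =>
      cases hs with
      | pair h h' => exact ⟨_, _, rfl, h.conv e ha, h'.conv e' hb⟩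

theorem exists_inl_or_inr (h : HasType S [] V (.sum a b)) (hV : V.IsValue) (ha : a.LC)
    (hb : b.LC) :
    (∃ c d W, V = .inl c d W ∧ HasType S [] W a) ∨ ∃ c d W, V = .inr c d W ∧ HasType S [] W b := by
  obtain ⟨t', hs, m⟩ := h.valueShape_match hV trivial
  cases m with
  | sum e e' =>
      cases hs with
      | inl hW => exact .inl ⟨_, _, _, rfl, hW.conv e ha⟩
      | inr hW => exact .inr ⟨_, _, _, rfl, hW.conv e' hb⟩

theorem loc_inv {l : ℕ} (h : HasType S [] (.loc l) t) : ∃ a, S l = some a ∧ Ty.Eqv (.ref a) t := by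
  obtain ⟨t', hs, e⟩ := h.valueShape trivial
  cases hs with
  | loc hl => exact ⟨_, hl, e⟩

/-- The value determines its type: a location through `S`, an injection through its annotations, a
pair through its components. This identifies the unspecified type at which the semantics of an
equation compares two data. -/
theorem eqv_of_isFinite {V : Term} {a c : Ty} (ha : a.IsFinite) (hV : V.IsValue)
    (h : HasType S [] V a) (h' : HasType S [] V c) : Ty.Eqv c a := by
  induction a generalizing V c with
  | unit | bool | nat =>
      obtain ⟨t, hs, m⟩ := h.valueShape_match hV trivial
      obtain ⟨t', hs', e⟩ := h'.valueShape hV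
      cases m
      cases hs
      cases hs'
      exact e.symm
  | ref a =>
      obtain ⟨l, a', rfl, hl, e⟩ := h.exists_loc hV
      obtain ⟨a'', hl', e'⟩ := h'.loc_inv
      cases hl.symm.trans hl'
      exact e'.symm.trans (.of_match (.ref e))
  | prod a b iha ihb =>
      obtain ⟨V₁, V₂, rfl, h₁, h₂⟩ := h.exists_pair hV ha.1.closed.1 ha.2.closed.1
      obtain ⟨t', hs', e⟩ := h'.valueShape hV
      cases hs' with
      | pair g₁ g₂ =>
          exact e.symm.trans (.of_match (.prod (iha ha.1 hV.1 h₁ g₁) (ihb ha.2 hV.2 h₂ g₂)))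
  | sum a b =>
      obtain ⟨t, hs, e⟩ := h.valueShape hV
      obtain ⟨t', hs', e'⟩ := h'.valueShape hV
      cases hs with
      | inl => cases hs' with | inl => exact e'.symm.trans e
      | inr => cases hs' with | inr => exact e'.symm.trans e
      | _ => cases e.match_of_isHead trivial trivial
  | _ => exact ha.elim

end HasType

/-! ### Typed models -/

/-- `S` types the free and hidden locations of the model `M` of type `Γ`. -/
structure ModelTyping (S : ℕ → Option Ty) (Γ : Env) (M : Model) : Prop where
  vars_closed : ∀ a ∈ Γ.vars, a.Closed
  locs : ∀ l a, Γ.locs l = some a → S l = some a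
  hid : ∀ l, l ∈ M.hid ↔ S l ≠ none ∧ Γ.locs l = none
  locs_closed : ∀ l a, S l = some a → a.Closed
  dom : ∀ l, M.store l = none ↔ S l = none
  store : ∀ l a V, S l = some a → M.store l = some V → V.IsValue ∧ HasType S [] V a
  env : List.Forall₂ (fun V a => V.IsValue ∧ HasType S [] V a) M.env Γ.vars

theorem isModel_iff {Γ : Env} {M : Model} :
    IsModel Γ M ↔ {l | M.store l ≠ none}.Finite ∧ ∃ S, ModelTyping S Γ M :=
  ⟨fun ⟨h₁, h₂, S, h₃, h₄, h₅, h₆, h₇, h₈⟩ => ⟨h₂, S, h₁, h₃, h₄, h₅, h₆, h₇, h₈⟩,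
    fun ⟨h₂, S, h₁, h₃, h₄, h₅, h₆, h₇, h₈⟩ => ⟨h₁, h₂, S, h₃, h₄, h₅, h₆, h₇, h₈⟩⟩

namespace ModelTyping

variable {S : ℕ → Option Ty} {Γ : Env} {M : Model}

theorem isValue_store (h : ModelTyping S Γ M) {l : ℕ} {V : Term} (hl : M.store l = some V) :
    V.IsValue := by
  cases hS : S l with
  | none => rw [(h.dom l).2 hS] at hl; cases hl
  | some a => exact (h.store l a V hS hl).1

theorem exists_store (h : ModelTyping S Γ M) {l : ℕ} {a : Ty} (hl : S l = some a) :
    ∃ V, M.store l = some V ∧ V.IsValue ∧ HasType S [] V a := by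
  cases hs : M.store l with
  | none => rw [(h.dom l).1 hs] at hl; cases hl
  | some V => exact ⟨V, rfl, h.store l a V hl hs⟩

theorem isValue_env (h : ModelTyping S Γ M) {V : Term} (hV : V ∈ M.env) : V.IsValue := by
  have := h.env
  revert hV this
  generalize M.env = ξ
  generalize Γ.vars = G
  intro hV h
  induction h with
  | nil => cases hV
  | cons hd _ ih =>
      cases hV with
      | head => exact hd.1
      | tail _ hV => exact ih hV

theorem exists_env (h : ModelTyping S Γ M) {n : ℕ} {a : Ty} (hn : Γ.vars[n]? = some a) :
    ∃ V, M.env[n]? = some V ∧ V.IsValue ∧ HasType S [] V a := by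
  obtain ⟨hn', rfl⟩ := List.getElem?_eq_some_iff.1 hn
  have hl := h.env.length_eq
  have := List.forall₂_iff_get.1 h.env
  exact ⟨M.env[n]'(by omega), List.getElem?_eq_getElem _, this.2 n (by omega) hn'⟩

theorem push (h : ModelTyping S Γ M) {a : Ty} {V : Term} (ha : a.Closed) (hV : V.IsValue)
    (hVa : HasType S [] V a) : ModelTyping S (Γ.snoc a) (M.push V) where
  vars_closed b hb := by
    rcases List.mem_append.1 hb with hb | hb
    · exact h.vars_closed b hb
    · rwa [List.mem_singleton.1 hb]
  locs := h.locs
  hid := h.hid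
  locs_closed := h.locs_closed
  dom := h.dom
  store := h.store
  env := List.rel_append h.env (.cons ⟨hV, hVa⟩ .nil)

end ModelTyping

theorem ModelEquiv.refl {Γ : Env} {M : Model} (h : IsModel Γ M) : ModelEquiv Γ M M :=
  ⟨h, h, fun _ _ => .rfl⟩

theorem ModelEquiv.symm {Γ : Env} {M M' : Model} (h : ModelEquiv Γ M M') : ModelEquiv Γ M' M :=
  ⟨h.2.1, h.1, fun N hN => (h.2.2 N hN).symm⟩

/-! ### Readings -/

namespace Reading.Interprets

variable {ρ : Reading} {Γ : FEnv} {Δ : Env}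

theorem lc (h : ρ.Interprets Γ Δ) (X : ℕ) : (ρ.tys X).LC := (h.1 X).1

theorem snoc (h : ρ.Interprets Γ Δ) (a : Ty) : ρ.Interprets Γ (Δ.snoc a) := by
  refine ⟨h.1, fun x b hx => ?_, h.2.2⟩
  have hx := h.2.1 x b hx
  obtain ⟨hlt, -⟩ := List.getElem?_eq_some_iff.1 hx
  rw [← hx]
  exact List.getElem?_append_left hlt

/-- The equation `hb` allows the type `b` of the new variable to be given directly when the reading
leaves `a` unchanged, as it does for finite and for closed types. -/
theorem bind_of_eq (h : ρ.Interprets Γ Δ) (x : ℕ) {a b : Ty} (hb : a.inst ρ.tys = b) :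
    (ρ.bind x Δ.vars.length).Interprets (Γ.bind x a) (Δ.snoc b) := by
  subst hb
  refine ⟨h.1, fun y b hy => ?_, h.2.2⟩
  by_cases hxy : y = x
  · subst hxy
    obtain rfl : a = b := by simpa [FEnv.bind] using hy
    simp [Reading.bind, Env.snoc]
  · have hy' : Γ.vars y = some b := by simpa [FEnv.bind, hxy] using hy
    simpa [Reading.bind, hxy] using (h.snoc (a.inst ρ.tys)).2.1 y b hy'

theorem bind (h : ρ.Interprets Γ Δ) (x : ℕ) (a : Ty) :
    (ρ.bind x Δ.vars.length).Interprets (Γ.bind x a) (Δ.snoc (a.inst ρ.tys)) :=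
  h.bind_of_eq x rfl

theorem bindT (h : ρ.Interprets Γ Δ) {X : ℕ} (hX : Γ.FreshT X) {a : Ty} (ha : a.Closed) :
    (ρ.bindT X a).Interprets Γ Δ := by
  have key : ∀ b : Ty, ¬ Ty.HasTVar X b → b.inst (ρ.bindT X a).tys = b.inst ρ.tys := by
    intro b hb
    refine Ty.inst_congr b fun Y hY => ?_
    have : Y ≠ X := by rintro rfl; exact hb hY
    simp [Reading.bindT, this]
  refine ⟨fun Y => ?_, fun x b hx => ?_, fun l b hl => ?_⟩
  · by_cases hY : Y = X
    · subst hY; simpa [Reading.bindT] using ha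
    · simpa [Reading.bindT, hY] using h.1 Y
  · rw [key b (hX.1 x b hx)]
    exact h.2.1 x b hx
  · rw [key b (hX.2 l b hl)]
    exact h.2.2 l b hl

theorem updateLocs (h : ρ.Interprets Γ Δ) {l : ℕ} (hl : Δ.locs l = none) (a : Ty) :
    ρ.Interprets Γ ⟨Δ.vars, Function.update Δ.locs l (some a)⟩ := by
  refine ⟨h.1, h.2.1, fun m b hm => ?_⟩
  have hm := h.2.2 m b hm
  have : m ≠ l := by rintro rfl; rw [hl] at hm; cases hm
  simpa [this] using hm

theorem evolves (h : ρ.Interprets Γ Δ) {Δ' : Env} {M M' : Model} (e : Evolves Δ M Δ' M') :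
    ρ.Interprets Γ Δ' := by
  induction e with
  | refl => exact h
  | run _ _ ih => exact ih.snoc _

end Reading.Interprets

/-! ### Logical terms -/

namespace LTerm

theorem VarsBelow.mono {e : LTerm} {j k : ℕ} (h : e.VarsBelow j) (hjk : j ≤ k) :
    e.VarsBelow k := by
  induction e with
  | var x => exact lt_of_lt_of_le h hjk
  | bin _ _ _ ih ih' | pair _ _ ih ih' => exact ⟨ih h.1, ih' h.2⟩
  | un _ _ ih | inl _ _ _ ih | inr _ _ _ ih | deref _ ih => exact ih h
  | _ => trivial

theorem exists_varsBelow (e : LTerm) : ∃ k, e.VarsBelow k := by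
  induction e with
  | var x => exact ⟨x + 1, Nat.lt_succ_self x⟩
  | bin _ _ _ ih ih' | pair _ _ ih ih' =>
      obtain ⟨k, hk⟩ := ih
      obtain ⟨k', hk'⟩ := ih'
      exact ⟨max k k', hk.mono (le_max_left _ _), hk'.mono (le_max_right _ _)⟩
  | un _ _ ih | inl _ _ _ ih | inr _ _ _ ih | deref _ ih => exact ih
  | _ => exact ⟨0, trivial⟩

theorem HasType.of_agree {Γ Γ' : FEnv} {e : LTerm} {a : Ty} {k : ℕ} (h : e.HasType Γ a)
    (hk : e.VarsBelow k) (hv : ∀ x < k, Γ'.vars x = Γ.vars x) (hl : Γ'.locs = Γ.locs) :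
    e.HasType Γ' a := by
  induction h with
  | var hx => exact .var ((hv _ hk).trans hx)
  | unit => exact .unit
  | bool b => exact .bool b
  | nat n => exact .nat n
  | loc h => exact .loc (by rw [hl, h])
  | un ho _ ih => exact .un ho (ih hk)
  | bin ho _ _ ih ih' => exact .bin ho (ih hk.1) (ih' hk.2)
  | pair _ _ ih ih' => exact .pair (ih hk.1) (ih' hk.2)
  | inl ha hb _ ih => exact .inl ha hb (ih hk)
  | inr ha hb _ ih => exact .inr ha hb (ih hk)
  | deref _ ih => exact .deref (ih hk)
  | conv _ e hb ih => exact .conv (ih hk) e hb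

theorem HasType.bind {Γ : FEnv} {e : LTerm} {a : Ty} {k : ℕ} (h : e.HasType Γ a)
    (hk : e.VarsBelow k) (b : Ty) : e.HasType (Γ.bind k b) a :=
  h.of_agree hk (fun x hx => by simp [FEnv.bind, hx.ne]) rfl

theorem HasType.bind_var (Γ : FEnv) (k : ℕ) (a : Ty) : (LTerm.var k).HasType (Γ.bind k a) a :=
  .var (by simp [FEnv.bind])

theorem HasType.den_eq {Γ : FEnv} {e : LTerm} {a : Ty} {k : ℕ} {ρ ρ' : Reading} {ξ ξ' : List Term}
    (σ : Store) (h : e.HasType Γ a) (hk : e.VarsBelow k)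
    (hv : ∀ x b, Γ.vars x = some b → x < k → ξ'[ρ'.pos x]? = ξ[ρ.pos x]?)
    (ht : ρ'.tys = ρ.tys) : e.den ρ' ξ' σ = e.den ρ ξ σ := by
  induction h with
  | var hx => exact hv _ _ hx hk
  | unit | bool | nat | loc => rfl
  | un _ _ ih => simp only [den, ih hk]
  | bin _ _ _ ih ih' | pair _ _ ih ih' => simp only [den, ih hk.1, ih' hk.2]
  | inl _ _ _ ih | inr _ _ _ ih => simp only [den, ih hk, ht]
  | deref _ ih => simp only [den, ih hk]
  | conv _ _ _ ih => exact ih hk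

/-- Names below `k` keep their positions, and these lie in the old part of the environment, so the
new last entry is invisible. -/
theorem HasType.den_bind {Γ : FEnv} {Δ : Env} {e : LTerm} {a : Ty} {k : ℕ} {ρ : Reading}
    {ξ : List Term} (σ : Store) (h : e.HasType Γ a) (hk : e.VarsBelow k) (hρ : ρ.Interprets Γ Δ)
    (hξ : ξ.length = Δ.vars.length) (V : Term) :
    e.den (ρ.bind k Δ.vars.length) (ξ ++ [V]) σ = e.den ρ ξ σ := by
  refine h.den_eq σ hk (fun x b hx hlt => ?_) rfl
  obtain ⟨hp, -⟩ := List.getElem?_eq_some_iff.1 (hρ.2.1 x b hx)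
  rw [← hξ] at hp
  simp only [Reading.bind, Function.update_of_ne hlt.ne]
  exact List.getElem?_append_left hp

theorem HasType.den_append {Γ : FEnv} {Δ : Env} {e : LTerm} {a : Ty} {ρ : Reading}
    {ξ : List Term} (σ : Store) (h : e.HasType Γ a) (hρ : ρ.Interprets Γ Δ)
    (hξ : ξ.length = Δ.vars.length) (V : Term) : e.den ρ (ξ ++ [V]) σ = e.den ρ ξ σ := by
  obtain ⟨k, hk⟩ := e.exists_varsBelow
  refine h.den_eq σ hk (fun x b hx _ => ?_) rfl
  obtain ⟨hp, -⟩ := List.getElem?_eq_some_iff.1 (hρ.2.1 x b hx)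
  rw [← hξ] at hp
  exact List.getElem?_append_left hp

/-- Well-typed logical terms denote values of their types. -/
theorem HasType.den {Γ : FEnv} {Δ : Env} {S : ℕ → Option Ty} {M : Model} {ρ : Reading} {e : LTerm}
    {a : Ty} (h : e.HasType Γ a) (hρ : ρ.Interprets Γ Δ) (hM : ModelTyping S Δ M) :
    (a.inst ρ.tys).Closed ∧ ∃ V, e.den ρ M.env M.store = some V ∧ V.IsValue ∧
      LocalState.HasType S [] V (a.inst ρ.tys) := by
  induction h with
  | var hx =>
      obtain ⟨V, hV⟩ := hM.exists_env (hρ.2.1 _ _ hx)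
      exact ⟨hM.vars_closed _ (List.mem_of_getElem? (hρ.2.1 _ _ hx)), V, hV⟩
  | unit => exact ⟨⟨trivial, fun _ => id⟩, _, rfl, trivial, .unit⟩
  | bool b => exact ⟨⟨trivial, fun _ => id⟩, _, rfl, trivial, .bool b⟩
  | nat n => exact ⟨⟨trivial, fun _ => id⟩, _, rfl, trivial, .nat n⟩
  | loc hl =>
      have hl := hM.locs _ _ (hρ.2.2 _ _ hl)
      have hc := hM.locs_closed _ _ hl
      exact ⟨⟨hc.1, hc.2⟩, _, rfl, trivial, .loc hl⟩
  | un ho _ ih =>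
      cases ho
      obtain ⟨-, V, hd, hV, ht⟩ := ih
      obtain ⟨b, rfl⟩ := ht.exists_bool hV
      exact ⟨⟨trivial, fun _ => id⟩, .bool (!b), by simp [LTerm.den, hd, UnOp.eval],
        trivial, .bool _⟩
  | bin ho _ _ ih ih' =>
      obtain ⟨-, V, hd, hV, ht⟩ := ih
      obtain ⟨-, V', hd', hV', ht'⟩ := ih'
      refine ⟨by cases ho <;> exact ⟨trivial, fun _ => id⟩, ?_⟩
      simp only [LTerm.den, hd, hd', Option.bind_some]
      cases ho with
      | add | sub | mul =>
          obtain ⟨m, rfl⟩ := HasType.exists_nat ht hV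
          obtain ⟨n, rfl⟩ := HasType.exists_nat ht' hV'
          exact ⟨_, rfl, trivial, .nat _⟩
      | le | eqNat =>
          obtain ⟨m, rfl⟩ := HasType.exists_nat ht hV
          obtain ⟨n, rfl⟩ := HasType.exists_nat ht' hV'
          exact ⟨_, rfl, trivial, .bool _⟩
      | and | or | eqBool =>
          obtain ⟨m, rfl⟩ := HasType.exists_bool ht hV
          obtain ⟨n, rfl⟩ := HasType.exists_bool ht' hV'
          exact ⟨_, rfl, trivial, .bool _⟩
      | eqUnit =>
          obtain rfl := HasType.eq_unit ht hV
          obtain rfl := HasType.eq_unit ht' hV'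
          exact ⟨_, rfl, trivial, .bool _⟩
      | eqRef =>
          obtain ⟨l, _, rfl, -⟩ := HasType.exists_loc ht hV
          obtain ⟨l', _, rfl, -⟩ := HasType.exists_loc ht' hV'
          exact ⟨_, rfl, trivial, .bool _⟩
  | pair _ _ ih ih' =>
      obtain ⟨hc, V, hd, hV, ht⟩ := ih
      obtain ⟨hc', V', hd', hV', ht'⟩ := ih'
      exact ⟨⟨⟨hc.1, hc'.1⟩, fun X hX => hX.elim (hc.2 X) (hc'.2 X)⟩, .pair V V',
        by simp [LTerm.den, hd, hd'], ⟨hV, hV'⟩, .pair ht ht'⟩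
  | inl ha hb _ ih =>
      obtain ⟨-, V, hd, hV, ht⟩ := ih
      exact ⟨Ty.LC.closed_inst hρ.1 (a := .sum _ _) ⟨ha, hb⟩, .inl _ _ V,
        by simp only [LTerm.den, hd, Option.map_some], hV,
        .inl (ha.closed_inst hρ.1).1 (hb.closed_inst hρ.1).1 ht⟩
  | inr ha hb _ ih =>
      obtain ⟨-, V, hd, hV, ht⟩ := ih
      exact ⟨Ty.LC.closed_inst hρ.1 (a := .sum _ _) ⟨ha, hb⟩, .inr _ _ V,
        by simp only [LTerm.den, hd, Option.map_some], hV,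
        .inr (ha.closed_inst hρ.1).1 (hb.closed_inst hρ.1).1 ht⟩
  | deref _ ih =>
      obtain ⟨hc, V, hd, hV, ht⟩ := ih
      obtain ⟨l, a', rfl, hl, e⟩ := HasType.exists_loc ht hV
      obtain ⟨W, hW, hWv, hWt⟩ := hM.exists_store hl
      exact ⟨hc, W, by simp [LTerm.den, hd, hW], hWv, hWt.conv e hc.1⟩
  | conv _ e hb ih =>
      obtain ⟨-, V, hd, hV, ht⟩ := ih
      have hc := hb.closed_inst hρ.1
      exact ⟨hc, V, hd, hV, ht.conv (e.inst hρ.lc) hc.1⟩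

/-- A logical term as a program, with programs for its variables. -/
def progWith (v : ℕ → Term) (δ : ℕ → Ty) : LTerm → Term
  | var x => v x
  | unit => .unit
  | bool b => .bool b
  | nat n => .nat n
  | loc l => .loc l
  | un o e => .un o (progWith v δ e)
  | bin o e e' => .bin o (progWith v δ e) (progWith v δ e')
  | pair e e' => .pair (progWith v δ e) (progWith v δ e')
  | inl a b e => .inl (a.inst δ) (b.inst δ) (progWith v δ e)
  | inr a b e => .inr (a.inst δ) (b.inst δ) (progWith v δ e)
  | deref e => .deref (progWith v δ e)

theorem prog_eq_progWith (ρ : Reading) (e : LTerm) :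
    e.prog ρ = e.progWith (fun x => .var (ρ.pos x)) ρ.tys := by
  induction e <;> simp_all [prog, progWith]

theorem HasType.progWith {Γ : FEnv} {e : LTerm} {a : Ty} {v : ℕ → Term} {δ : ℕ → Ty}
    {S : ℕ → Option Ty} {G : List Ty} (h : e.HasType Γ a) (hδ : ∀ X, (δ X).Closed)
    (hv : ∀ x b, Γ.vars x = some b → LocalState.HasType S G (v x) (b.inst δ))
    (hl : ∀ l b, Γ.locs l = some b → S l = some (b.inst δ)) :
    LocalState.HasType S G (e.progWith v δ) (a.inst δ) := by
  induction h with
  | var hx => exact hv _ _ hx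
  | unit => exact .unit
  | bool b => exact .bool b
  | nat n => exact .nat n
  | loc h => exact .loc (hl _ _ h)
  | un ho _ ih => exact .un (by cases ho; constructor) ih
  | bin ho _ _ ih ih' => exact .bin (by cases ho <;> constructor) ih ih'
  | pair _ _ ih ih' => exact .pair ih ih'
  | inl ha hb _ ih => exact .inl (ha.closed_inst hδ).1 (hb.closed_inst hδ).1 ih
  | inr ha hb _ ih => exact .inr (ha.closed_inst hδ).1 (hb.closed_inst hδ).1 ih
  | deref _ ih => exact .deref ih
  | conv _ e hb ih => exact ih.conv (e.inst fun X => (hδ X).1) (hb.closed_inst hδ).1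

/-- Evaluation of a logical term only reads the store, hence ends in its denotation by pure steps.
The variables are left abstract because they become entries of an environment in `prog` and
projections from a tuple in `ctxProg`. -/
theorem pureSteps_progWith {ρ : Reading} {ξ : List Term} {h : Finset ℕ} {σ : Store}
    {v s : ℕ → Term}
    (hv : ∀ x V, ξ[ρ.pos x]? = some V → V.IsValue ∧ PureSteps h σ ((v x).subst s) V)
    (hσ : ∀ l V, σ l = some V → V.IsValue) (e : LTerm) :
    ∀ {V : Term}, e.den ρ ξ σ = some V →
      V.IsValue ∧ PureSteps h σ ((e.progWith v ρ.tys).subst s) V := by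
  induction e with
  | var x => exact fun hV => hv x _ hV
  | unit | bool | nat | loc =>
      intro V hV
      cases hV
      exact ⟨trivial, .refl _⟩
  | un o e ih =>
      intro V hV
      obtain ⟨W, hW, ho⟩ := Option.bind_eq_some_iff.1 hV
      exact ⟨(UnOp.isValue_of_eval ho).2,
        ((ih hW).2.map (.un o) fun _ _ => .unC).tail (.un ho)⟩
  | bin o e e' ih ih' =>
      intro V hV
      obtain ⟨W, hW, hV⟩ := Option.bind_eq_some_iff.1 hV
      obtain ⟨W', hW', ho⟩ := Option.bind_eq_some_iff.1 hV
      exact ⟨(BinOp.isValue_of_eval ho).2.2,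
        ((ih hW).2.bin (ih hW).1 (ih' hW').2).tail (.bin ho)⟩
  | pair e e' ih ih' =>
      intro V hV
      obtain ⟨W, hW, hV⟩ := Option.bind_eq_some_iff.1 hV
      obtain ⟨W', hW', rfl⟩ := Option.map_eq_some_iff.1 hV
      exact ⟨⟨(ih hW).1, (ih' hW').1⟩, (ih hW).2.pair (ih hW).1 (ih' hW').2⟩
  | inl a b e ih =>
      intro V hV
      obtain ⟨W, hW, rfl⟩ := Option.map_eq_some_iff.1 hV
      exact ⟨(ih hW).1, (ih hW).2.map (.inl _ _) fun _ _ => .inlC⟩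
  | inr a b e ih =>
      intro V hV
      obtain ⟨W, hW, rfl⟩ := Option.map_eq_some_iff.1 hV
      exact ⟨(ih hW).1, (ih hW).2.map (.inr _ _) fun _ _ => .inrC⟩
  | deref e ih =>
      intro V hV
      obtain ⟨W, hW, hV⟩ := Option.bind_eq_some_iff.1 hV
      split at hV
      · exact ⟨hσ _ _ hV, (ih hW).2.deref hV⟩
      · cases hV

theorem HasType.prog {Γ : FEnv} {Δ : Env} {ρ : Reading} {e : LTerm} {a : Ty} (h : e.HasType Γ a)
    (hρ : ρ.Interprets Γ Δ) :
    LocalState.HasType Δ.locs Δ.vars (e.prog ρ) (a.inst ρ.tys) := by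
  rw [prog_eq_progWith]
  exact h.progWith hρ.1 (fun x b hx => .var (hρ.2.1 x b hx)) hρ.2.2

theorem pureSteps_prog {S : ℕ → Option Ty} {Δ : Env} {M : Model} {ρ : Reading} {e : LTerm}
    {V : Term} (h : Finset ℕ) (hM : ModelTyping S Δ M) (hV : e.den ρ M.env M.store = some V) :
    PureSteps h M.store ((e.prog ρ).subst (Term.envSubst M.env)) V := by
  rw [prog_eq_progWith]
  refine (pureSteps_progWith (fun x V hx => ?_) (fun l V => hM.isValue_store) e hV).2
  refine ⟨hM.isValue_env (List.mem_of_getElem? hx), ?_⟩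
  simp only [Term.subst, Term.envSubst, List.getD_eq_getElem?_getD, hx]
  exact .refl _

end LTerm

/-! ### A program that decides reachability from data of finite types -/

theorem Ncl.mono {σ : Store} {A B : Set ℕ} (h : A ⊆ B) {l : ℕ} (hl : Ncl σ A l) : Ncl σ B l := by
  induction hl with
  | base hl => exact .base (h hl)
  | step _ hs hf ih => exact .step ih hs hf

theorem not_ncl_empty {σ : Store} {l : ℕ} : ¬ Ncl σ ∅ l := by
  intro h
  induction h with
  | base h => exact h
  | step _ _ _ ih => exact ih

theorem ncl_union {σ : Store} {A B : Set ℕ} {l : ℕ} :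
    Ncl σ (A ∪ B) l ↔ Ncl σ A l ∨ Ncl σ B l := by
  constructor
  · intro h
    induction h with
    | base h => exact h.imp .base .base
    | step _ hs hf ih => exact ih.imp (.step · hs hf) (.step · hs hf)
  · rintro (h | h)
    · exact h.mono Set.subset_union_left
    · exact h.mono Set.subset_union_right

/-- A path that returns to `m` causes no trouble: the location after `m` occurs in `W`, so the path
can be restarted there. -/
theorem ncl_singleton {σ : Store} {m l : ℕ} {W : Term} (hm : σ m = some W) :
    Ncl σ {m} l ↔ m = l ∨ Ncl σ W.fl l := by
  constructor
  · intro h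
    induction h with
    | base h => exact .inl h.symm
    | step _ hs hf ih =>
        obtain rfl | ih := ih
        · cases hm.symm.trans hs
          exact .inr (.base hf)
        · exact .inr (.step ih hs hf)
  · rintro (rfl | h)
    · exact .base rfl
    · induction h with
      | base h => exact .step (.base rfl) hm h
      | step _ hs hf ih => exact .step ih hs hf

open Classical in
/-- The program, of type `Bool`, that decides whether the reference `t'` with contents of type `b`
is reachable from the datum `t` of finite type. -/
noncomputable def reachProg (b : Ty) : Ty → Term → Term → Term
  | .prod a₁ a₂, t, t' =>
      .bin .or (reachProg b a₁ (.fst t) t') (reachProg b a₂ (.snd t) t')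
  | .sum a₁ a₂, t, t' =>
      .caseOf t a₁ (reachProg b a₁ (.var 0) (t'.rename Nat.succ))
        a₂ (reachProg b a₂ (.var 0) (t'.rename Nat.succ))
  | .ref a, t, t' =>
      -- An equality test between references of different types would be ill typed. It can be
      -- omitted, since such references are never the same location.
      .bin .or (if Ty.Eqv a b then .bin .eq t t' else .bool false) (reachProg b a (.deref t) t')
  | _, _, _ => .bool false

theorem reachProg_hasType {S : ℕ → Option Ty} {a b : Ty} (ha : a.IsFinite) (hb : b.LC)
    {G : List Ty} {t : Term} {i : ℕ} (ht : HasType S G t a) (hi : G[i]? = some (.ref b)) :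
    HasType S G (reachProg b a t (.var i)) .bool := by
  induction a generalizing G t i with
  | unit | bool | nat => exact .bool _
  | prod a₁ a₂ ih₁ ih₂ => exact .bin .or (ih₁ ha.1 (.fst ht) hi) (ih₂ ha.2 (.snd ht) hi)
  | sum a₁ a₂ ih₁ ih₂ =>
      exact .caseOf ha.1.closed.1 ha.2.closed.1 ht (ih₁ (i := i + 1) ha.1 (.var rfl) hi)
        (ih₂ (i := i + 1) ha.2 (.var rfl) hi)
  | ref a ih =>
      refine .bin .or ?_ (ih ha (.deref ht) hi)
      split_ifs with h
      · exact .bin (.eqRef b) (ht.conv (.of_match (.ref h)) hb) (.var hi)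
      · exact .bool _
  | _ => exact ha.elim

/-- The target is restricted to variables and locations, for which weakening and substitution under
a binder commute by computation. More is not needed, because `reachContext` binds the target to a
variable before the test. -/
theorem subst_reachProg (b a : Ty) (s : ℕ → Term) (t : Term) {t' : Term}
    (ht' : (∃ i, t' = .var i) ∨ ∃ l, t' = .loc l) :
    (reachProg b a t t').subst s = reachProg b a (t.subst s) (t'.subst s) := by
  induction a generalizing s t t' with
  | prod a₁ a₂ ih₁ ih₂ => simp only [reachProg, Term.subst, ih₁ s _ ht', ih₂ s _ ht']
  | sum a₁ a₂ ih₁ ih₂ =>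
      have lift : (t'.rename Nat.succ).subst (Term.liftS s) = (t'.subst s).rename Nat.succ := by
        rcases ht' with ⟨i, rfl⟩ | ⟨l, rfl⟩ <;> rfl
      have atom : (∃ i, t'.rename Nat.succ = .var i) ∨ ∃ l, t'.rename Nat.succ = .loc l := by
        rcases ht' with ⟨i, rfl⟩ | ⟨l, rfl⟩
        · exact .inl ⟨i + 1, rfl⟩
        · exact .inr ⟨l, rfl⟩
      simp only [reachProg, Term.subst, ih₁ _ _ atom, ih₂ _ _ atom, lift, Term.liftS]
  | ref a ih =>
      simp only [reachProg, Term.subst, ih s _ ht']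
      split_ifs <;> rfl
  | _ => rfl

open Classical in
-- Induction on the type, with one closure law of `Ncl` for each constructor. The depth of the
-- search is bounded by the type alone; finiteness of the store plays no role.
theorem pureSteps_reachProg {S : ℕ → Option Ty} {Δ : Env} {M : Model} (hM : ModelTyping S Δ M)
    {h : Finset ℕ} {a b b' : Ty} (ha : a.IsFinite) {t V : Term} {l : ℕ} (hl : S l = some b')
    (hb : Ty.Eqv b' b) (hV : V.IsValue) (hVa : HasType S [] V a) (ht : PureSteps h M.store t V) :
    PureSteps h M.store (reachProg b a t (.loc l)) (.bool (decide (Ncl M.store V.fl l))) := by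
  have or_eval : ∀ {P Q : Term} {p q r : Prop}, (r ↔ p ∨ q) →
      PureSteps h M.store P (.bool (decide p)) → PureSteps h M.store Q (.bool (decide q)) →
      PureSteps h M.store (.bin .or P Q) (.bool (decide r)) := by
    intro P Q p q r hr hp hq
    refine (hp.bin trivial hq).tail (.bin ?_)
    simp only [BinOp.eval, hr, Bool.decide_or]
  have base : ∀ {W : Term}, W.fl = ∅ →
      PureSteps h M.store (.bool false) (.bool (decide (Ncl M.store W.fl l))) := by
    intro W hW
    rw [hW, decide_eq_false not_ncl_empty]
    exact .refl _
  induction a generalizing t V with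
  | unit =>
      obtain rfl := hVa.eq_unit hV
      exact base rfl
  | bool =>
      obtain ⟨_, rfl⟩ := hVa.exists_bool hV
      exact base rfl
  | nat =>
      obtain ⟨_, rfl⟩ := hVa.exists_nat hV
      exact base rfl
  | prod a₁ a₂ ih₁ ih₂ =>
      obtain ⟨V₁, V₂, rfl, h₁, h₂⟩ := hVa.exists_pair hV ha.1.closed.1 ha.2.closed.1
      exact or_eval ncl_union (ih₁ ha.1 hV.1 h₁ (ht.fst hV.1 hV.2))
        (ih₂ ha.2 hV.2 h₂ (ht.snd hV.1 hV.2))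
  | sum a₁ a₂ ih₁ ih₂ =>
      obtain ⟨c, d, W, rfl, hW⟩ | ⟨c, d, W, rfl, hW⟩ :=
        hVa.exists_inl_or_inr hV ha.1.closed.1 ha.2.closed.1
      · refine (ht.caseL hV).trans ?_
        rw [Term.subst1, Term.rename, subst_reachProg _ _ _ _ (.inr ⟨l, rfl⟩)]
        exact ih₁ (V := W) ha.1 hV hW (.refl W)
      · refine (ht.caseR hV).trans ?_
        rw [Term.subst1, Term.rename, subst_reachProg _ _ _ _ (.inr ⟨l, rfl⟩)]
        exact ih₂ (V := W) ha.2 hV hW (.refl W)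
  | ref a ih =>
      obtain ⟨m, a', rfl, hm, e⟩ := hVa.exists_loc hV
      obtain ⟨W, hW, hWv, hWt⟩ := hM.exists_store hm
      refine or_eval (ncl_singleton hW) ?_ (ih ha hWv (hWt.conv e ha.closed.1) (ht.deref hW))
      split_ifs with hab
      · exact (ht.bin trivial (.refl _)).tail (.bin (by simp [BinOp.eval]))
      -- The test was replaced by `false`. This is correct, since `m = l` would make the content
      -- types `a` and `b` equal through the one type that `S` gives to `l`.
      · have : m ≠ l := by
          rintro rfl
          cases hm.symm.trans hl
          exact hab (e.symm.trans hb)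
        simp only [this, decide_false]
        exact .refl _
  | _ => exact ha.elim

/-- A program of type `Unit` that converges if the reference `t'` is reachable from `t`, and
diverges otherwise. -/
noncomputable def reachContext (a b : Ty) (t t' : Term) : Term :=
  .app (.app (.lam (.ref b) (.lam a
    (.cond (reachProg b a (.var 0) (.var 1)) .unit (omega .unit)))) t') t

theorem omega_hasType {S : ℕ → Option Ty} {G : List Ty} {a : Ty} (ha : a.LC) :
    HasType S G (omega a) a :=
  .app (.recfn trivial ha (.app (.var rfl) (.var rfl))) .unit

theorem reachContext_hasType {S : ℕ → Option Ty} {G : List Ty} {a b : Ty} {t t' : Term}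
    (ha : a.IsFinite) (hb : b.LC) (ht : HasType S G t a) (ht' : HasType S G t' (.ref b)) :
    HasType S G (reachContext a b t t') .unit :=
  .app (.app (.lam hb (.lam ha.closed.1 (.cond (reachProg_hasType ha hb (.var rfl) rfl) .unit
    (omega_hasType trivial)))) ht') ht

/-- The target and the datum are evaluated before the search starts, so `reachProg` copies only
values. -/
theorem converges_reachContext_iff {S : ℕ → Option Ty} {Δ : Env} {M : Model}
    (hM : ModelTyping S Δ M) {h : Finset ℕ} {a b : Ty} (ha : a.IsFinite) {t t' V : Term} {l : ℕ}
    (hl : HasType S [] (.loc l) (.ref b)) (hV : V.IsValue) (hVa : HasType S [] V a)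
    {s : ℕ → Term} (ht : PureSteps h M.store (t.subst s) V)
    (ht' : PureSteps h M.store (t'.subst s) (.loc l)) :
    Converges ⟨h, (reachContext a b t t').subst s, M.store⟩ ↔ Ncl M.store V.fl l := by
  classical
  obtain ⟨_, b', h₀, hb', e⟩ := hl.exists_loc trivial
  cases h₀
  let body (P : Term) : Term := .cond P .unit (omega .unit)
  -- `h₁`, `h₂` and `h₃` carry the substitution `s`, then the location, then the datum through to
  -- the test.
  have h₁ : (reachContext a b t t').subst s = .app (.app (.lam (.ref b) (.lam a
      (body (reachProg b a (.var 0) (.var 1))))) (t'.subst s)) (t.subst s) := by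
    simp only [reachContext, Term.subst, subst_omega, body,
      subst_reachProg _ _ _ _ (.inl ⟨_, rfl⟩)]
    rfl
  have h₂ : Term.subst1 (.loc l) (.lam a (body (reachProg b a (.var 0) (.var 1)))) =
      .lam a (body (reachProg b a (.var 0) (.loc l))) := by
    simp only [Term.subst1, Term.subst, subst_omega, body,
      subst_reachProg _ _ _ _ (.inl ⟨_, rfl⟩)]
    rfl
  have h₃ : Term.subst1 V (body (reachProg b a (.var 0) (.loc l))) =
      body (reachProg b a V (.loc l)) := by
    simp only [Term.subst1, Term.subst, subst_omega, body,
      subst_reachProg _ _ _ _ (.inr ⟨_, rfl⟩)]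
    rfl
  have steps : PureSteps h M.store ((reachContext a b t t').subst s)
      (if decide (Ncl M.store V.fl l) then .unit else omega .unit) := by
    rw [h₁]
    refine (((ht'.beta trivial).map (.app · (t.subst s)) fun _ _ => .appL).trans ?_)
    rw [h₂]
    refine (ht.beta hV).trans ?_
    rw [h₃]
    exact (pureSteps_reachProg hM ha hb' e hV hVa (.refl V)).cond
  rw [steps.converges_iff]
  by_cases hn : Ncl M.store V.fl l
  · simp only [hn, decide_true, if_true, iff_true]
    exact ⟨_, .refl, trivial⟩
  · simp only [hn, decide_false, Bool.false_eq_true, if_false, iff_false]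
    rintro ⟨c, hc⟩
    exact omega_not_evalsTo hc

/-! ### Components of the tuple that fills a context -/

/-- A context receives the environment of a model as one iterated pair, and gets at the `n`-th datum
by projections. -/
def proj : ℕ → Term → Term
  | 0, t => .fst t
  | n + 1, t => proj n (.snd t)

theorem subst_proj (s : ℕ → Term) (n : ℕ) : ∀ t, (proj n t).subst s = proj n (t.subst s) := by
  induction n with
  | zero => exact fun _ => rfl
  | succ n ih => exact fun t => ih (.snd t)

theorem proj_hasType {S : ℕ → Option Ty} {G : List Ty} {a : Ty} (as : List Ty) {n : ℕ} {t : Term}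
    (ht : HasType S G t (tupleTy as)) (hn : as[n]? = some a) : HasType S G (proj n t) a := by
  induction as generalizing n t with
  | nil => simp at hn
  | cons b bs ih =>
      cases n with
      | zero => cases hn; exact .fst ht
      | succ n => exact ih (t := .snd t) (.snd ht) hn

theorem isValue_tuple {ξ : List Term} (h : ∀ V ∈ ξ, V.IsValue) : (tuple ξ).IsValue := by
  induction ξ with
  | nil => trivial
  | cons V ξ ih => exact ⟨h V (.head _), ih fun W hW => h W (.tail _ hW)⟩

theorem pureSteps_proj {h : Finset ℕ} {σ : Store} {ξ : List Term} (hξ : ∀ V ∈ ξ, V.IsValue)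
    {n : ℕ} {t V : Term} (ht : PureSteps h σ t (tuple ξ)) (hn : ξ[n]? = some V) :
    PureSteps h σ (proj n t) V := by
  induction ξ generalizing n t with
  | nil => simp at hn
  | cons W ξ ih =>
      have hW := hξ W (.head _)
      have hξ' : ∀ V ∈ ξ, V.IsValue := fun W hW => hξ W (.tail _ hW)
      cases n with
      | zero => cases hn; exact ht.fst hW (isValue_tuple hξ')
      | succ n => exact ih (t := .snd t) hξ' (ht.snd hW (isValue_tuple hξ')) hn

namespace LTerm

/-- A logical term as a program over the tuple of the data of a model. -/
def ctxProg (ρ : Reading) (e : LTerm) : Term := e.progWith (fun x => proj (ρ.pos x) (.var 0)) ρ.tys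

theorem HasType.ctxProg {Γ : FEnv} {Δ : Env} {ρ : Reading} {e : LTerm} {a : Ty}
    (h : e.HasType Γ a) (hρ : ρ.Interprets Γ Δ) :
    LocalState.HasType Δ.locs [tupleTy Δ.vars] (e.ctxProg ρ) (a.inst ρ.tys) :=
  h.progWith hρ.1 (fun x b hx => proj_hasType _ (.var rfl) (hρ.2.1 x b hx)) hρ.2.2

theorem pureSteps_ctxProg {S : ℕ → Option Ty} {Δ : Env} {M : Model} {ρ : Reading} {e : LTerm}
    {V : Term} (h : Finset ℕ) (hM : ModelTyping S Δ M) (hV : e.den ρ M.env M.store = some V) :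
    PureSteps h M.store ((e.ctxProg ρ).subst (Term.single (tuple M.env))) V := by
  refine (pureSteps_progWith (fun x V hx => ?_) (fun l V => hM.isValue_store) e hV).2
  refine ⟨hM.isValue_env (List.mem_of_getElem? hx), ?_⟩
  rw [subst_proj]
  exact pureSteps_proj (fun V => hM.isValue_env) (.refl _) hx

end LTerm

/-! ### Reachability in a single model -/

/-- The location denoted by `e'` is reachable in the store of `M` from the value of `e`. -/
def Reaches (ρ : Reading) (M : Model) (e e' : LTerm) : Prop :=
  ∃ V l, e.den ρ M.env M.store = some V ∧ e'.den ρ M.env M.store = some (.loc l) ∧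
    Ncl M.store V.fl l

/-- The context on the right is built from the types, terms and reading only. The same context
therefore works in every model of type `Δ`, which is what makes reachability observable. -/
theorem reaches_iff_converges {Γ : FEnv} {Δ : Env} {ρ : Reading} {M : Model} {e e' : LTerm}
    {a b : Ty} (ha : a.IsFinite) (he : e.HasType Γ a) (he' : e'.HasType Γ (.ref b))
    (hρ : ρ.Interprets Γ Δ) (hM : IsModel Δ M) :
    Reaches ρ M e e' ↔ Converges ⟨M.hid, Term.subst1 (tuple M.env)
      (reachContext a (b.inst ρ.tys) (e.ctxProg ρ) (e'.ctxProg ρ)), M.store⟩ := by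
  obtain ⟨-, S, hS⟩ := isModel_iff.1 hM
  obtain ⟨-, V, hd, hV, ht⟩ := he.den hρ hS
  obtain ⟨-, W, hd', hW, ht'⟩ := he'.den hρ hS
  rw [ha.inst_eq] at ht
  obtain ⟨l, _, rfl, -⟩ := ht'.exists_loc hW
  rw [Term.subst1, converges_reachContext_iff hS ha ht' hV ht
    (LTerm.pureSteps_ctxProg _ hS hd) (LTerm.pureSteps_ctxProg _ hS hd')]
  refine ⟨?_, fun h => ⟨V, l, hd, hd', h⟩⟩
  rintro ⟨V', l', h, h', hn⟩
  cases hd.symm.trans h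
  cases hd'.symm.trans h'
  exact hn

/-- Reachability from data of finite types is invariant under contextual congruence. -/
theorem Reaches.of_modelEquiv {Γ : FEnv} {Δ : Env} {ρ : Reading} {M M' : Model} {e e' : LTerm}
    {a b : Ty} (ha : a.IsFinite) (he : e.HasType Γ a) (he' : e'.HasType Γ (.ref b))
    (hρ : ρ.Interprets Γ Δ) (hM : ModelEquiv Δ M M') (h : Reaches ρ M e e') :
    Reaches ρ M' e e' := by
  obtain ⟨-, S, hS⟩ := isModel_iff.1 hM.1
  have hb : (b.inst ρ.tys).LC := (he'.den hρ hS).1.1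
  have ht := he.ctxProg hρ
  rw [ha.inst_eq] at ht
  rw [reaches_iff_converges ha he he' hρ hM.2.1]
  rw [reaches_iff_converges ha he he' hρ hM.1] at h
  exact (hM.2.2 _ (reachContext_hasType ha hb ht (he'.ctxProg hρ))).1 h

theorem sat_reach_iff {Γ : FEnv} {Δ : Env} {ρ : Reading} {M : Model} {e e' : LTerm}
    {a b : Ty} (ha : a.IsFinite) (he : e.HasType Γ a) (he' : e'.HasType Γ (.ref b))
    (hρ : ρ.Interprets Γ Δ) (hM : IsModel Δ M) :
    (Formula.reach e e').Sat Δ M ρ ↔ Reaches ρ M e e' :=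
  ⟨fun h => h M (.refl hM), fun h _ hM' => h.of_modelEquiv ha he he' hρ hM'.symm⟩

theorem ModelTyping.length_env {S : ℕ → Option Ty} {Γ : Env} {M : Model} (h : ModelTyping S Γ M) :
    M.env.length = Γ.vars.length := h.env.length_eq

theorem IsModel.length_env {Γ : Env} {M : Model} (h : IsModel Γ M) :
    M.env.length = Γ.vars.length := by
  obtain ⟨-, S, hS⟩ := isModel_iff.1 h
  exact hS.length_env

/-! ### Equations -/

/-- Filling a context with either value gives programs with the same erasure, which converge
together. -/
theorem ModelEquiv.push_of_erase_eq {S : ℕ → Option Ty} {Δ : Env} {M : Model} (hM : IsModel Δ M)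
    (hS : ModelTyping S Δ M) {a : Ty} {V V' : Term} (ha : a.Closed) (hV : V.IsValue)
    (hVa : HasType S [] V a) (hV' : V'.IsValue) (hVa' : HasType S [] V' a)
    (he : V.erase = V'.erase) : ModelEquiv (Δ.snoc a) (M.push V) (M.push V') := by
  have hfin := (isModel_iff.1 hM).1
  have tup : ∀ ξ : List Term, (tuple (ξ ++ [V])).erase = (tuple (ξ ++ [V'])).erase := by
    intro ξ
    induction ξ with
    | nil => simp only [List.nil_append, tuple, Term.erase, he]
    | cons W ξ ih => simp only [List.cons_append, tuple, Term.erase, ih]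
  refine ⟨isModel_iff.2 ⟨hfin, S, hS.push ha hV hVa⟩, isModel_iff.2 ⟨hfin, S, hS.push ha hV' hVa'⟩,
    fun N _ => ⟨fun h => ?_, fun h => ?_⟩⟩
  · refine Config.SameErasure.converges (.mk ?_ fun _ => rfl) h
    rw [Term.erase_subst1, Term.erase_subst1, Model.push, Model.push, tup]
  · refine Config.SameErasure.converges (.mk ?_ fun _ => rfl) h
    rw [Term.erase_subst1, Term.erase_subst1, Model.push, Model.push, tup]

theorem sat_eq_of_erase_eq {Γ : FEnv} {Δ : Env} {ρ : Reading} {M : Model} {e e' : LTerm} {a : Ty}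
    {V V' : Term} (he : e.HasType Γ a) (he' : e'.HasType Γ a) (hρ : ρ.Interprets Γ Δ)
    (hM : IsModel Δ M) (hV : e.den ρ M.env M.store = some V)
    (hV' : e'.den ρ M.env M.store = some V') (h : V.erase = V'.erase) :
    (Formula.eq e e').Sat Δ M ρ := by
  obtain ⟨-, S, hS⟩ := isModel_iff.1 hM
  obtain ⟨hc, W, hd, hW, ht⟩ := he.den hρ hS
  obtain ⟨-, W', hd', hW', ht'⟩ := he'.den hρ hS
  cases hV.symm.trans hd
  cases hV'.symm.trans hd'
  exact ⟨_, V, V', hd, hd', .push_of_erase_eq hM hS hc hW ht hW' ht' h⟩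

/-- Equations between references hold only if both sides denote the same location. -/
theorem exists_loc_of_sat_eq {Γ : FEnv} {Δ : Env} {ρ : Reading} {M : Model} {e e' : LTerm} {b : Ty}
    (he' : e'.HasType Γ (.ref b)) (hρ : ρ.Interprets Γ Δ) (h : (Formula.eq e e').Sat Δ M ρ) :
    ∃ l, e.den ρ M.env M.store = some (.loc l) ∧ e'.den ρ M.env M.store = some (.loc l) := by
  obtain ⟨c, V, V', hV, hV', hm, hm', hN⟩ := h
  obtain ⟨-, S, hS⟩ := isModel_iff.1 hm
  obtain ⟨-, S', hS'⟩ := isModel_iff.1 hm'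
  have hlen : M.env.length = Δ.vars.length := by
    simpa [Model.push, Env.snoc] using hm.length_env
  have hd : ∀ W, e'.den ρ (M.push W).env (M.push W).store = some V' := fun W =>
    (he'.den_append M.store hρ hlen W).trans hV'
  have hu : ∀ W, (M.push W).env[Δ.vars.length]? = some W := by
    intro W
    simp [Model.push, ← hlen]
  have hc : c.Closed := hS.vars_closed c (by simp [Env.snoc])
  obtain ⟨hb, W, hW, hWv, hWt⟩ := he'.den (hρ.snoc c) hS'
  cases (hd V').symm.trans hW
  obtain ⟨l, b', rfl, hl, hb'⟩ := hWt.exists_loc hWv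
  -- The type `c` at which the equation is tested is arbitrary in the semantics. Since `V'` is a
  -- location, `c` has to be equal to the reference type of `e'`, and only then is the comparison
  -- below well typed.
  have hcv : (Δ.snoc c).vars[Δ.vars.length]? = some c := by simp [Env.snoc]
  obtain ⟨W, hW, -, hWc⟩ := hS'.exists_env hcv
  cases (hu _).symm.trans hW
  obtain ⟨b'', hl', hb''⟩ := hWc.loc_inv
  cases hl.symm.trans hl'
  have hcb : Ty.Eqv c (.ref (b.inst ρ.tys)) := hb''.symm.trans (.of_match (.ref hb'))
  -- The context compares the last datum with `e'`. In both models `e'` denotes the location `l`,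
  -- which is also the last datum of the second model. Convergence there forces the last datum of
  -- the first model to be `l`.
  let N : Term := .cond (.bin .eq (proj Δ.vars.length (.var 0)) (e'.ctxProg ρ)) .unit (omega .unit)
  have hNt : HasType (Δ.snoc c).locs [tupleTy (Δ.snoc c).vars] N .unit :=
    .cond (.bin (.eqRef _) ((proj_hasType _ (.var rfl) hcv).conv hcb hb.1)
      (he'.ctxProg (hρ.snoc c))) .unit (omega_hasType trivial)
  have run : ∀ {T : ℕ → Option Ty} {m : ℕ}, ModelTyping T (Δ.snoc c) (M.push (.loc m)) →
      PureSteps M.hid M.store (Term.subst1 (tuple (M.push (.loc m)).env) N)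
        (if decide (m = l) then .unit else omega .unit) := by
    intro T m hT
    simp only [N, Term.subst1, Term.subst, subst_proj, subst_omega]
    refine PureSteps.cond (((pureSteps_proj (fun V => hT.isValue_env) (.refl _) (hu _)).bin trivial
      (LTerm.pureSteps_ctxProg _ hT (hd _))).tail (.bin ?_))
    simp [BinOp.eval]
  obtain ⟨W, hW, hWv, hWc⟩ := hS.exists_env hcv
  cases (hu _).symm.trans hW
  obtain ⟨m, _, rfl, -⟩ := (hWc.conv hcb hb.1).exists_loc hWv
  have hconv := (hN N hNt).2 ((run hS').converges_iff.2 (by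
    simp only [decide_true, if_true]
    exact ⟨_, .refl, trivial⟩))
  have hml : m = l := by
    by_contra hml
    obtain ⟨c, hc⟩ := (run hS).converges_iff.1 hconv
    simp only [hml, decide_false, Bool.false_eq_true, if_false] at hc
    exact omega_not_evalsTo hc
  subst hml
  exact ⟨m, hV, hV'⟩

/-- The equation says that two models differing only in their last datum are congruent. Giving that
datum a name `k` fresh for `e'` reduces the claim to invariance under congruence. No typing of `e`
is required, since the type `c` of the datum is pinned down by the value of `f`. -/
theorem Reaches.of_sat_eq {Γ : FEnv} {Δ : Env} {ρ : Reading} {M : Model} {e f e' : LTerm} {a b : Ty}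
    (ha : a.IsFinite) (hf : f.HasType Γ a) (he' : e'.HasType Γ (.ref b))
    (hρ : ρ.Interprets Γ Δ) (h : (Formula.eq e f).Sat Δ M ρ) (hr : Reaches ρ M f e') :
    Reaches ρ M e e' := by
  obtain ⟨c, V, V', hV, hV', hm⟩ := h
  obtain ⟨-, S, hS⟩ := isModel_iff.1 hm.2.1
  have hlen : M.env.length = Δ.vars.length := by
    simpa [Model.push, Env.snoc] using hm.2.1.length_env
  obtain ⟨-, W, hW, hWv, hWt⟩ := hf.den (hρ.snoc c) hS
  cases ((hf.den_append M.store hρ hlen V').trans hV').symm.trans hW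
  rw [ha.inst_eq] at hWt
  have hcv : (Δ.snoc c).vars[Δ.vars.length]? = some c := by simp [Env.snoc]
  obtain ⟨W, hW, -, hWc⟩ := hS.exists_env hcv
  cases (show (M.push V').env[Δ.vars.length]? = some V' by simp [Model.push, ← hlen]).symm.trans hW
  have hca : Ty.Eqv c a := HasType.eqv_of_isFinite ha hWv hWt hWc
  have hc : c.Closed := hS.vars_closed c (by simp [Env.snoc])
  obtain ⟨k, hk⟩ := e'.exists_varsBelow
  have hρ' : (ρ.bind k Δ.vars.length).Interprets (Γ.bind k c) (Δ.snoc c) :=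
    hρ.bind_of_eq k (Ty.inst_of_no_tvar hc.2)
  have hu : ∀ W, (LTerm.var k).den (ρ.bind k Δ.vars.length) (M.push W).env (M.push W).store =
      some W := by
    intro W
    simp [LTerm.den, Reading.bind, Model.push, ← hlen]
  have hd : ∀ W, e'.den (ρ.bind k Δ.vars.length) (M.push W).env (M.push W).store =
      e'.den ρ M.env M.store := fun W => he'.den_bind M.store hk hρ hlen W
  obtain ⟨W, l, hW, hl, hn⟩ := hr
  cases hV'.symm.trans hW
  have hr' : Reaches (ρ.bind k Δ.vars.length) (M.push V') (.var k) e' :=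
    ⟨V', l, hu V', (hd V').trans hl, hn⟩
  obtain ⟨W, l', hW, hl', hn'⟩ := hr'.of_modelEquiv ha
    ((LTerm.HasType.bind_var Γ k c).conv hca ha.closed.1) (he'.bind hk c) hρ' hm.symm
  cases (hu V).symm.trans hW
  exact ⟨V, l', hV, (hd V).symm.trans hl', hn'⟩

/-! ### Functional programs -/

/-- A terminating run leaves the store as it was and hides nothing new, so dropping the result gives
back the very same model. For a diverging program there is nothing to check. -/
theorem functional_of_pureSteps {Δ : Env} {L : Term} {a : Ty} (hL : HasType Δ.locs Δ.vars L a)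
    (h : ∀ S M, ModelTyping S Δ M → ∃ V, (V.IsValue ∨ ∃ b, V = omega b) ∧
      PureSteps ∅ M.store (L.subst (Term.envSubst M.env)) V) : Functional Δ L a := by
  refine ⟨hL, ?_⟩
  rintro M _ hM ⟨-, -, h', W, σ, hev, rfl⟩
  obtain ⟨-, S, hS⟩ := isModel_iff.1 hM
  obtain ⟨V, hV, st⟩ := h S M hS
  have hev := st.evalsTo_iff.1 hev
  rcases hV with hV | ⟨b, rfl⟩
  · obtain h | ⟨d, st', -⟩ := hev.1.cases_head
    · cases h
      simpa [Model.pop] using ModelEquiv.refl hM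
    · exact (hV.not_step st').elim
  · exact (omega_not_evalsTo hev).elim

theorem runs_push {S : ℕ → Option Ty} {Δ : Env} {M : Model} {L V : Term} {a : Ty}
    (hM : IsModel Δ M) (hS : ModelTyping S Δ M) (hL : HasType Δ.locs Δ.vars L a) (ha : a.Closed)
    (hV : V.IsValue) (hVa : HasType S [] V a)
    (st : PureSteps ∅ M.store (L.subst (Term.envSubst M.env)) V) : Runs Δ M L a (M.push V) :=
  ⟨hL, isModel_iff.2 ⟨(isModel_iff.1 hM).1, S, hS.push ha hV hVa⟩, ∅, V, M.store,
    ⟨st.steps, hV⟩, by simp [Model.push]⟩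

section

variable {Γ : FEnv} {Δ : Env} {ρ : Reading} {e : LTerm} {a b : Ty}

theorem functional_fst (ha : a.IsFinite) (hb : b.IsFinite) (he : e.HasType Γ (.prod a b))
    (hρ : ρ.Interprets Γ Δ) : Functional Δ (.fst (e.prog ρ)) a := by
  have ht := he.prog hρ
  simp only [Ty.inst, ha.inst_eq, hb.inst_eq] at ht
  refine functional_of_pureSteps (.fst ht) fun S M hS => ?_
  obtain ⟨-, V, hd, hV, hVt⟩ := he.den hρ hS
  simp only [Ty.inst, ha.inst_eq, hb.inst_eq] at hVt
  obtain ⟨V₁, V₂, rfl, -⟩ := hVt.exists_pair hV ha.closed.1 hb.closed.1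
  exact ⟨V₁, .inl hV.1, (LTerm.pureSteps_prog _ hS hd).fst hV.1 hV.2⟩

theorem functional_snd (ha : a.IsFinite) (hb : b.IsFinite) (he : e.HasType Γ (.prod a b))
    (hρ : ρ.Interprets Γ Δ) : Functional Δ (.snd (e.prog ρ)) b := by
  have ht := he.prog hρ
  simp only [Ty.inst, ha.inst_eq, hb.inst_eq] at ht
  refine functional_of_pureSteps (.snd ht) fun S M hS => ?_
  obtain ⟨-, V, hd, hV, hVt⟩ := he.den hρ hS
  simp only [Ty.inst, ha.inst_eq, hb.inst_eq] at hVt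
  obtain ⟨V₁, V₂, rfl, -⟩ := hVt.exists_pair hV ha.closed.1 hb.closed.1
  exact ⟨V₂, .inl hV.2, (LTerm.pureSteps_prog _ hS hd).snd hV.1 hV.2⟩

/-- In the unwanted branch some program of type `a` has to be supplied. Divergence is always
available and has no effect on models, whereas a default value of a reference type would need a
location. -/
theorem functional_caseL (ha : a.IsFinite) (hb : b.IsFinite) (he : e.HasType Γ (.sum a b))
    (hρ : ρ.Interprets Γ Δ) :
    Functional Δ (.caseOf (e.prog ρ) a (.var 0) b (omega a)) a := by
  have ht := he.prog hρ
  simp only [Ty.inst, ha.inst_eq, hb.inst_eq] at ht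
  refine functional_of_pureSteps (.caseOf ha.closed.1 hb.closed.1 ht (.var rfl)
    (omega_hasType ha.closed.1)) fun S M hS => ?_
  obtain ⟨-, V, hd, hV, hVt⟩ := he.den hρ hS
  simp only [Ty.inst, ha.inst_eq, hb.inst_eq] at hVt
  obtain ⟨c, d, W, rfl, -⟩ | ⟨c, d, W, rfl, -⟩ :=
    hVt.exists_inl_or_inr hV ha.closed.1 hb.closed.1
  · exact ⟨W, .inl hV, (LTerm.pureSteps_prog _ hS hd).caseL hV⟩
  · exact ⟨omega a, .inr ⟨a, rfl⟩, (LTerm.pureSteps_prog _ hS hd).caseR hV⟩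

theorem functional_caseR (ha : a.IsFinite) (hb : b.IsFinite) (he : e.HasType Γ (.sum a b))
    (hρ : ρ.Interprets Γ Δ) :
    Functional Δ (.caseOf (e.prog ρ) a (omega b) b (.var 0)) b := by
  have ht := he.prog hρ
  simp only [Ty.inst, ha.inst_eq, hb.inst_eq] at ht
  refine functional_of_pureSteps (.caseOf ha.closed.1 hb.closed.1 ht
    (omega_hasType hb.closed.1) (.var rfl)) fun S M hS => ?_
  obtain ⟨-, V, hd, hV, hVt⟩ := he.den hρ hS
  simp only [Ty.inst, ha.inst_eq, hb.inst_eq] at hVt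
  obtain ⟨c, d, W, rfl, -⟩ | ⟨c, d, W, rfl, -⟩ :=
    hVt.exists_inl_or_inr hV ha.closed.1 hb.closed.1
  · exact ⟨omega b, .inr ⟨b, rfl⟩, (LTerm.pureSteps_prog _ hS hd).caseL hV⟩
  · exact ⟨W, .inl hV, (LTerm.pureSteps_prog _ hS hd).caseR hV⟩

end

/-! ### Existential quantification over components -/

namespace Formula

theorem sat_or {C D : Formula} {Δ : Env} {M : Model} {ρ : Reading} :
    (or C D).Sat Δ M ρ ↔ C.Sat Δ M ρ ∨ D.Sat Δ M ρ := by
  simp only [or, Sat]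
  tauto

theorem sat_ex {x : ℕ} {a : Ty} {C : Formula} {Δ : Env} {M : Model} {ρ : Reading} :
    (ex x a C).Sat Δ M ρ ↔ ∃ L M', Functional Δ L (a.inst ρ.tys) ∧
      Runs Δ M L (a.inst ρ.tys) M' ∧
      C.Sat (Δ.snoc (a.inst ρ.tys)) M' (ρ.bind x Δ.vars.length) := by
  simp only [ex, Sat]
  push Not
  rfl

theorem not_sat_fls {Δ : Env} {M : Model} {ρ : Reading} (hM : IsModel Δ M) : ¬ fls.Sat Δ M ρ := by
  obtain ⟨hf, S, hS⟩ := isModel_iff.1 hM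
  refine fun h => h ⟨.nat, .nat 1, .nat 1, rfl, rfl, .refl (isModel_iff.2 ⟨hf, S, ?_⟩)⟩
  exact hS.push ⟨trivial, fun _ => id⟩ trivial (.nat 1)

end Formula

/-- The program chosen by the quantifier may change the store or hide new locations, but the model
without its result is congruent to `M`. Reachability therefore carries over, and the two terms do
not see the new variable. -/
theorem Reaches.of_sat_ex {Γ : FEnv} {Δ : Env} {ρ : Reading} {M : Model} {e e' : LTerm}
    {a b c : Ty} {k : ℕ} {C : Formula} (ha : a.IsFinite) (he : e.HasType Γ a)
    (he' : e'.HasType Γ (.ref b)) (hk : e.VarsBelow k) (hk' : e'.VarsBelow k)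
    (hρ : ρ.Interprets Γ Δ) (hM : IsModel Δ M) (h : (Formula.ex k c C).Sat Δ M ρ)
    (hC : ∀ (Δ' : Env) (ρ' : Reading) (M' : Model), ρ'.Interprets (Γ.bind k c) Δ' →
      IsModel Δ' M' → C.Sat Δ' M' ρ' → Reaches ρ' M' e e') : Reaches ρ M e e' := by
  obtain ⟨L, M', hL, hR, hs⟩ := Formula.sat_ex.1 h
  have hr := hC _ _ _ (hρ.bind k c) hR.2.1 hs
  have hequiv := hL.2 M M' hM hR
  obtain ⟨-, -, h', V, σ, -, rfl⟩ := hR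
  have hp : Model.pop ⟨M.hid ∪ h', M.env ++ [V], σ⟩ = ⟨M.hid ∪ h', M.env, σ⟩ := by
    simp [Model.pop]
  rw [hp] at hequiv
  refine Reaches.of_modelEquiv ha he he' hρ hequiv.symm ?_
  obtain ⟨W, l, hW, hl, hn⟩ := hr
  exact ⟨W, l, (he.den_bind σ hk hρ hM.length_env V).symm.trans hW,
    (he'.den_bind σ hk' hρ hM.length_env V).symm.trans hl, hn⟩

section Components

variable {Γ : FEnv} {Δ : Env} {ρ : Reading} {M : Model} {e e' : LTerm} {a b c : Ty} {k : ℕ}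
  {C D : Formula}

theorem bind_bind_var (Γ : FEnv) (k : ℕ) (a b : Ty) :
    (LTerm.var k).HasType ((Γ.bind k a).bind (k + 1) b) a :=
  (LTerm.HasType.bind_var Γ k a).bind (Nat.lt_succ_self k) b

/-- Each quantifier is removed by `Reaches.of_sat_ex`; what remains is an equation with a pair,
whose locations are those of its two components. Leaving `C` and `D` open makes the lemma serve both
families of formulae. -/
theorem reaches_of_sat_prod (ha : a.IsFinite) (hb : b.IsFinite) (he : e.HasType Γ (.prod a b))
    (he' : e'.HasType Γ (.ref c)) (hk : e.VarsBelow k) (hk' : e'.VarsBelow k)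
    (hρ : ρ.Interprets Γ Δ) (hM : IsModel Δ M)
    (h : (Formula.ex k a (.ex (k + 1) b (.and (.eq e (.pair (.var k) (.var (k + 1))))
      (.or C D)))).Sat Δ M ρ)
    (hC : ∀ (Δ' : Env) (ρ' : Reading) (M' : Model),
      ρ'.Interprets ((Γ.bind k a).bind (k + 1) b) Δ' → IsModel Δ' M' → C.Sat Δ' M' ρ' →
      Reaches ρ' M' (.var k) e')
    (hD : ∀ (Δ' : Env) (ρ' : Reading) (M' : Model),
      ρ'.Interprets ((Γ.bind k a).bind (k + 1) b) Δ' → IsModel Δ' M' → D.Sat Δ' M' ρ' →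
      Reaches ρ' M' (.var (k + 1)) e') : Reaches ρ M e e' := by
  have hab : (Ty.prod a b).IsFinite := ⟨ha, hb⟩
  refine Reaches.of_sat_ex hab he he' hk hk' hρ hM h fun Δ₁ ρ₁ M₁ hρ₁ hM₁ h₁ => ?_
  refine Reaches.of_sat_ex hab (he.bind hk a) (he'.bind hk' a) (hk.mono k.le_succ)
    (hk'.mono k.le_succ) hρ₁ hM₁ h₁ fun Δ₂ ρ₂ M₂ hρ₂ hM₂ h₂ => ?_
  have hx := bind_bind_var Γ k a b
  have hy := LTerm.HasType.bind_var (Γ.bind k a) (k + 1) b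
  refine Reaches.of_sat_eq hab (.pair hx hy)
    ((he'.bind hk' a).bind (hk'.mono k.le_succ) b) hρ₂ h₂.1 ?_
  obtain ⟨-, S, hS⟩ := isModel_iff.1 hM₂
  obtain ⟨-, V, hV, -⟩ := hx.den hρ₂ hS
  obtain ⟨-, W, hW, -⟩ := hy.den hρ₂ hS
  have hp : (LTerm.pair (.var k) (.var (k + 1))).den ρ₂ M₂.env M₂.store = some (.pair V W) := by
    rw [LTerm.den, hV, hW]
    rfl
  rcases Formula.sat_or.1 h₂.2 with h | h
  · obtain ⟨V', l, hV', hl, hn⟩ := hC _ _ _ hρ₂ hM₂ h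
    cases hV.symm.trans hV'
    exact ⟨_, l, hp, hl, ncl_union.2 (.inl hn)⟩
  · obtain ⟨W', l, hW', hl, hn⟩ := hD _ _ _ hρ₂ hM₂ h
    cases hW.symm.trans hW'
    exact ⟨_, l, hp, hl, ncl_union.2 (.inr hn)⟩

/-- The witnesses are the two projections of `e`. The extended model is produced before `C` and `D`
are chosen, because for `reachIn` the number of steps is known only after the component has been
examined in that model. -/
theorem exists_model_prod (ha : a.IsFinite) (hb : b.IsFinite) (he : e.HasType Γ (.prod a b))
    (he' : e'.HasType Γ (.ref c)) (hk : e.VarsBelow k) (hk' : e'.VarsBelow k)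
    (hρ : ρ.Interprets Γ Δ) (hM : IsModel Δ M) (hr : Reaches ρ M e e') :
    ∃ (Δ' : Env) (ρ' : Reading) (M' : Model),
      ρ'.Interprets ((Γ.bind k a).bind (k + 1) b) Δ' ∧ IsModel Δ' M' ∧
      (Reaches ρ' M' (.var k) e' ∨ Reaches ρ' M' (.var (k + 1)) e') ∧
      ∀ C D : Formula, C.Sat Δ' M' ρ' ∨ D.Sat Δ' M' ρ' →
        (Formula.ex k a (.ex (k + 1) b (.and (.eq e (.pair (.var k) (.var (k + 1))))
          (.or C D)))).Sat Δ M ρ := by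
  obtain ⟨V, l, hV, hl, hn⟩ := hr
  obtain ⟨-, S, hS⟩ := isModel_iff.1 hM
  obtain ⟨-, V', hd, hVv, hVt⟩ := he.den hρ hS
  cases hV.symm.trans hd
  simp only [Ty.inst, ha.inst_eq, hb.inst_eq] at hVt
  obtain ⟨V₁, V₂, rfl, h₁, h₂⟩ := hVt.exists_pair hVv ha.closed.1 hb.closed.1
  have hf₁ := functional_fst ha hb he hρ
  have hR₁ := runs_push hM hS hf₁.1 ha.closed hVv.1 h₁
    ((LTerm.pureSteps_prog ∅ hS hd).fst hVv.1 hVv.2)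
  have hρ₁ := hρ.bind_of_eq k (ha.inst_eq ρ.tys)
  have hM₁ := hR₁.2.1
  have hS₁ := hS.push ha.closed hVv.1 h₁
  have hd₁ := (he.den_bind M.store hk hρ hM.length_env V₁).trans hd
  have hl₁ := (he'.den_bind M.store hk' hρ hM.length_env V₁).trans hl
  have he₁ := he.bind hk a
  have he₁' := he'.bind hk' a
  have hf₂ := functional_snd ha hb he₁ hρ₁
  have hR₂ := runs_push hM₁ hS₁ hf₂.1 hb.closed hVv.2 h₂
    ((LTerm.pureSteps_prog ∅ hS₁ hd₁).snd hVv.1 hVv.2)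
  have hρ₂ := hρ₁.bind_of_eq (k + 1) (hb.inst_eq _)
  have hM₂ := hR₂.2.1
  have hd₂ := (he₁.den_bind M.store (hk.mono k.le_succ) hρ₁ hM₁.length_env V₂).trans hd₁
  have hl₂ := (he₁'.den_bind M.store (hk'.mono k.le_succ) hρ₁ hM₁.length_env V₂).trans hl₁
  have hx := bind_bind_var Γ k a b
  have hy := LTerm.HasType.bind_var (Γ.bind k a) (k + 1) b
  have hlen := hM.length_env
  have hlen₁ := hM₁.length_env
  have hxd : (LTerm.var k).den ((ρ.bind k Δ.vars.length).bind (k + 1) (Δ.snoc a).vars.length)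
      ((M.push V₁).push V₂).env ((M.push V₁).push V₂).store = some V₁ := by
    simp [LTerm.den, Reading.bind, Model.push, ← hlen]
  have hyd : (LTerm.var (k + 1)).den
      ((ρ.bind k Δ.vars.length).bind (k + 1) (Δ.snoc a).vars.length)
      ((M.push V₁).push V₂).env ((M.push V₁).push V₂).store = some V₂ := by
    rw [← hlen₁]
    simp [LTerm.den, Reading.bind, Model.push]
  have hpd : (LTerm.pair (.var k) (.var (k + 1))).den
      ((ρ.bind k Δ.vars.length).bind (k + 1) (Δ.snoc a).vars.length)
      ((M.push V₁).push V₂).env ((M.push V₁).push V₂).store = some (.pair V₁ V₂) := by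
    rw [LTerm.den, hxd, hyd]
    rfl
  refine ⟨_, _, _, hρ₂, hM₂, ?_, fun C D hCD => ?_⟩
  · rcases ncl_union.1 hn with hn | hn
    · exact .inl ⟨V₁, l, hxd, hl₂, hn⟩
    · exact .inr ⟨V₂, l, hyd, hl₂, hn⟩
  · rw [Formula.sat_ex, ha.inst_eq]
    refine ⟨_, _, hf₁, hR₁, ?_⟩
    rw [Formula.sat_ex, hb.inst_eq]
    exact ⟨_, _, hf₂, hR₂, sat_eq_of_erase_eq (he₁.bind (hk.mono k.le_succ) b) (.pair hx hy) hρ₂ hM₂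
      hd₂ hpd rfl, Formula.sat_or.2 hCD⟩

theorem reaches_of_sat_inl (ha : a.IsFinite) (hb : b.IsFinite) (he : e.HasType Γ (.sum a b))
    (he' : e'.HasType Γ (.ref c)) (hk : e.VarsBelow k) (hk' : e'.VarsBelow k)
    (hρ : ρ.Interprets Γ Δ) (hM : IsModel Δ M)
    (h : (Formula.ex k a (.and (.eq e (.inl a b (.var k))) C)).Sat Δ M ρ)
    (hC : ∀ (Δ' : Env) (ρ' : Reading) (M' : Model), ρ'.Interprets (Γ.bind k a) Δ' →
      IsModel Δ' M' → C.Sat Δ' M' ρ' → Reaches ρ' M' (.var k) e') : Reaches ρ M e e' := by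
  have hab : (Ty.sum a b).IsFinite := ⟨ha, hb⟩
  refine Reaches.of_sat_ex hab he he' hk hk' hρ hM h fun Δ₁ ρ₁ M₁ hρ₁ hM₁ h₁ => ?_
  refine Reaches.of_sat_eq hab
    (.inl ha.closed.1 hb.closed.1 (.bind_var Γ k a)) (he'.bind hk' a) hρ₁ h₁.1 ?_
  obtain ⟨V, l, hV, hl, hn⟩ := hC _ _ _ hρ₁ hM₁ h₁.2
  exact ⟨_, l, Option.map_eq_some_iff.2 ⟨V, hV, rfl⟩, hl, hn⟩

theorem reaches_of_sat_inr (ha : a.IsFinite) (hb : b.IsFinite) (he : e.HasType Γ (.sum a b))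
    (he' : e'.HasType Γ (.ref c)) (hk : e.VarsBelow k) (hk' : e'.VarsBelow k)
    (hρ : ρ.Interprets Γ Δ) (hM : IsModel Δ M)
    (h : (Formula.ex k b (.and (.eq e (.inr a b (.var k))) C)).Sat Δ M ρ)
    (hC : ∀ (Δ' : Env) (ρ' : Reading) (M' : Model), ρ'.Interprets (Γ.bind k b) Δ' →
      IsModel Δ' M' → C.Sat Δ' M' ρ' → Reaches ρ' M' (.var k) e') : Reaches ρ M e e' := by
  have hab : (Ty.sum a b).IsFinite := ⟨ha, hb⟩
  refine Reaches.of_sat_ex hab he he' hk hk' hρ hM h fun Δ₁ ρ₁ M₁ hρ₁ hM₁ h₁ => ?_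
  refine Reaches.of_sat_eq hab
    (.inr ha.closed.1 hb.closed.1 (.bind_var Γ k b)) (he'.bind hk' b) hρ₁ h₁.1 ?_
  obtain ⟨V, l, hV, hl, hn⟩ := hC _ _ _ hρ₁ hM₁ h₁.2
  exact ⟨_, l, Option.map_eq_some_iff.2 ⟨V, hV, rfl⟩, hl, hn⟩

/-- The analogue of `exists_model_prod`: the value of `e` decides which of the two case programs
terminates and provides the witness. -/
theorem exists_model_sum (ha : a.IsFinite) (hb : b.IsFinite) (he : e.HasType Γ (.sum a b))
    (he' : e'.HasType Γ (.ref c)) (hk : e.VarsBelow k) (hk' : e'.VarsBelow k)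
    (hρ : ρ.Interprets Γ Δ) (hM : IsModel Δ M) (hr : Reaches ρ M e e') :
    (∃ (Δ' : Env) (ρ' : Reading) (M' : Model),
      ρ'.Interprets (Γ.bind k a) Δ' ∧ IsModel Δ' M' ∧ Reaches ρ' M' (.var k) e' ∧
      ∀ C : Formula, C.Sat Δ' M' ρ' →
        (Formula.ex k a (.and (.eq e (.inl a b (.var k))) C)).Sat Δ M ρ) ∨
    ∃ (Δ' : Env) (ρ' : Reading) (M' : Model),
      ρ'.Interprets (Γ.bind k b) Δ' ∧ IsModel Δ' M' ∧ Reaches ρ' M' (.var k) e' ∧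
      ∀ C : Formula, C.Sat Δ' M' ρ' →
        (Formula.ex k b (.and (.eq e (.inr a b (.var k))) C)).Sat Δ M ρ := by
  obtain ⟨V, l, hV, hl, hn⟩ := hr
  obtain ⟨-, S, hS⟩ := isModel_iff.1 hM
  obtain ⟨-, V', hd, hVv, hVt⟩ := he.den hρ hS
  cases hV.symm.trans hd
  simp only [Ty.inst, ha.inst_eq, hb.inst_eq] at hVt
  have hxd : ∀ W, (LTerm.var k).den (ρ.bind k Δ.vars.length) (M.push W).env (M.push W).store =
      some W := by
    intro W
    simp [LTerm.den, Reading.bind, Model.push, ← hM.length_env]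
  have hl₁ := fun W => (he'.den_bind M.store hk' hρ hM.length_env W).trans hl
  have hd₁ := fun W => (he.den_bind M.store hk hρ hM.length_env W).trans hd
  obtain ⟨c, d, W, rfl, hW⟩ | ⟨c, d, W, rfl, hW⟩ :=
    hVt.exists_inl_or_inr hVv ha.closed.1 hb.closed.1
  · have hf := functional_caseL ha hb he hρ
    have hR := runs_push (V := W) hM hS hf.1 ha.closed hVv hW
      ((LTerm.pureSteps_prog ∅ hS hd).caseL hVv)
    have hρ₁ := hρ.bind_of_eq k (ha.inst_eq ρ.tys)
    refine .inl ⟨_, _, _, hρ₁, hR.2.1, ⟨W, l, hxd W, hl₁ W, hn⟩, fun C hC => ?_⟩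
    rw [Formula.sat_ex, ha.inst_eq]
    -- The value of `e` is annotated with `c` and `d`, the formula with `a` and `b`; the two
    -- injections agree after erasure.
    exact ⟨_, _, hf, hR, sat_eq_of_erase_eq (he.bind hk a)
      (.inl ha.closed.1 hb.closed.1 (.bind_var Γ k a)) hρ₁ hR.2.1 (hd₁ W)
      (Option.map_eq_some_iff.2 ⟨W, hxd W, rfl⟩) rfl, hC⟩
  · have hf := functional_caseR ha hb he hρ
    have hR := runs_push (V := W) hM hS hf.1 hb.closed hVv hW
      ((LTerm.pureSteps_prog ∅ hS hd).caseR hVv)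
    have hρ₁ := hρ.bind_of_eq k (hb.inst_eq ρ.tys)
    refine .inr ⟨_, _, _, hρ₁, hR.2.1, ⟨W, l, hxd W, hl₁ W, hn⟩, fun C hC => ?_⟩
    rw [Formula.sat_ex, hb.inst_eq]
    exact ⟨_, _, hf, hR, sat_eq_of_erase_eq (he.bind hk b)
      (.inr ha.closed.1 hb.closed.1 (.bind_var Γ k b)) hρ₁ hR.2.1 (hd₁ W)
      (Option.map_eq_some_iff.2 ⟨W, hxd W, rfl⟩) rfl, hC⟩

/-! ### References -/

theorem reaches_of_sat_eq (he' : e'.HasType Γ (.ref c)) (hρ : ρ.Interprets Γ Δ)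
    (h : (Formula.eq e e').Sat Δ M ρ) : Reaches ρ M e e' := by
  obtain ⟨l, hl, hl'⟩ := exists_loc_of_sat_eq he' hρ h
  exact ⟨_, l, hl, hl', .base rfl⟩

theorem reaches_of_deref (hr : Reaches ρ M (.deref e) e') : Reaches ρ M e e' := by
  obtain ⟨W, l, hW, hl, hn⟩ := hr
  obtain ⟨V, hV, hW⟩ := Option.bind_eq_some_iff.1 hW
  split at hW
  · exact ⟨_, l, hV, hl, (ncl_singleton hW).2 (.inr hn)⟩
  · cases hW

theorem sat_eq_or_reaches_deref (he : e.HasType Γ (.ref a))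
    (hρ : ρ.Interprets Γ Δ) (hM : IsModel Δ M) (hr : Reaches ρ M e e') :
    (Formula.eq e e').Sat Δ M ρ ∨ Reaches ρ M (.deref e) e' := by
  obtain ⟨V, l, hV, hl, hn⟩ := hr
  obtain ⟨-, S, hS⟩ := isModel_iff.1 hM
  obtain ⟨hc, V', hd, hVv, hVt⟩ := he.den hρ hS
  cases hV.symm.trans hd
  obtain ⟨m, a', rfl, hm, -⟩ := hVt.exists_loc hVv
  obtain ⟨W, hW, -⟩ := hS.exists_store hm
  rcases (ncl_singleton hW).1 hn with rfl | hn
  · exact .inl ⟨_, _, _, hV, hl, .push_of_erase_eq hM hS hc trivial hVt trivial hVt rfl⟩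
  · exact .inr ⟨W, l, by simp [LTerm.den, hV, hW], hl, hn⟩

theorem not_reaches_of_fl_eq_empty
    (h : ∀ V, e.den ρ M.env M.store = some V → V.fl = ∅) : ¬ Reaches ρ M e e' := by
  rintro ⟨V, l, hV, -, hn⟩
  rw [h V hV] at hn
  exact not_ncl_empty hn

end Components

theorem not_reaches_unit {Γ : FEnv} {Δ : Env} {ρ : Reading} {M : Model} {e e' : LTerm}
    (he : e.HasType Γ .unit) (hρ : ρ.Interprets Γ Δ) (hM : IsModel Δ M) : ¬ Reaches ρ M e e' := by
  obtain ⟨-, S, hS⟩ := isModel_iff.1 hM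
  obtain ⟨-, V, hd, hV, ht⟩ := he.den hρ hS
  refine not_reaches_of_fl_eq_empty fun W hW => ?_
  cases hd.symm.trans hW
  obtain rfl := HasType.eq_unit ht hV
  rfl

theorem not_reaches_bool {Γ : FEnv} {Δ : Env} {ρ : Reading} {M : Model} {e e' : LTerm}
    (he : e.HasType Γ .bool) (hρ : ρ.Interprets Γ Δ) (hM : IsModel Δ M) : ¬ Reaches ρ M e e' := by
  obtain ⟨-, S, hS⟩ := isModel_iff.1 hM
  obtain ⟨-, V, hd, hV, ht⟩ := he.den hρ hS
  refine not_reaches_of_fl_eq_empty fun W hW => ?_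
  cases hd.symm.trans hW
  obtain ⟨_, rfl⟩ := HasType.exists_bool ht hV
  rfl

theorem not_reaches_nat {Γ : FEnv} {Δ : Env} {ρ : Reading} {M : Model} {e e' : LTerm}
    (he : e.HasType Γ .nat) (hρ : ρ.Interprets Γ Δ) (hM : IsModel Δ M) : ¬ Reaches ρ M e e' := by
  obtain ⟨-, S, hS⟩ := isModel_iff.1 hM
  obtain ⟨-, V, hd, hV, ht⟩ := he.den hρ hS
  refine not_reaches_of_fl_eq_empty fun W hW => ?_
  cases hd.symm.trans hW
  obtain ⟨_, rfl⟩ := HasType.exists_nat ht hV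
  rfl

/-! ### The formulae that express reachability -/

/-- Induction on the type for all environments, models and terms at once, because quantifiers extend
the model and a dereference replaces the source term. -/
theorem sat_reachO_iff {a c : Ty} (ha : a.IsFinite) {Γ : FEnv} {Δ : Env} {ρ : Reading} {M : Model}
    {e e' : LTerm} {k : ℕ} (he : e.HasType Γ a) (he' : e'.HasType Γ (.ref c))
    (hk : e.VarsBelow k) (hk' : e'.VarsBelow k) (hρ : ρ.Interprets Γ Δ) (hM : IsModel Δ M) :
    (Formula.reachO a k e e').Sat Δ M ρ ↔ Reaches ρ M e e' := by
  induction a generalizing Γ Δ ρ M e e' k with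
  | unit => exact iff_of_false (Formula.not_sat_fls hM) (not_reaches_unit he hρ hM)
  | bool => exact iff_of_false (Formula.not_sat_fls hM) (not_reaches_bool he hρ hM)
  | nat => exact iff_of_false (Formula.not_sat_fls hM) (not_reaches_nat he hρ hM)
  | prod a b iha ihb =>
      have hx := bind_bind_var Γ k a b
      have hy := LTerm.HasType.bind_var (Γ.bind k a) (k + 1) b
      have he₂' := (he'.bind hk' a).bind (hk'.mono k.le_succ) b
      have hk₂' : e'.VarsBelow (k + 2) := hk'.mono (by omega)
      have hkx : (LTerm.var k).VarsBelow (k + 2) := by simp [LTerm.VarsBelow]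
      have hky : (LTerm.var (k + 1)).VarsBelow (k + 2) := by simp [LTerm.VarsBelow]
      constructor
      · intro h
        exact reaches_of_sat_prod ha.1 ha.2 he he' hk hk' hρ hM h
          (fun _ _ _ hρ' hM' => (iha ha.1 hx he₂' hkx hk₂' hρ' hM').1)
          (fun _ _ _ hρ' hM' => (ihb ha.2 hy he₂' hky hk₂' hρ' hM').1)
      · intro h
        obtain ⟨Δ', ρ', M', hρ', hM', hr, hs⟩ := exists_model_prod ha.1 ha.2 he he' hk hk' hρ hM h
        exact hs _ _ (hr.imp (iha ha.1 hx he₂' hkx hk₂' hρ' hM').2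
          (ihb ha.2 hy he₂' hky hk₂' hρ' hM').2)
  | sum a b iha ihb =>
      have hk₁' : e'.VarsBelow (k + 1) := hk'.mono k.le_succ
      have hkx : (LTerm.var k).VarsBelow (k + 1) := Nat.lt_succ_self k
      have iha' : ∀ (Δ' : Env) (ρ' : Reading) (M' : Model), ρ'.Interprets (Γ.bind k a) Δ' →
          IsModel Δ' M' → _ := fun _ _ _ hρ' hM' =>
        iha ha.1 (.bind_var Γ k a) (he'.bind hk' a) hkx hk₁' hρ' hM'
      have ihb' : ∀ (Δ' : Env) (ρ' : Reading) (M' : Model), ρ'.Interprets (Γ.bind k b) Δ' →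
          IsModel Δ' M' → _ := fun _ _ _ hρ' hM' =>
        ihb ha.2 (.bind_var Γ k b) (he'.bind hk' b) hkx hk₁' hρ' hM'
      rw [Formula.reachO, Formula.sat_or]
      constructor
      · rintro (h | h)
        · exact reaches_of_sat_inl ha.1 ha.2 he he' hk hk' hρ hM h
            fun Δ' ρ' M' hρ' hM' => (iha' Δ' ρ' M' hρ' hM').1
        · exact reaches_of_sat_inr ha.1 ha.2 he he' hk hk' hρ hM h
            fun Δ' ρ' M' hρ' hM' => (ihb' Δ' ρ' M' hρ' hM').1
      · intro h
        obtain ⟨Δ', ρ', M', hρ', hM', hr, hs⟩ | ⟨Δ', ρ', M', hρ', hM', hr, hs⟩ :=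
          exists_model_sum ha.1 ha.2 he he' hk hk' hρ hM h
        · exact .inl (hs _ ((iha' Δ' ρ' M' hρ' hM').2 hr))
        · exact .inr (hs _ ((ihb' Δ' ρ' M' hρ' hM').2 hr))
  | ref a ih =>
      rw [Formula.reachO, Formula.sat_or, ih ha (.deref he) he' hk hk' hρ hM]
      exact ⟨fun h => h.elim (reaches_of_sat_eq he' hρ) reaches_of_deref,
        sat_eq_or_reaches_deref he hρ hM⟩
  | _ => exact ha.elim

/-- The induction is on `i` and not on the type, since the last disjunct of each recursive clause
lowers `i` while keeping the type. -/
theorem reaches_of_sat_reachIn {c : Ty} (i : ℕ) {a : Ty} (ha : a.IsFinite) {Γ : FEnv} {Δ : Env}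
    {ρ : Reading} {M : Model} {e e' : LTerm} {k : ℕ} (he : e.HasType Γ a)
    (he' : e'.HasType Γ (.ref c)) (hk : e.VarsBelow k) (hk' : e'.VarsBelow k)
    (hρ : ρ.Interprets Γ Δ) (hM : IsModel Δ M) (h : (Formula.reachIn i a k e e').Sat Δ M ρ) :
    Reaches ρ M e e' := by
  induction i generalizing a Γ Δ ρ M e e' k with
  -- Here `e` may have any finite type: an equation with the reference `e'` already forces `e` to
  -- denote a location.
  | zero => exact reaches_of_sat_eq he' hρ h
  | succ n ih =>
      cases a with
      | unit | bool | nat => exact (Formula.not_sat_fls hM h).elim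
      | prod a b =>
          rcases Formula.sat_or.1 h with h | h
          · have he₂' := (he'.bind hk' a).bind (hk'.mono k.le_succ) b
            have hk₂' : e'.VarsBelow (k + 2) := hk'.mono (by omega)
            exact reaches_of_sat_prod ha.1 ha.2 he he' hk hk' hρ hM h
              (fun _ _ _ => ih ha.1 (bind_bind_var Γ k a b) he₂' (by simp [LTerm.VarsBelow]) hk₂')
              (fun _ _ _ => ih ha.2 (.bind_var (Γ.bind k a) (k + 1) b) he₂'
                (by simp [LTerm.VarsBelow]) hk₂')
          · exact ih ha he he' hk hk' hρ hM h
      | sum a b =>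
          rcases Formula.sat_or.1 h with h | h
          · have hk₁' : e'.VarsBelow (k + 1) := hk'.mono k.le_succ
            rcases Formula.sat_or.1 h with h | h
            · exact reaches_of_sat_inl ha.1 ha.2 he he' hk hk' hρ hM h fun _ _ _ =>
                ih ha.1 (.bind_var Γ k a) (he'.bind hk' a) (Nat.lt_succ_self k) hk₁'
            · exact reaches_of_sat_inr ha.1 ha.2 he he' hk hk' hρ hM h fun _ _ _ =>
                ih ha.2 (.bind_var Γ k b) (he'.bind hk' b) (Nat.lt_succ_self k) hk₁'
          · exact ih ha he he' hk hk' hρ hM h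
      | ref a =>
          rcases Formula.sat_or.1 h with h | h
          · exact reaches_of_deref
              (ih (a := a) (e := .deref e) ha (.deref he) he' hk hk' hρ hM h)
          · exact ih ha he he' hk hk' hρ hM h
      | _ => exact ha.elim

/-- Induction on the type along a single path to the target. As one disjunct suffices at every
stage, monotonicity in `i` is not needed. -/
theorem exists_sat_reachIn {a c : Ty} (ha : a.IsFinite) {Γ : FEnv} {Δ : Env} {ρ : Reading}
    {M : Model} {e e' : LTerm} {k : ℕ} (he : e.HasType Γ a) (he' : e'.HasType Γ (.ref c))
    (hk : e.VarsBelow k) (hk' : e'.VarsBelow k) (hρ : ρ.Interprets Γ Δ) (hM : IsModel Δ M)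
    (hr : Reaches ρ M e e') : ∃ i, (Formula.reachIn i a k e e').Sat Δ M ρ := by
  induction a generalizing Γ Δ ρ M e e' k with
  | unit => exact (not_reaches_unit he hρ hM hr).elim
  | bool => exact (not_reaches_bool he hρ hM hr).elim
  | nat => exact (not_reaches_nat he hρ hM hr).elim
  | prod a b iha ihb =>
      have he₂' := (he'.bind hk' a).bind (hk'.mono k.le_succ) b
      have hk₂' : e'.VarsBelow (k + 2) := hk'.mono (by omega)
      obtain ⟨Δ', ρ', M', hρ', hM', hr, hs⟩ := exists_model_prod ha.1 ha.2 he he' hk hk' hρ hM hr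
      rcases hr with hr | hr
      · obtain ⟨i, hi⟩ := iha (k := k + 2) ha.1 (bind_bind_var Γ k a b) he₂'
          (by simp [LTerm.VarsBelow]) hk₂' hρ' hM' hr
        exact ⟨i + 1, Formula.sat_or.2 (.inl (hs _ _ (.inl hi)))⟩
      · obtain ⟨i, hi⟩ := ihb (k := k + 2) ha.2 (.bind_var (Γ.bind k a) (k + 1) b) he₂'
          (by simp [LTerm.VarsBelow]) hk₂' hρ' hM' hr
        exact ⟨i + 1, Formula.sat_or.2 (.inl (hs _ _ (.inr hi)))⟩
  | sum a b iha ihb =>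
      have hk₁' : e'.VarsBelow (k + 1) := hk'.mono k.le_succ
      obtain ⟨Δ', ρ', M', hρ', hM', hr, hs⟩ | ⟨Δ', ρ', M', hρ', hM', hr, hs⟩ :=
        exists_model_sum ha.1 ha.2 he he' hk hk' hρ hM hr
      · obtain ⟨i, hi⟩ := iha ha.1 (.bind_var Γ k a) (he'.bind hk' a) (Nat.lt_succ_self k) hk₁'
          hρ' hM' hr
        exact ⟨i + 1, Formula.sat_or.2 (.inl (Formula.sat_or.2 (.inl (hs _ hi))))⟩
      · obtain ⟨i, hi⟩ := ihb ha.2 (.bind_var Γ k b) (he'.bind hk' b) (Nat.lt_succ_self k) hk₁'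
          hρ' hM' hr
        exact ⟨i + 1, Formula.sat_or.2 (.inl (Formula.sat_or.2 (.inr (hs _ hi))))⟩
  | ref a ih =>
      rcases sat_eq_or_reaches_deref he hρ hM hr with h | h
      · exact ⟨0, h⟩
      · obtain ⟨i, hi⟩ := ih (k := k) ha (.deref he) he' hk hk' hρ hM h
        exact ⟨i + 1, Formula.sat_or.2 (.inl hi)⟩
  | _ => exact ha.elim

/-! ### Elimination of reachability predicates -/

namespace Formula

theorem noReach_reachO (a : Ty) (k : ℕ) (e e' : LTerm) : (reachO a k e e').NoReach := by
  induction a generalizing k e <;> simp_all [reachO, NoReach, or, ex, fls]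

theorem wf_reachO {a c : Ty} (ha : a.IsFinite) {Γ : FEnv} {e e' : LTerm} {k : ℕ}
    (he : e.HasType Γ a) (he' : e'.HasType Γ (.ref c)) (hk : e.VarsBelow k)
    (hk' : e'.VarsBelow k) : (reachO a k e e').WF Γ := by
  induction a generalizing Γ e k with
  | unit | bool | nat => exact ⟨⟨.nat, .nat 1⟩, .nat, .nat 1⟩
  | prod a b iha ihb =>
      have he₂' := (he'.bind hk' a).bind (hk'.mono k.le_succ) b
      have hk₂' : e'.VarsBelow (k + 2) := hk'.mono (by omega)
      have hx := bind_bind_var Γ k a b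
      have hy := LTerm.HasType.bind_var (Γ.bind k a) (k + 1) b
      exact ⟨ha.1.closed.1, ha.2.closed.1,
        ⟨⟨_, (he.bind hk a).bind (hk.mono k.le_succ) b⟩, _, .pair hx hy⟩,
        iha ha.1 hx he₂' (by simp [LTerm.VarsBelow]) hk₂',
        ihb ha.2 hy he₂' (by simp [LTerm.VarsBelow]) hk₂'⟩
  | sum a b iha ihb =>
      have hk₁' : e'.VarsBelow (k + 1) := hk'.mono k.le_succ
      exact ⟨⟨ha.1.closed.1, ⟨⟨_, he.bind hk a⟩, _,
          .inl ha.1.closed.1 ha.2.closed.1 (.bind_var Γ k a)⟩,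
          iha ha.1 (.bind_var Γ k a) (he'.bind hk' a) (Nat.lt_succ_self k) hk₁'⟩,
        ha.2.closed.1, ⟨⟨_, he.bind hk b⟩, _,
          .inr ha.1.closed.1 ha.2.closed.1 (.bind_var Γ k b)⟩,
          ihb ha.2 (.bind_var Γ k b) (he'.bind hk' b) (Nat.lt_succ_self k) hk₁'⟩
  | ref a ih => exact ⟨⟨⟨_, he⟩, _, he'⟩, ih (e := .deref e) ha (.deref he) he' hk hk'⟩
  | _ => exact ha.elim

theorem isModel_push_loc {Δ : Env} {M : Model} {l : ℕ} {a : Ty}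
    (hM : IsModel ⟨Δ.vars, Function.update Δ.locs l (some a)⟩ M) :
    IsModel (Env.snoc ⟨Δ.vars, Function.update Δ.locs l (some a)⟩ (.ref a))
      (M.push (.loc l)) := by
  obtain ⟨hf, S, hS⟩ := isModel_iff.1 hM
  have hl : S l = some a := hS.locs l a (by simp)
  have hc := hS.locs_closed l a hl
  exact isModel_iff.2 ⟨hf, S, hS.push ⟨hc.1, hc.2⟩ trivial (.loc hl)⟩

theorem isModel_of_evolves {Δ Δ' : Env} {M M' : Model} (hM : IsModel Δ M)
    (h : Evolves Δ M Δ' M') : IsModel Δ' M' := by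
  cases h with
  | refl => exact hM
  | run _ hr => exact hr.2.1

/-- Equivalence speaks only about models that the reading interprets, so every connective has to
pass this condition on to the models in which its subformulae are evaluated: extended, updated,
evolved, or with a hidden location made free. -/
theorem exists_noReach (C : Formula) : ∀ Γ : FEnv, C.WF Γ → C.FiniteReach Γ →
    ∃ C' : Formula, C'.WF Γ ∧ C'.NoReach ∧ Equivalent Γ C C' := by
  induction C with
  | eq e e' => exact fun Γ h _ => ⟨eq e e', h, trivial, fun _ _ _ _ _ => .rfl⟩
  | neg C ih =>
      intro Γ h hf
      obtain ⟨C', h₁, h₂, h₃⟩ := ih Γ h hf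
      exact ⟨neg C', h₁, h₂, fun Δ ρ M hρ hM => not_congr (h₃ Δ ρ M hρ hM)⟩
  | and C D ihC ihD =>
      intro Γ h hf
      obtain ⟨C', h₁, h₂, h₃⟩ := ihC Γ h.1 hf.1
      obtain ⟨D', g₁, g₂, g₃⟩ := ihD Γ h.2 hf.2
      exact ⟨and C' D', ⟨h₁, g₁⟩, ⟨h₂, g₂⟩, fun Δ ρ M hρ hM =>
        and_congr (h₃ Δ ρ M hρ hM) (g₃ Δ ρ M hρ hM)⟩
  | all x a C ih =>
      intro Γ h hf
      obtain ⟨C', h₁, h₂, h₃⟩ := ih _ h.2 hf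
      exact ⟨all x a C', ⟨h.1, h₁⟩, h₂, fun Δ ρ M hρ hM => forall₄_congr fun L M' hL hR =>
        h₃ _ _ _ (hρ.bind x a) hR.2.1⟩
  | nuAll x a C ih =>
      intro Γ h hf
      obtain ⟨C', h₁, h₂, h₃⟩ := ih _ h.2 hf
      refine ⟨nuAll x a C', ⟨h.1, h₁⟩, h₂, fun Δ ρ M hρ hM => forall₅_congr fun l M' hl _ hM' =>
        forall_congr' fun _ => h₃ _ _ _ ?_ (isModel_push_loc hM')⟩
      exact (hρ.updateLocs hl (a.inst ρ.tys)).bind_of_eq x rfl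
  | allT X C ih =>
      intro Γ h hf
      obtain ⟨C', h₁, h₂, h₃⟩ := ih _ h.2 hf
      exact ⟨allT X C', ⟨h.1, h₁⟩, h₂, fun Δ ρ M hρ hM => forall₂_congr fun a ha =>
        h₃ _ _ _ (hρ.bindT h.1 ha) hM⟩
  | allCon e C ih =>
      intro Γ h hf
      obtain ⟨C', h₁, h₂, h₃⟩ := ih _ h.2 hf
      exact ⟨allCon e C', ⟨h.1, h₁⟩, h₂, fun Δ ρ M hρ hM => forall₅_congr fun L a l V c =>
        forall₅_congr fun _ _ _ _ hM' => h₃ _ _ _ hρ hM'⟩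
  | eval e e' x b C ih =>
      intro Γ h hf
      obtain ⟨C', h₁, h₂, h₃⟩ := ih _ h.2.2 hf
      exact ⟨eval e e' x b C', ⟨h.1, h.2.1, h₁⟩, h₂, fun Δ ρ M hρ hM => exists_congr fun M' =>
        and_congr_right fun hR => h₃ _ _ _ (hρ.bind x b) hR.2.1⟩
  | located e e' x b C ws ih =>
      intro Γ h hf
      obtain ⟨C', h₁, h₂, h₃⟩ := ih _ h.2.2.1 hf
      exact ⟨located e e' x b C' ws, ⟨h.1, h.2.1, h₁, h.2.2.2⟩, h₂, fun Δ ρ M hρ hM =>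
        -- The clause about the written locations does not mention `C`, so it is unaffected.
        exists_congr fun M' => and_congr_right fun hR =>
          and_congr_left fun _ => h₃ _ _ _ (hρ.bind x b) hR.2.1⟩
  | box C ih =>
      intro Γ h hf
      obtain ⟨C', h₁, h₂, h₃⟩ := ih _ h hf
      exact ⟨box C', h₁, h₂, fun Δ ρ M hρ hM => forall₃_congr fun Δ' M' hE =>
        h₃ _ _ _ (hρ.evolves hE) (isModel_of_evolves hM hE)⟩
  | reach e e' =>
      intro Γ h hf
      obtain ⟨-, b, he'⟩ := h
      obtain ⟨a, ha, he⟩ := hf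
      obtain ⟨i, hi⟩ := e.exists_varsBelow
      obtain ⟨j, hj⟩ := e'.exists_varsBelow
      -- Bound names are taken above all names in both terms, which avoids capture.
      have hk : e.VarsBelow (max i j) := hi.mono (le_max_left i j)
      have hk' : e'.VarsBelow (max i j) := hj.mono (le_max_right i j)
      exact ⟨reachO a (max i j) e e', wf_reachO ha he he' hk hk', noReach_reachO _ _ _ _,
        fun Δ ρ M hρ hM => (sat_reach_iff ha he he' hρ hM).trans
          (sat_reachO_iff ha he he' hk hk' hρ hM).symm⟩

end Formula

end LocalState

/-! ### The theorem -/

theorem mainTheorem5 :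
    (∀ (Γ : LocalState.FEnv) (C : LocalState.Formula), C.WF Γ → C.FiniteReach Γ →
      ∃ C' : LocalState.Formula, C'.WF Γ ∧ C'.NoReach ∧ LocalState.Formula.Equivalent Γ C C') ∧
    (∀ (Γ : LocalState.FEnv) (a b : LocalState.Ty) (e e' : LocalState.LTerm) (k : ℕ),
      a.IsFinite → e.HasType Γ a → e'.HasType Γ (.ref b) → e.VarsBelow k → e'.VarsBelow k →
      ∀ (Δ : LocalState.Env) (ρ : LocalState.Reading) (M : LocalState.Model),
        ρ.Interprets Γ Δ → LocalState.IsModel Δ M →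
        ((LocalState.Formula.reach e e').Sat Δ M ρ ↔
          ∃ i : ℕ, (LocalState.Formula.reachIn i a k e e').Sat Δ M ρ) ∧
        ((LocalState.Formula.reachO a k e e').Sat Δ M ρ ↔
          ∃ i : ℕ, (LocalState.Formula.reachIn i a k e e').Sat Δ M ρ) ∧
        ((LocalState.Formula.reach e e').Sat Δ M ρ ↔
          (LocalState.Formula.reachO a k e e').Sat Δ M ρ)) := by
  refine ⟨fun Γ C => C.exists_noReach Γ, ?_⟩
  intro Γ a b e e' k ha he he' hk hk' Δ ρ M hρ hM
  have hI : (∃ i : ℕ, (LocalState.Formula.reachIn i a k e e').Sat Δ M ρ) ↔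
      LocalState.Reaches ρ M e e' :=
    ⟨fun ⟨i, hi⟩ => LocalState.reaches_of_sat_reachIn i ha he he' hk hk' hρ hM hi,
      LocalState.exists_sat_reachIn ha he he' hk hk' hρ hM⟩
  rw [hI, LocalState.sat_reach_iff ha he he' hρ hM,
    LocalState.sat_reachO_iff ha he he' hk hk' hρ hM]
  exact ⟨.rfl, .rfl, .rfl⟩
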